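/- Let $J^1(S^1)=\{(x,y,z): x\in S^1=[0,1]/(0\sim 1),\ y,z\in\mathbb R\}$ with contact structure $\ker(dz-y\,dx)$. Let $L$ be a (smooth, closed, embedded) Legendrian link in $J^1(S^1)$ whose front projection $Z$ (its image under $(x,y,z)\mapsto (x,z)$) is generic: its only singularities are semicubical cusps and transverse double points, these are pairwise distinct points of the annulus, and none of them lies over $x=0$ (several may have the same $x$-coordinate). Such a front has finitely many singularities, so cutting the annulus open along $x=0$ presents it as a left-to-right sequence of left cusps, right cusps and crossings. Let $n$ be the number of strands of $Z$ over $x=0$. The resolution $Y$ of $Z$ is the link diagram in the annulus $S^1\times\mathbb R$ obtained from $Z$ as follows. - Each left cusp is replaced by a smooth left turning point (a vertical tangency with the curve on its right). Each right cusp is replaced by a crossing of its two branches followed on the right by a smooth right turning point. Each crossing of $Z$ becomes a crossing of $Y$. At all these crossings the overstrand is the strand of lesser slope. - At the very right, just before $x=1$, the $n$-strand tangle $T_n$ is appended. Here $T_0$ is empty, $T_1$ is the trivial one-strand tangle, and for $n\ge 2$ the tangle $T_n$ consists of $T_{n-1}$ on the lowest $n-1$ strands, followed on its right by the top strand descending across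 all the other $n-1$ strands and then ascending back across all of them to the top, being the overstrand at all of these $2(n-1)$ crossings. Then there is a Legendrian link $L'$, Legendrian isotopic to $L$ (through a smooth family of Legendrian links), whose Lagrangian projection (its image under $(x,y,z)\mapsto (x,y)$, the strand with larger $z$ being the overstrand at each double point) is generic and is, up to planar isotopy of the annulus, the link diagram $Y$. -/

import Mathlib

open scoped ContDiff

noncomputable section

/-! ### Legendrian links in the 1-jet space of the circle

The circle is `ℝ / ℤ`, that is `[0, 1]` with its end points identified, and `J¹(S¹)` is
`S¹ × ℝ × ℝ` with coordinates `(x, y, z)` and contact structure `ker (dz - y dx)`. -/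

/-- A parametrized Legendrian link in `J¹(S¹)`. Each component is a smooth closed curve of
period `1`; its `S¹`-valued coordinate is given by a lift `x i : ℝ → ℝ` of degree `degree i`. -/
structure LegendrianLink (ι : Type*) where
  x : ι → ℝ → ℝ
  y : ι → ℝ → ℝ
  z : ι → ℝ → ℝ
  degree : ι → ℤ
  smooth_x : ∀ i, ContDiff ℝ ∞ (x i)
  smooth_y : ∀ i, ContDiff ℝ ∞ (y i)
  smooth_z : ∀ i, ContDiff ℝ ∞ (z i)
  x_add_one : ∀ i t, x i (t + 1) = x i t + degree i
  periodic_y : ∀ i, Function.Periodic (y i) 1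
  periodic_z : ∀ i, Function.Periodic (z i) 1
  immersed : ∀ i t, ¬ (deriv (x i) t = 0 ∧ deriv (y i) t = 0 ∧ deriv (z i) t = 0)
  embedded : ∀ i j s t, (∃ n : ℤ, x i s = x j t + n) → y i s = y j t → z i s = z j t →
    i = j ∧ ∃ n : ℤ, s = t + n
  legendrian : ∀ i t, deriv (z i) t = y i t * deriv (x i) t

/-- Legendrian isotopy: a path of Legendrian links, over the time interval `[0, 1]`, that is
jointly smooth in the time and the parameter of the link. -/
def LegendrianIsotopic {ι : Type*} (L L' : LegendrianLink ι) : Prop :=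
  ∃ F : ℝ → LegendrianLink ι, F 0 = L ∧ F 1 = L' ∧ ∀ i,
    ContDiffOn ℝ ∞ (fun q : ℝ × ℝ => (F q.1).x i q.2) (Set.Icc 0 1 ×ˢ Set.univ) ∧
    ContDiffOn ℝ ∞ (fun q : ℝ × ℝ => (F q.1).y i q.2) (Set.Icc 0 1 ×ˢ Set.univ) ∧
    ContDiffOn ℝ ∞ (fun q : ℝ × ℝ => (F q.1).z i q.2) (Set.Icc 0 1 ×ˢ Set.univ)

/-! ### Projections to the annulus

A projection of a link to the annulus `S¹ × ℝ` is given by the lifts `x` of the horizontal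
coordinate and by the vertical coordinate `v` (`v = z` for the front projection, `v = y` for the
Lagrangian projection). -/

namespace Projection

variable {ι : Type*}

/-- The points of the abstract link, each taken once: a component, and a parameter modulo `1`. -/
def Par (ι : Type*) : Set (ι × ℝ) := {p | p.2 ∈ Set.Ico (0 : ℝ) 1}

/-- The image of a point in the annulus cut open along `x = 0`, that is in `[0, 1) × ℝ`. -/
def point (x v : ι → ℝ → ℝ) (p : ι × ℝ) : ℝ × ℝ := (Int.fract (x p.1 p.2), v p.1 p.2)

/-- The derivative of one coordinate at a point of the link. -/
def der (u : ι → ℝ → ℝ) (p : ι × ℝ) : ℝ := deriv (u p.1) p.2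

/-- The second derivative of one coordinate at a point of the link. -/
def der2 (u : ι → ℝ → ℝ) (p : ι × ℝ) : ℝ := deriv (deriv (u p.1)) p.2

/-- The curve turns round at `p`, and lies locally to the right of the image of `p`. -/
def LeftTurn (x : ι → ℝ → ℝ) (p : ι × ℝ) : Prop := der x p = 0 ∧ 0 < der2 x p

/-- The curve turns round at `p`, and lies locally to the left of the image of `p`. -/
def RightTurn (x : ι → ℝ → ℝ) (p : ι × ℝ) : Prop := der x p = 0 ∧ der2 x p < 0

/-- Genericity. The points at which the projection has no well-defined slope `dv/dx` are
nondegenerate (for a front: semicubical cusps; for a Lagrangian projection: simple vertical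
tangencies); the multiple points are transverse double points away from those points; and nothing
of this happens over the cut `x = 0`. Several singularities may have the same `x`-coordinate. -/
structure Generic (x v : ι → ℝ → ℝ) : Prop where
  nondegenerate : ∀ p ∈ Par ι, der x p = 0 → der2 x p ≠ 0
  double_ne_turn : ∀ p ∈ Par ι, ∀ q ∈ Par ι, p ≠ q → point x v p = point x v q → der x p ≠ 0
  transverse : ∀ p ∈ Par ι, ∀ q ∈ Par ι, p ≠ q → point x v p = point x v q →
    der v p * der x q ≠ der v q * der x p
  no_triple : ∀ p ∈ Par ι, ∀ q ∈ Par ι, ∀ r ∈ Par ι, p ≠ q → q ≠ r → p ≠ r →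
    ¬ (point x v p = point x v q ∧ point x v q = point x v r)
  turn_off_cut : ∀ p ∈ Par ι, der x p = 0 → (point x v p).1 ≠ 0
  double_off_cut : ∀ p ∈ Par ι, ∀ q ∈ Par ι, p ≠ q → point x v p = point x v q →
    (point x v p).1 ≠ 0

/-- The points of the annulus at which the projection has a turning point or a double point. -/
def Singular (x v : ι → ℝ → ℝ) (P : ℝ × ℝ) : Prop :=
  (∃ p ∈ Par ι, point x v p = P ∧ der x p = 0) ∨
  (∃ p ∈ Par ι, ∃ q ∈ Par ι, p ≠ q ∧ point x v p = P ∧ point x v q = P)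

/-- The number of strands over the cut `x = 0`. -/
def strandsAtCut (x : ι → ℝ → ℝ) : ℕ := {p ∈ Par ι | Int.fract (x p.1 p.2) = 0}.ncard

/-- The number of strands immediately to the left of the vertical line through `P` that reach that
line below `P`: each point of this part of the line counts once, except that a right turning
point is reached from the left by two strands and a left turning point by none. -/
def strandsBelow (x v : ι → ℝ → ℝ) (P : ℝ × ℝ) : ℕ :=
  {p ∈ Par ι | (point x v p).1 = P.1 ∧ (point x v p).2 < P.2 ∧ der x p ≠ 0}.ncard +
  2 * {p ∈ Par ι | (point x v p).1 = P.1 ∧ (point x v p).2 < P.2 ∧ RightTurn x p}.ncard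

/-- Reading the singularities of a projection from left to right, starting at the cut, gives the
word `w`; singularities with the same `x`-coordinate are read from top to bottom. The relation
`R P e` says that `e` describes the singularity at `P`. -/
def Reads {E : Type} (x v : ι → ℝ → ℝ) (R : ℝ × ℝ → E → Prop) (w : List E) : Prop :=
  ∃ l : List (ℝ × ℝ),
    l.Pairwise (fun P Q => P.1 < Q.1 ∨ (P.1 = Q.1 ∧ Q.2 < P.2)) ∧
    (∀ P, P ∈ l ↔ Singular x v P) ∧
    List.Forall₂ R l w

end Projection

/-! ### Fronts -/

inductive FrontKind
  | leftCusp
  | rightCusp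
  | crossing

/-- A singularity of a front, together with the number `pos` of strands below it. Strands are
numbered from bottom to top, starting with `0`: a crossing exchanges the strands `pos` and
`pos + 1`, a right cusp joins and ends them, and a left cusp begins two strands which become the
strands `pos` and `pos + 1`. -/
structure FrontEvent where
  kind : FrontKind
  pos : ℕ

/-- A front diagram in the annulus, cut open at `x = 0`: the number of strands over the cut, and
the singularities from left to right. -/
structure FrontDiagram where
  strands : ℕ
  word : List FrontEvent

/-! ### Link diagrams -/

/-- The elementary pieces of a link diagram in the annulus: a left turning point, a right turning
point, and the two kinds of crossings, according to whether the overstrand is the one of lesser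
or of greater slope. -/
inductive DiagramKind
  | leftTurn
  | rightTurn
  | lesserOver
  | greaterOver

/-- The number of strands that enter an elementary piece from the left. -/
def DiagramKind.inputs : DiagramKind → ℕ
  | .leftTurn => 0
  | .rightTurn => 2
  | .lesserOver => 2
  | .greaterOver => 2

/-- The number of strands that leave an elementary piece on the right. -/
def DiagramKind.outputs : DiagramKind → ℕ
  | .leftTurn => 2
  | .rightTurn => 0
  | .lesserOver => 2
  | .greaterOver => 2

/-- An elementary piece of a link diagram, with the number `pos` of strands below it. -/
structure DiagramEvent where
  kind : DiagramKind
  pos : ℕ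

/-- A link diagram in the annulus, cut open at `x = 0`: the number of strands over the cut, and
the elementary pieces from left to right. -/
structure LinkDiagram where
  strands : ℕ
  word : List DiagramEvent

/-- The planar isotopy that moves two consecutive pieces past each other horizontally, where the
second piece `f` lies below the first piece `e`, with `m` strands between them. -/
inductive PlanarMove : List DiagramEvent → List DiagramEvent → Prop
  | swap (u w : List DiagramEvent) (e f : DiagramKind) (k m : ℕ) :
      PlanarMove (u ++ [⟨e, k + f.inputs + m⟩, ⟨f, k⟩] ++ w)
        (u ++ [⟨f, k⟩, ⟨e, k + f.outputs + m⟩] ++ w)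

/-- Two link diagrams in the annulus are related by planar isotopies which only move elementary
pieces, over disjoint groups of strands, past each other. -/
def LinkDiagram.PlanarIsotopic (D D' : LinkDiagram) : Prop :=
  D.strands = D'.strands ∧ Relation.EqvGen PlanarMove D.word D'.word

/-! ### The two diagrams of a Legendrian link -/

namespace LegendrianLink

open Projection

variable {ι : Type*}

/-- The front (`xz`-) projection is generic. -/
def GenericFront (L : LegendrianLink ι) : Prop := Generic L.x L.z

/-- `e` describes the singularity of the front projection at the point `P`. -/
def IsFrontEvent (L : LegendrianLink ι) (P : ℝ × ℝ) (e : FrontEvent) : Prop :=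
  e.pos = strandsBelow L.x L.z P ∧
  match e.kind with
  | .leftCusp => ∃ p ∈ Par ι, point L.x L.z p = P ∧ LeftTurn L.x p
  | .rightCusp => ∃ p ∈ Par ι, point L.x L.z p = P ∧ RightTurn L.x p
  | .crossing => ∃ p ∈ Par ι, ∃ q ∈ Par ι, p ≠ q ∧ point L.x L.z p = P ∧ point L.x L.z q = P

/-- The front projection of `L` is generic and is given by the front diagram `Z`. -/
def HasFront (L : LegendrianLink ι) (Z : FrontDiagram) : Prop :=
  L.GenericFront ∧ Z.strands = strandsAtCut L.x ∧ Reads L.x L.z L.IsFrontEvent Z.word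

/-- The slope `dy/dx` of the Lagrangian projection. It is only used at crossings of a generic
projection, where `dx ≠ 0`. -/
def slope (L : LegendrianLink ι) (p : ι × ℝ) : ℝ := der L.y p / der L.x p

/-- `p` and `q` are the two points of `L` over a crossing of the Lagrangian projection at `P`, and
`p` lies above `q`, the `z`-axis pointing to the viewer. -/
def CrossesOver (L : LegendrianLink ι) (P : ℝ × ℝ) (p q : ι × ℝ) : Prop :=
  p ∈ Par ι ∧ q ∈ Par ι ∧ p ≠ q ∧ point L.x L.y p = P ∧ point L.x L.y q = P ∧
    L.z q.1 q.2 < L.z p.1 p.2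

/-- `e` describes the turning point or crossing of the Lagrangian projection at `P`. -/
def IsLagrangianEvent (L : LegendrianLink ι) (P : ℝ × ℝ) (e : DiagramEvent) : Prop :=
  e.pos = strandsBelow L.x L.y P ∧
  match e.kind with
  | .leftTurn => ∃ p ∈ Par ι, point L.x L.y p = P ∧ LeftTurn L.x p
  | .rightTurn => ∃ p ∈ Par ι, point L.x L.y p = P ∧ RightTurn L.x p
  | .lesserOver => ∃ p q, L.CrossesOver P p q ∧ L.slope p < L.slope q
  | .greaterOver => ∃ p q, L.CrossesOver P p q ∧ L.slope q < L.slope p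

/-- The Lagrangian (`xy`-) projection of `L` is generic and is given by the link diagram `D`. -/
def HasLagrangianDiagram (L : LegendrianLink ι) (D : LinkDiagram) : Prop :=
  Generic L.x L.y ∧ D.strands = strandsAtCut L.x ∧ Reads L.x L.y L.IsLagrangianEvent D.word

end LegendrianLink

/-! ### The resolution of a front -/

/-- Resolution of a singularity: a left cusp becomes a smooth left turning point, a right cusp
becomes a crossing followed by a smooth right turning point, and a crossing stays a crossing; at
each crossing the strand of lesser slope is the overstrand. -/
def FrontEvent.resolve (e : FrontEvent) : List DiagramEvent :=
  match e.kind with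
  | .leftCusp => [⟨.leftTurn, e.pos⟩]
  | .rightCusp => [⟨.lesserOver, e.pos⟩, ⟨.rightTurn, e.pos⟩]
  | .crossing => [⟨.lesserOver, e.pos⟩]

/-- The strand with `n` strands below it goes down across all of these, and then back up across
all of them, each time as the overstrand. -/
def dip (n : ℕ) : List DiagramEvent :=
  (List.range n).reverse.map (fun k => ⟨.lesserOver, k⟩) ++
  (List.range n).map (fun k => ⟨.greaterOver, k⟩)

/-- The tangle `T_n`: the tangle `T_1` is trivial, and `T_{n+1}` consists of `T_n` on the lowest
`n` strands, followed by a dip of the top strand. -/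
def transitionTangle : ℕ → List DiagramEvent
  | 0 => []
  | n + 1 => transitionTangle n ++ dip n

/-- The resolution of a front: resolve each singularity, and append `T_n` at the very right, where
`n` is the number of strands there. -/
def FrontDiagram.resolution (Z : FrontDiagram) : LinkDiagram where
  strands := Z.strands
  word := Z.word.flatMap FrontEvent.resolve ++ transitionTangle Z.strands

end

/-! A fibrewise diffeomorphism `(x, z) ↦ (x, g (x, z))` of the annulus induces a contact
transformation: the new height is `g`, the new slope is `g_x + g_z * y`. The straight line from the
identity to such a map consists of maps of the same kind, so the image of `L` is Legendrian isotopic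
to `L` (`legendrianIsotopic_deform`). Everything rests on one choice of `g`. With `z + c ≥ 1` on the
link, take `g = (z + c) * exp ((x - S (x - τ z)) / ε)`, where `S` is a smooth staircase that rises
by `1` in a short window once per period, `τ` is nondecreasing, and `ε` is small. Since `S` has
degree one, `g` is periodic in `x`.

Left of a thin strip before the cut, `S = 0` and the new slope is `ε⁻¹ * exp (x / ε) * (z + ε * y +
c)` (`Strip.link_y_outer`). On each vertical line this is an increasing affine function of `z + ε *
y`, so the crossings of the Lagrangian projection are those of the perturbed front `(x, z + ε * y)`.
At a left cusp the differences of `z` and `y` over a vertical chord have the same sign and cannot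
cancel, so the cusp opens without a double point (`eventually_not_isDouble_of_leftTurn`). At a right
cusp they have opposite signs and cancel on exactly one short chord, which gives the crossing of a
small loop (`exists_isResolution_rightTurn`). A crossing of the front persists and moves slightly to
the left, where the strand of lesser slope is the higher one (`exists_isResolution_crossing`).
Compactness excludes other double points (`eventually_isDouble_imp`).

In the strip the front has no singularities, and `τ` makes the strands pass the staircase in
disjoint successive windows, from the lowest strand to the highest. In its window a strand has slope
proportional to `Z * (1 - S') + ε * Y`, where `Z = z + c` and `Y = y`; this becomes negative where
`S' > 1`. The lower strands have already been scaled down by `exp (-1 / ε)`, and the higher ones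
have not been scaled yet. So the strand goes down once across all lower strands and comes back,
without meeting a higher one (`Staircase.eventually_dip`, `Strip.eventually_dips`). The order of `z`
along the fibres is unchanged, so the dipping strand is the overstrand. These dips form the tangle
`T_n`.

What remains is combinatorial. Crossings move to the left and turning points do not, so
singularities on one vertical line may be read in another order than in the resolution. Only a
crossing can overtake, and then it lies below the piece that it overtakes, which is an allowed
planar move (`pairwise_frontItems`, `eqvGen_of_perm`, `exists_lagrangianDiagram`). -/

/-! ### Reordering words of link diagrams -/

/-- The strict reading order of points: from left to right, and from top to bottom. -/
def ReadsBefore (P Q : ℝ × ℝ) : Prop := P.1 < Q.1 ∨ (P.1 = Q.1 ∧ Q.2 < P.2)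

theorem ReadsBefore.asymm {P Q : ℝ × ℝ} (h : ReadsBefore P Q) : ¬ ReadsBefore Q P := by
  rintro (h' | ⟨h1', h2'⟩) <;> rcases h with h | ⟨h1, h2⟩ <;> linarith

/-- There is a sorted version of every list of items placed at pairwise distinct points. -/
theorem exists_perm_pairwise_readsBefore {α : Type*} (f : α → ℝ × ℝ) (c : List α)
    (hc : (c.map f).Nodup) :
    ∃ a : List α, a.Perm c ∧ a.Pairwise (fun u v => ReadsBefore (f u) (f v)) := by
  classical
  -- Insertion sort needs a total relation, hence the non-strict reading order; strictness comes
  -- back at the end because the points are distinct.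
  let r : α → α → Prop := fun u v =>
    (f u).1 < (f v).1 ∨ ((f u).1 = (f v).1 ∧ (f v).2 ≤ (f u).2)
  have : Std.Total r := ⟨fun u v => by
    rcases lt_trichotomy (f u).1 (f v).1 with h | h | h
    · exact Or.inl (Or.inl h)
    · rcases le_total (f u).2 (f v).2 with h' | h'
      · exact Or.inr (Or.inr ⟨h.symm, h'⟩)
      · exact Or.inl (Or.inr ⟨h, h'⟩)
    · exact Or.inr (Or.inl h)⟩
  have : IsTrans α r := ⟨fun u v w h1 h2 => by
    rcases h1 with h1 | h1 <;> rcases h2 with h2 | h2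
    · exact Or.inl (h1.trans h2)
    · exact Or.inl (by rw [← h2.1]; exact h1)
    · exact Or.inl (by rw [h1.1]; exact h2)
    · exact Or.inr ⟨h1.1.trans h2.1, h2.2.trans h1.2⟩⟩
  have hp := List.perm_insertionSort r c
  refine ⟨c.insertionSort r, hp, ?_⟩
  have h1 := List.pairwise_insertionSort r c
  have h2 : ((c.insertionSort r).map f).Nodup := (hp.map f).nodup_iff.mpr hc
  rw [List.Nodup, List.pairwise_map] at h2
  refine (h1.and h2).imp ?_
  rintro u v ⟨h | h, hne⟩
  · exact Or.inl h
  · refine Or.inr ⟨h.1, lt_of_le_of_ne h.2 fun h' => hne (Prod.ext h.1 h'.symm)⟩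

/-- The piece `f` can be moved to the left past the piece `e`, which lies above it, and neither
position changes. -/
def SlidesLeft (e f : DiagramEvent) : Prop :=
  f.kind.inputs = 2 ∧ f.kind.outputs = 2 ∧ f.pos + 2 ≤ e.pos

theorem PlanarMove.append_left (u : List DiagramEvent) {v w : List DiagramEvent}
    (h : PlanarMove v w) : PlanarMove (u ++ v) (u ++ w) := by
  obtain ⟨u', w', e, f, k, m⟩ := h
  have := PlanarMove.swap (u ++ u') w' e f k m
  simpa [List.append_assoc] using this

theorem eqvGen_append_left (u : List DiagramEvent) {v w : List DiagramEvent}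
    (h : Relation.EqvGen PlanarMove v w) : Relation.EqvGen PlanarMove (u ++ v) (u ++ w) := by
  induction h with
  | rel _ _ h => exact .rel _ _ (h.append_left u)
  | refl _ => exact .refl _
  | symm _ _ _ ih => exact .symm _ _ ih
  | trans _ _ _ _ _ ih1 ih2 => exact .trans _ _ _ ih1 ih2

theorem SlidesLeft.planarMove {e f : DiagramEvent} (h : SlidesLeft e f)
    (w : List DiagramEvent) : PlanarMove (e :: f :: w) (f :: e :: w) := by
  obtain ⟨ek, ep⟩ := e
  obtain ⟨fk, fp⟩ := f
  obtain ⟨h1, h2, h3⟩ := h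
  obtain ⟨m, hm⟩ := Nat.exists_eq_add_of_le h3
  dsimp only at h1 h2 hm
  have := PlanarMove.swap [] w ek fk fp m
  rw [h1, h2, ← hm] at this
  simpa using this

theorem eqvGen_slide {f : DiagramEvent} (u : List DiagramEvent) (w : List DiagramEvent)
    (h : ∀ e ∈ u, SlidesLeft e f) :
    Relation.EqvGen PlanarMove (u ++ f :: w) (f :: (u ++ w)) := by
  induction u with
  | nil => exact .refl _
  | cons e u ih =>
    refine .trans _ (e :: f :: (u ++ w)) _ ?_ (.rel _ _ ((h e (by simp)).planarMove _))
    exact eqvGen_append_left [e] (ih fun e he => h e (by simp [he]))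

/-- A word in which each pair of pieces is in reading order, or can be exchanged, is planar
isotopic to the word in reading order. -/
theorem eqvGen_of_perm {α : Type*} (ev : α → DiagramEvent) (R : α → α → Prop)
    (hR : ∀ u v, R u v → ¬ R v u) (a c : List α) (hp : a.Perm c) (ha : a.Pairwise R)
    (hc : c.Pairwise fun u v => R u v ∨ SlidesLeft (ev u) (ev v)) :
    Relation.EqvGen PlanarMove (a.map ev) (c.map ev) := by
  induction a generalizing c with
  | nil => rw [hp.symm.eq_nil]; exact .refl _
  | cons h a ih =>
    have hmem : h ∈ c := hp.subset (by simp)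
    obtain ⟨c1, c2, rfl⟩ := List.append_of_mem hmem
    have hp' : a.Perm (c1 ++ c2) := by
      have := hp.trans List.perm_middle
      exact (List.perm_cons h).mp this
    have hsub : (c1 ++ c2).Sublist (c1 ++ h :: c2) :=
      List.Sublist.append_left (List.sublist_cons_self _ _) _
    rw [List.pairwise_cons] at ha
    have ih' := ih (c1 ++ c2) hp' ha.2 (hc.sublist hsub)
    rw [List.pairwise_append] at hc
    -- `h` is first in `a`, so whatever precedes it in `c` stands in the wrong order relative to `h`
    -- and must be one of the pieces that `h` can slide past.
    have hs : ∀ e ∈ c1.map ev, SlidesLeft e (ev h) := by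
      intro e he
      obtain ⟨x, hx, rfl⟩ := List.mem_map.mp he
      rcases hc.2.2 x hx h (by simp) with h1 | h1
      · exact absurd h1 (hR _ _ (ha.1 x (hp'.symm.subset (by simp [hx]))))
      · exact h1
    simp only [List.map_append, List.map_cons] at ih' ⊢
    exact .trans _ _ _ (eqvGen_append_left [ev h] ih') (.symm _ _ (eqvGen_slide _ _ hs))

/-! ### Contact transformations induced by fibrewise diffeomorphisms of the annulus -/

/-- A smooth map `(x, z) ↦ (x, g (x, z))` of the annulus, with the partial derivatives of `g`,
that preserves the orientation of the fibres over the half line `z > b`. -/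
structure FiberMap (b : ℝ) where
  g : ℝ × ℝ → ℝ
  gx : ℝ × ℝ → ℝ
  gz : ℝ × ℝ → ℝ
  smooth_g : ContDiff ℝ ∞ g
  smooth_gx : ContDiff ℝ ∞ gx
  smooth_gz : ContDiff ℝ ∞ gz
  hasFDerivAt : ∀ q, HasFDerivAt g
    (gx q • ContinuousLinearMap.fst ℝ ℝ ℝ + gz q • ContinuousLinearMap.snd ℝ ℝ ℝ) q
  periodic_g : ∀ x z, g (x + 1, z) = g (x, z)
  periodic_gx : ∀ x z, gx (x + 1, z) = gx (x, z)
  periodic_gz : ∀ x z, gz (x + 1, z) = gz (x, z)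
  gz_pos : ∀ x z, b < z → 0 < gz (x, z)

namespace FiberMap

variable {b : ℝ} (G : FiberMap b)

theorem apply_add_int {f : ℝ × ℝ → ℝ} (hf : ∀ x z, f (x + 1, z) = f (x, z)) (x z : ℝ) (n : ℤ) :
    f (x + n, z) = f (x, z) := by
  have : Function.Periodic (fun x => f (x, z)) 1 := fun x => hf x z
  simpa using this.int_mul n x

theorem strictMonoOn (x : ℝ) : StrictMonoOn (fun z => G.g (x, z)) (Set.Ioi b) := by
  have hd : ∀ z, HasDerivAt (fun z => G.g (x, z)) (G.gz (x, z)) z := by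
    intro z
    have h := (G.hasFDerivAt (x, z)).comp_hasDerivAt z ((hasDerivAt_const z x).prodMk (hasDerivAt_id z))
    rw [Function.comp_def] at h
    simpa using h
  refine strictMonoOn_of_deriv_pos (convex_Ioi b)
    (fun z _ => (hd z).continuousAt.continuousWithinAt) ?_
  intro z hz
  rw [interior_Ioi] at hz
  rw [(hd z).deriv]
  exact G.gz_pos x z hz

/-- The straight line from the identity to `G`. -/
def interpolate (s : ℝ) (hs : s ∈ Set.Icc (0 : ℝ) 1) : FiberMap b where
  g q := (1 - s) * q.2 + s * G.g q
  gx q := s * G.gx q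
  gz q := (1 - s) + s * G.gz q
  smooth_g := (contDiff_const.mul contDiff_snd).add (contDiff_const.mul G.smooth_g)
  smooth_gx := contDiff_const.mul G.smooth_gx
  smooth_gz := contDiff_const.add (contDiff_const.mul G.smooth_gz)
  hasFDerivAt q := by
    have h := ((hasFDerivAt_snd (𝕜 := ℝ) (E := ℝ) (F := ℝ) (p := q)).const_mul (1 - s)).add
      ((G.hasFDerivAt q).const_mul s)
    refine h.congr_fderiv ?_
    ext <;> simp
  periodic_g x z := by simp [G.periodic_g]
  periodic_gx x z := by simp [G.periodic_gx]
  periodic_gz x z := by simp [G.periodic_gz]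
  gz_pos x z hz := by
    have h := G.gz_pos x z hz
    obtain ⟨h0, h1⟩ := hs
    rcases h0.eq_or_lt with rfl | h0
    · simp
    · have := mul_pos h0 h
      linarith

end FiberMap

namespace LegendrianLink

variable {ι : Type*} (L : LegendrianLink ι) {b : ℝ}

theorem x_add_int (i : ι) (t : ℝ) (n : ℤ) : L.x i (t + n) = L.x i t + n * L.degree i := by
  have h : Function.Periodic (fun t => L.x i t - t * L.degree i) 1 := by
    intro t
    simp only [L.x_add_one]
    ring
  have := h.int_mul n t
  simp only [mul_one] at this
  linarith

/-- The image of a Legendrian link under the contact transformation induced by a fibre map. -/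
def deform (G : FiberMap b) (hb : ∀ i t, b < L.z i t) : LegendrianLink ι where
  x := L.x
  -- Forced by the contact condition: along `dz = y dx` the differential of `g` is `(g_x + g_z * y)
  -- dx`.
  y i t := G.gx (L.x i t, L.z i t) + G.gz (L.x i t, L.z i t) * L.y i t
  z i t := G.g (L.x i t, L.z i t)
  degree := L.degree
  smooth_x := L.smooth_x
  smooth_y i := (G.smooth_gx.comp ((L.smooth_x i).prodMk (L.smooth_z i))).add
    ((G.smooth_gz.comp ((L.smooth_x i).prodMk (L.smooth_z i))).mul (L.smooth_y i))
  smooth_z i := G.smooth_g.comp ((L.smooth_x i).prodMk (L.smooth_z i))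
  x_add_one := L.x_add_one
  periodic_y i t := by
    simp only [L.x_add_one, L.periodic_z i t, L.periodic_y i t,
      FiberMap.apply_add_int G.periodic_gx, FiberMap.apply_add_int G.periodic_gz]
  periodic_z i t := by
    simp only [L.x_add_one, L.periodic_z i t, FiberMap.apply_add_int G.periodic_g]
  immersed i t := by
    rintro ⟨h1, h2, h3⟩
    have hx := ((L.smooth_x i).differentiable (by simp) t).hasDerivAt
    have hy := ((L.smooth_y i).differentiable (by simp) t).hasDerivAt
    have hz := ((L.smooth_z i).differentiable (by simp) t).hasDerivAt
    -- Where `x' = 0` also `z' = 0`, so only the term `g_z * y'` survives in the derivative of the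
    -- new `y`.
    have hz0 : deriv (L.z i) t = 0 := by rw [L.legendrian, h1, mul_zero]
    rw [h1] at hx
    rw [hz0] at hz
    have hc := hx.prodMk hz
    have hgx := ((G.smooth_gx.differentiable (by simp)
      (L.x i t, L.z i t)).hasFDerivAt).comp_hasDerivAt t hc
    have hgz := ((G.smooth_gz.differentiable (by simp)
      (L.x i t, L.z i t)).hasFDerivAt).comp_hasDerivAt t hc
    have h00 : ((0 : ℝ), (0 : ℝ)) = 0 := rfl
    rw [h00, map_zero] at hgx hgz
    have h := (hgx.add (hgz.mul hy)).deriv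
    have h2' := h.symm.trans h2
    simp only [Function.comp_apply, zero_mul, zero_add, mul_eq_zero] at h2'
    rcases h2' with h' | h'
    · exact (G.gz_pos (L.x i t) (L.z i t) (hb i t)).ne' h'
    · exact L.immersed i t ⟨h1, h', hz0⟩
  embedded i j s t := by
    rintro ⟨n, hn⟩ hy hz
    simp only [hn, FiberMap.apply_add_int G.periodic_g, FiberMap.apply_add_int G.periodic_gx,
      FiberMap.apply_add_int G.periodic_gz] at hy hz
    have hz' := (G.strictMonoOn (L.x j t)).injOn (hb i s) (hb j t) hz
    rw [hz'] at hy
    have hy' := mul_left_cancel₀ (G.gz_pos (L.x j t) (L.z j t) (hb j t)).ne' (add_left_cancel hy)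
    exact L.embedded i j s t ⟨n, hn⟩ hy' hz'
  legendrian i t := by
    have hx := ((L.smooth_x i).differentiable (by simp) t).hasDerivAt
    have hz := ((L.smooth_z i).differentiable (by simp) t).hasDerivAt
    have h := (G.hasFDerivAt (L.x i t, L.z i t)).comp_hasDerivAt t (hx.prodMk hz)
    have h' := h.deriv
    rw [Function.comp_def] at h'
    rw [h', L.legendrian]
    simp
    ring

/-- The `z`-derivative of the interpolated map is a convex combination of `1` and a positive number,
so each stage is again a fibre map and its image is an embedded Legendrian link. -/
theorem legendrianIsotopic_deform (G : FiberMap b) (hb : ∀ i t, b < L.z i t) :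
    LegendrianIsotopic L (L.deform G hb) := by
  -- The isotopy must provide a link at every real time, but interpolation is available only on `[0,
  -- 1]`. Time is therefore clamped, which does not affect smoothness over `[0, 1]`.
  have hcl : ∀ s : ℝ, max 0 (min 1 s) ∈ Set.Icc (0 : ℝ) 1 := fun s =>
    ⟨le_max_left _ _, max_le zero_le_one (min_le_left _ _)⟩
  have hin : ∀ s ∈ Set.Icc (0 : ℝ) 1, max 0 (min 1 s) = s := fun s hs => by
    rw [min_eq_right hs.2, max_eq_right hs.1]
  refine ⟨fun s => L.deform (G.interpolate _ (hcl s)) hb, ?_, ?_, fun i => ⟨?_, ?_, ?_⟩⟩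
  · cases L
    simp [deform, FiberMap.interpolate]
  · cases L
    simp [deform, FiberMap.interpolate]
  · exact ((L.smooth_x i).comp contDiff_snd).contDiffOn
  · have hq : ContDiff ℝ ∞ (fun q : ℝ × ℝ => (L.x i q.2, L.z i q.2)) :=
      ((L.smooth_x i).comp contDiff_snd).prodMk ((L.smooth_z i).comp contDiff_snd)
    have : ContDiff ℝ ∞ (fun q : ℝ × ℝ => q.1 * G.gx (L.x i q.2, L.z i q.2) +
        ((1 - q.1) + q.1 * G.gz (L.x i q.2, L.z i q.2)) * L.y i q.2) :=
      (contDiff_fst.mul (G.smooth_gx.comp hq)).add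
        (((contDiff_const.sub contDiff_fst).add (contDiff_fst.mul (G.smooth_gz.comp hq))).mul
          ((L.smooth_y i).comp contDiff_snd))
    refine this.contDiffOn.congr ?_
    intro q hq
    simp only [deform, FiberMap.interpolate, hin q.1 hq.1]
  · have hq : ContDiff ℝ ∞ (fun q : ℝ × ℝ => (L.x i q.2, L.z i q.2)) :=
      ((L.smooth_x i).comp contDiff_snd).prodMk ((L.smooth_z i).comp contDiff_snd)
    have : ContDiff ℝ ∞ (fun q : ℝ × ℝ => (1 - q.1) * L.z i q.2 +
        q.1 * G.g (L.x i q.2, L.z i q.2)) :=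
      ((contDiff_const.sub contDiff_fst).mul ((L.smooth_z i).comp contDiff_snd)).add
        (contDiff_fst.mul (G.smooth_g.comp hq))
    refine this.contDiffOn.congr ?_
    intro q hq
    simp only [deform, FiberMap.interpolate, hin q.1 hq.1]

end LegendrianLink

section
open Set Filter Topology

/-! ### Real functions of one variable -/

/-- A tube lemma: the local conditions on the parameter are combined over a finite subcover. It is
used to pass from local statements near each point of the link to statements about the whole link.
-/
theorem IsCompact.eventually_forall_of_prod {X α : Type*} [TopologicalSpace X] {K : Set X}
    (hK : IsCompact K) {l : Filter α} {P : α → X → Prop}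
    (h : ∀ y ∈ K, ∀ᶠ q in l ×ˢ 𝓝 y, P q.1 q.2) : ∀ᶠ a in l, ∀ y ∈ K, P a y := by
  refine hK.induction_on (p := fun s => ∀ᶠ a in l, ∀ y ∈ s, P a y) (by simp) ?_ ?_ ?_
  · intro s t hst ht
    filter_upwards [ht] with a ha y hy using ha y (hst hy)
  · intro s t hs ht
    filter_upwards [hs, ht] with a ha hb y hy using hy.elim (ha y) (hb y)
  · intro y hy
    obtain ⟨p, hp, q, hq, hpq⟩ := Filter.eventually_prod_iff.mp (h y hy)
    refine ⟨{x | q x}, mem_nhdsWithin_of_mem_nhds hq, ?_⟩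
    filter_upwards [hp] with a ha y hy using hpq ha hy

/-- A continuous strictly increasing function on an interval has a continuous inverse. -/
theorem exists_continuous_inverse {f : ℝ → ℝ} {a b : ℝ} (hab : a ≤ b) (hf : Continuous f)
    (hm : StrictMonoOn f (Icc a b)) : ∃ σ : ℝ → ℝ, Continuous σ ∧
      (∀ t ∈ Icc a b, σ (f t) = t) ∧ ∀ x ∈ Icc (f a) (f b), σ x ∈ Icc a b ∧ f (σ x) = x := by
  let cl : ℝ → ℝ := fun t => max a (min b t)
  have hcl : ∀ t, cl t ∈ Icc a b := fun t => ⟨le_max_left _ _, max_le hab (min_le_left _ _)⟩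
  have hcl' : ∀ t ∈ Icc a b, cl t = t := fun t ht => by
    simp only [cl, min_eq_right ht.2, max_eq_right ht.1]
  have hclm : Monotone cl := fun s t h => max_le_max le_rfl (min_le_min le_rfl h)
  have hcld : Monotone fun t => t - cl t := by
    intro s t h
    simp only [cl]
    rcases le_total b s with h1 | h1 <;> rcases le_total b t with h2 | h2 <;>
    rcases le_total a s with h3 | h3 <;> rcases le_total a t with h4 | h4 <;>
    simp [h1, h2, h3, h4, hab] <;> linarith
  -- Extending `f` by rays of slope `1` beyond the interval gives an order isomorphism of the line,
  -- whose inverse is continuous for free.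
  let F : ℝ → ℝ := fun t => f (cl t) + (t - cl t)
  have hFm : StrictMono F := by
    intro s t h
    rcases (hclm h.le).eq_or_lt with h1 | h1
    · simp only [F, h1]; linarith
    · have h2 := hm (hcl s) (hcl t) h1
      have h3 := hcld h.le
      simp only [F] at h3 ⊢
      linarith
  have hFc : Continuous F := by
    have : Continuous cl := continuous_const.max (continuous_const.min continuous_id)
    exact (hf.comp this).add (continuous_id.sub this)
  have hFs : Function.Surjective F := by
    refine hFc.surjective ?_ ?_
    · refine tendsto_atTop_mono' atTop (f₁ := fun t => f b + (t - b)) ?_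
        (tendsto_atTop_add_const_left _ _ (tendsto_atTop_add_const_right _ _ tendsto_id))
      filter_upwards [eventually_ge_atTop b] with t ht
      simp [F, cl, min_eq_left ht, max_eq_right hab]
    · refine Tendsto.congr' ?_ (tendsto_atBot_add_const_left _ (f a)
        (tendsto_atBot_add_const_right _ (-a) tendsto_id))
      filter_upwards [eventually_le_atBot a] with t ht
      simp [F, cl, min_eq_right (ht.trans hab), max_eq_left ht, sub_eq_add_neg]
  let e := hFm.orderIsoOfSurjective F hFs
  have he : ∀ t ∈ Icc a b, e t = f t := fun t ht => by
    change F t = f t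
    simp [F, hcl' t ht]
  refine ⟨e.symm, e.symm.continuous, fun t ht => by rw [← he t ht, e.symm_apply_apply], ?_⟩
  intro x hx
  rw [← he a (left_mem_Icc.mpr hab), ← he b (right_mem_Icc.mpr hab)] at hx
  have h1 : e.symm x ∈ Icc a b := ⟨e.le_symm_apply.mpr hx.1, e.symm_apply_le.mpr hx.2⟩
  exact ⟨h1, by rw [← he _ h1, e.apply_symm_apply]⟩

section Sign

variable {f : ℝ → ℝ} {t₀ : ℝ}

/-- Either `f'` is positive at `t₀` already, or it decreases through zero there. These are the two
ways in which a curve can reach a vertical line from the left for parameters before `t₀`. -/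
theorem eventually_left_deriv_pos (hf : ContDiff ℝ ∞ f)
    (h : 0 < deriv f t₀ ∨ (deriv f t₀ = 0 ∧ deriv (deriv f) t₀ < 0)) :
    ∀ᶠ t in 𝓝[<] t₀, 0 < deriv f t := by
  rcases h with h | ⟨h0, h⟩
  · exact ((hf.continuous_deriv (by simp)).continuousAt.eventually_const_lt h).filter_mono
      nhdsWithin_le_nhds
  · have h1 := (eventually_nhdsWithin_sign_eq_of_deriv_neg h h0).filter_mono
      (nhdsWithin_le_nhds (s := Iio t₀))
    filter_upwards [h1, self_mem_nhdsWithin] with t ht htt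
    rw [sign_pos (sub_pos.mpr htt)] at ht
    exact sign_eq_one_iff.mp ht

theorem deriv_comp_neg_fun (f : ℝ → ℝ) : deriv (fun t => f (-t)) = fun t => -deriv f (-t) := by
  ext t; exact deriv_comp_neg f t

theorem deriv_deriv_comp_neg (f : ℝ → ℝ) (t : ℝ) :
    deriv (deriv fun t => f (-t)) t = deriv (deriv f) (-t) := by
  rw [deriv_comp_neg_fun, deriv.fun_neg, deriv_comp_neg, neg_neg]

theorem eventually_right_deriv_neg (hf : ContDiff ℝ ∞ f)
    (h : deriv f t₀ < 0 ∨ (deriv f t₀ = 0 ∧ deriv (deriv f) t₀ < 0)) :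
    ∀ᶠ t in 𝓝[>] t₀, deriv f t < 0 := by
  have := eventually_left_deriv_pos (f := fun t => f (-t)) (t₀ := -t₀) (hf.comp contDiff_neg) (by
    rw [deriv_deriv_comp_neg, deriv_comp_neg_fun]
    simpa using h)
  filter_upwards [(tendsto_neg_nhdsGT (a := t₀)).eventually this] with t ht
  rw [deriv_comp_neg_fun] at ht
  simpa using ht

theorem eventually_left_deriv_neg (hf : ContDiff ℝ ∞ f)
    (h : deriv f t₀ < 0 ∨ (deriv f t₀ = 0 ∧ 0 < deriv (deriv f) t₀)) :
    ∀ᶠ t in 𝓝[<] t₀, deriv f t < 0 := by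
  have hd : deriv (fun t => -f t) = fun t => -deriv f t := by ext t; exact deriv.fun_neg
  have := eventually_left_deriv_pos (f := fun t => -f t) (t₀ := t₀) hf.neg (by
    rw [hd, deriv.fun_neg]
    simpa using h)
  rw [hd] at this
  simpa using this

theorem eventually_right_deriv_pos (hf : ContDiff ℝ ∞ f)
    (h : 0 < deriv f t₀ ∨ (deriv f t₀ = 0 ∧ 0 < deriv (deriv f) t₀)) :
    ∀ᶠ t in 𝓝[>] t₀, 0 < deriv f t := by
  have hd : deriv (fun t => -f t) = fun t => -deriv f t := by ext t; exact deriv.fun_neg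
  have := eventually_right_deriv_neg (f := fun t => -f t) (t₀ := t₀) hf.neg (by
    rw [hd, deriv.fun_neg]
    simpa using h)
  rw [hd] at this
  simpa using this

theorem exists_Icc_left_of_eventually {p : ℝ → Prop} (h : ∀ᶠ t in 𝓝[<] t₀, p t) :
    ∃ a < t₀, ∀ t ∈ Ico a t₀, p t := by
  obtain ⟨a, ha, h⟩ := mem_nhdsLT_iff_exists_Ico_subset.mp h
  exact ⟨a, ha, fun t ht => h ht⟩

theorem exists_Icc_right_of_eventually {p : ℝ → Prop} (h : ∀ᶠ t in 𝓝[>] t₀, p t) :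
    ∃ b > t₀, ∀ t ∈ Ioc t₀ b, p t := by
  obtain ⟨a, ha, h⟩ := mem_nhdsGT_iff_exists_Ioc_subset.mp h
  exact ⟨a, ha, fun t ht => h ht⟩

theorem exists_strictMonoOn_left (hf : ContDiff ℝ ∞ f) (h : ∀ᶠ t in 𝓝[<] t₀, 0 < deriv f t) :
    ∃ a < t₀, StrictMonoOn f (Icc a t₀) ∧ ∀ t ∈ Ico a t₀, 0 < deriv f t := by
  obtain ⟨a, ha, h⟩ := exists_Icc_left_of_eventually h
  refine ⟨a, ha, strictMonoOn_of_deriv_pos (convex_Icc _ _) hf.continuous.continuousOn ?_, h⟩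
  intro t ht
  rw [interior_Icc] at ht
  exact h t ⟨ht.1.le, ht.2⟩

/-- The inverse of a function which increases up to `t₀`. -/
theorem exists_left_inverse (hf : ContDiff ℝ ∞ f) (h : ∀ᶠ t in 𝓝[<] t₀, 0 < deriv f t) :
    ∃ σ : ℝ → ℝ, Continuous σ ∧ σ (f t₀) = t₀ ∧
      (∀ᶠ ξ in 𝓝[<] (f t₀), f (σ ξ) = ξ ∧ 0 < deriv f (σ ξ) ∧
        HasDerivAt σ (deriv f (σ ξ))⁻¹ ξ ∧ σ ξ < t₀) ∧ ∀ᶠ t in 𝓝[<] t₀, σ (f t) = t := by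
  obtain ⟨a, ha, hm, hp⟩ := exists_strictMonoOn_left hf h
  obtain ⟨σ, hσ, h1, h2⟩ := exists_continuous_inverse ha.le hf.continuous hm
  have ha0 : f a < f t₀ := hm (left_mem_Icc.mpr ha.le) (right_mem_Icc.mpr ha.le) ha
  refine ⟨σ, hσ, h1 _ (right_mem_Icc.mpr ha.le), ?_, ?_⟩
  · filter_upwards [Ioo_mem_nhdsLT ha0] with ξ hξ
    obtain ⟨h3, h4⟩ := h2 ξ ⟨hξ.1.le, hξ.2.le⟩
    have h5 : σ ξ < t₀ := by
      refine lt_of_le_of_ne h3.2 fun h => ?_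
      rw [h] at h4
      exact hξ.2.ne' h4
    have h6 := hp _ ⟨h3.1, h5⟩
    refine ⟨h4, h6, ?_, h5⟩
    refine HasDerivAt.of_local_left_inverse hσ.continuousAt
      (hf.differentiable (by simp) _).hasDerivAt h6.ne' ?_
    filter_upwards [Ioo_mem_nhds hξ.1 hξ.2] with y hy using (h2 y ⟨hy.1.le, hy.2.le⟩).2
  · filter_upwards [Ioo_mem_nhdsLT ha] with t ht using h1 t ⟨ht.1.le, ht.2.le⟩

/-- The inverse of a function which decreases from `t₀` on. -/
theorem exists_right_inverse (hf : ContDiff ℝ ∞ f) (h : ∀ᶠ t in 𝓝[>] t₀, deriv f t < 0) :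
    ∃ σ : ℝ → ℝ, Continuous σ ∧ σ (f t₀) = t₀ ∧
      (∀ᶠ ξ in 𝓝[<] (f t₀), f (σ ξ) = ξ ∧ deriv f (σ ξ) < 0 ∧
        HasDerivAt σ (deriv f (σ ξ))⁻¹ ξ ∧ t₀ < σ ξ) ∧ ∀ᶠ t in 𝓝[>] t₀, σ (f t) = t := by
  have hn : Tendsto (fun t : ℝ => -t) (𝓝[<] (-t₀)) (𝓝[>] t₀) := by
    refine tendsto_nhdsWithin_iff.mpr ⟨?_, ?_⟩
    · simpa using (continuous_neg.tendsto (-t₀)).mono_left (nhdsWithin_le_nhds (s := Iio (-t₀)))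
    · filter_upwards [self_mem_nhdsWithin] with t ht
      exact Set.mem_Ioi.mpr (lt_neg.mpr ht)
  obtain ⟨σ, h1, h2, h3, h4⟩ := exists_left_inverse (f := fun t => f (-t)) (t₀ := -t₀)
    (hf.comp contDiff_neg) (by
      rw [deriv_comp_neg_fun]
      filter_upwards [hn.eventually h] with t ht
      linarith)
  rw [neg_neg] at h2 h3
  refine ⟨fun ξ => -σ ξ, h1.neg, by simp [h2], ?_, ?_⟩
  · filter_upwards [h3] with ξ ⟨h5, h6, h7, h8⟩
    rw [deriv_comp_neg_fun] at h6 h7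
    refine ⟨h5, by linarith, ?_, by linarith⟩
    have := h7.neg
    rwa [inv_neg, neg_neg] at this
  · filter_upwards [(tendsto_neg_nhdsGT (a := t₀)).eventually h4] with t ht
    rw [neg_neg] at ht
    linarith

theorem eventually_left_lt (hf : ContDiff ℝ ∞ f) (h : ∀ᶠ t in 𝓝[<] t₀, deriv f t < 0) :
    ∀ᶠ t in 𝓝[<] t₀, f t₀ < f t := by
  have hd : deriv (fun t => -f t) = fun t => -deriv f t := by ext t; exact deriv.fun_neg
  obtain ⟨a, ha, hm, -⟩ := exists_strictMonoOn_left (f := fun t => -f t) hf.neg (by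
    rw [hd]; simpa using h)
  filter_upwards [Ioo_mem_nhdsLT ha] with t ht
  have := hm ⟨ht.1.le, ht.2.le⟩ (right_mem_Icc.mpr ha.le) ht.2
  simpa using this

theorem eventually_right_lt (hf : ContDiff ℝ ∞ f) (h : ∀ᶠ t in 𝓝[>] t₀, 0 < deriv f t) :
    ∀ᶠ t in 𝓝[>] t₀, f t₀ < f t := by
  obtain ⟨b, hb, h⟩ := exists_Icc_right_of_eventually h
  have hm : StrictMonoOn f (Icc t₀ b) :=
    strictMonoOn_of_deriv_pos (convex_Icc _ _) hf.continuous.continuousOn fun t ht => by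
      rw [interior_Icc] at ht
      exact h t ⟨ht.1, ht.2.le⟩
  filter_upwards [Ioo_mem_nhdsGT hb] with t ht
  exact hm (left_mem_Icc.mpr hb.le) ⟨ht.1.le, ht.2.le⟩ ht.1

/-- The two-sided local inverse at a regular point. -/
theorem exists_local_inverse (hf : ContDiff ℝ ∞ f) (h : deriv f t₀ ≠ 0) :
    ∃ σ : ℝ → ℝ, σ (f t₀) = t₀ ∧ (∀ᶠ ξ in 𝓝 (f t₀), f (σ ξ) = ξ ∧ deriv f (σ ξ) ≠ 0 ∧
      HasDerivAt σ (deriv f (σ ξ))⁻¹ ξ) ∧ ∀ᶠ t in 𝓝 t₀, σ (f t) = t := by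
  have hs := ((hf.hasStrictDerivAt (x := t₀) (by simp)).hasStrictFDerivAt_equiv h)
  let e := hs.toOpenPartialHomeomorph f
  have het : e.target ∈ 𝓝 (f t₀) := hs.image_mem_toOpenPartialHomeomorph_target |>
    e.open_target.mem_nhds
  have hes : e.source ∈ 𝓝 t₀ := e.open_source.mem_nhds hs.mem_toOpenPartialHomeomorph_source
  have hsym : e.symm (f t₀) = t₀ := e.left_inv hs.mem_toOpenPartialHomeomorph_source
  have hc : ContinuousAt e.symm (f t₀) := e.continuousAt_symm hs.image_mem_toOpenPartialHomeomorph_target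
  refine ⟨e.symm, hsym, ?_, ?_⟩
  · have hne : ∀ᶠ ξ in 𝓝 (f t₀), deriv f (e.symm ξ) ≠ 0 := by
      have h1 := (hf.continuous_deriv (by simp)).continuousAt (x := e.symm (f t₀))
      exact (h1.comp hc).eventually_ne (by simpa [hsym] using h)
    filter_upwards [het, hne] with ξ hξ hξ'
    refine ⟨e.right_inv hξ, hξ', ?_⟩
    refine HasDerivAt.of_local_left_inverse (e.continuousAt_symm hξ)
      (hf.differentiable (by simp) _).hasDerivAt hξ' ?_
    filter_upwards [e.open_target.mem_nhds hξ] with y hy using e.right_inv hy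
  · filter_upwards [hes] with t ht using e.left_inv ht

end Sign

/-- Persistence of a simple zero under a perturbation that is small in the `C¹` sense. -/
theorem exists_simple_zero {H H' : ℝ → ℝ → ℝ} {x₁ m : ℝ} (hm : m < 0)
    (hd : ∀ᶠ q in 𝓝[>] (0 : ℝ) ×ˢ 𝓝 x₁, HasDerivAt (H q.1) (H' q.1 q.2) q.2)
    (hH' : Tendsto (fun q : ℝ × ℝ => H' q.1 q.2) (𝓝[>] (0 : ℝ) ×ˢ 𝓝 x₁) (𝓝 m))
    (hpos : ∀ᶠ x in 𝓝[<] x₁, ∀ᶠ ε in 𝓝[>] (0 : ℝ), 0 < H ε x)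
    (hneg : ∀ᶠ x in 𝓝[>] x₁, ∀ᶠ ε in 𝓝[>] (0 : ℝ), H ε x < 0) :
    ∃ X : ℝ → ℝ, Tendsto X (𝓝[>] 0) (𝓝 x₁) ∧ ∃ η > 0, ∀ᶠ ε in 𝓝[>] (0 : ℝ),
      H ε (X ε) = 0 ∧ HasDerivAt (H ε) (H' ε (X ε)) (X ε) ∧ H' ε (X ε) < 0 ∧
      ∀ x, |x - x₁| < η → (x < X ε → 0 < H ε x) ∧ (X ε < x → H ε x < 0) := by
  have hlt := hH'.eventually_lt_const hm
  -- One neighbourhood of `x₁` on which `H ε` has negative derivative for all small `ε`; there a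
  -- zero is unique.
  obtain ⟨p, hp, q, hq, hpq⟩ := Filter.eventually_prod_iff.mp (hd.and hlt)
  obtain ⟨η, hη, hball⟩ := Metric.eventually_nhds_iff.mp hq
  have hanti : ∀ ε, p ε → StrictAntiOn (H ε) (Ioo (x₁ - η) (x₁ + η)) := by
    intro ε hε
    have hmem : ∀ x ∈ Ioo (x₁ - η) (x₁ + η), q x := fun x hx => hball (by
      rw [Real.dist_eq, abs_lt]; constructor <;> linarith [hx.1, hx.2])
    refine strictAntiOn_of_deriv_neg (convex_Ioo _ _)
      (fun x hx => (hpq hε (hmem x hx)).1.continuousAt.continuousWithinAt) ?_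
    intro x hx
    rw [interior_Ioo] at hx
    have := hpq hε (hmem x hx)
    rw [this.1.deriv]
    exact this.2
  -- Signs at two fixed points on either side of `x₁` persist for small `ε`, and the intermediate
  -- value theorem applies between them. The interval may be taken arbitrarily short.
  have hex : ∀ η' > 0, η' < η → ∀ᶠ ε in 𝓝[>] (0 : ℝ),
      ∃ x ∈ Ioo (x₁ - η') (x₁ + η'), H ε x = 0 := by
    intro η' h0 h1
    obtain ⟨a, ha, hma, hma'⟩ := (hpos.and (Ioo_mem_nhdsLT (show x₁ - η' < x₁ by linarith))).exists
    obtain ⟨b, hb, hmb, hmb'⟩ := (hneg.and (Ioo_mem_nhdsGT (show x₁ < x₁ + η' by linarith))).exists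
    filter_upwards [ha, hb, hp] with ε hea heb hep
    have hcont : ContinuousOn (H ε) (Icc a b) := by
      intro x hx
      refine (hpq hep (hball ?_)).1.continuousAt.continuousWithinAt
      rw [Real.dist_eq, abs_lt]; constructor <;> linarith [hx.1, hx.2]
    obtain ⟨x, hx, hx0⟩ := intermediate_value_Icc' (by linarith : a ≤ b) hcont ⟨heb.le, hea.le⟩
    exact ⟨x, ⟨by linarith [hx.1], by linarith [hx.2]⟩, hx0⟩
  classical
  -- By uniqueness this zero in the large interval agrees with the zeros found in shorter ones,
  -- whence convergence to `x₁`. The value `x₁` is only a default.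
  let X : ℝ → ℝ := fun ε =>
    if h : ∃ x ∈ Ioo (x₁ - η) (x₁ + η), H ε x = 0 then h.choose else x₁
  have hX : ∀ ε, p ε → ∀ x ∈ Ioo (x₁ - η) (x₁ + η), H ε x = 0 → X ε = x := by
    intro ε hε x hx h0
    have h : ∃ x ∈ Ioo (x₁ - η) (x₁ + η), H ε x = 0 := ⟨x, hx, h0⟩
    simp only [X, dif_pos h]
    exact (hanti ε hε).injOn h.choose_spec.1 hx (h.choose_spec.2.trans h0.symm)
  refine ⟨X, ?_, η, hη, ?_⟩
  · refine Metric.tendsto_nhds.mpr fun η' hη' => ?_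
    have h2 : 0 < min η' (η / 2) := lt_min hη' (by linarith)
    filter_upwards [hex _ h2 (lt_of_le_of_lt (min_le_right _ _) (by linarith)), hp]
      with ε ⟨x, hx, hx0⟩ hep
    have h3 := min_le_left η' (η / 2)
    have h4 := min_le_right η' (η / 2)
    rw [hX ε hep x ⟨by linarith [hx.1], by linarith [hx.2]⟩ hx0, Real.dist_eq, abs_lt]
    constructor <;> linarith [hx.1, hx.2]
  · filter_upwards [hex (η / 2) (by linarith) (by linarith), hp] with ε ⟨x, hx, hx0⟩ hep
    have hxm : x ∈ Ioo (x₁ - η) (x₁ + η) := ⟨by linarith [hx.1], by linarith [hx.2]⟩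
    rw [hX ε hep x hxm hx0]
    have h := hpq hep (hball (y := x) (by
      rw [Real.dist_eq, abs_lt]; constructor <;> linarith [hx.1, hx.2]))
    refine ⟨hx0, h.1, h.2, fun y hy => ?_⟩
    rw [abs_lt] at hy
    have hym : y ∈ Ioo (x₁ - η) (x₁ + η) := ⟨by linarith [hy.1], by linarith [hy.2]⟩
    refine ⟨fun hl => ?_, fun hl => ?_⟩
    · rw [← hx0]; exact hanti ε hep hym hxm hl
    · rw [← hx0]; exact hanti ε hep hxm hym hl

end

section
open Set Filter Topology Projection

/-! ### Periodicity -/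

theorem Function.Periodic.apply_fract {α : Type*} {u : ℝ → α} (h : Function.Periodic u 1) (t : ℝ) :
    u (Int.fract t) = u t := by
  have := h.sub_int_mul_eq (x := t) ⌊t⌋
  rwa [mul_one] at this

theorem Function.Periodic.add_int {α : Type*} {u : ℝ → α} (h : Function.Periodic u 1) (t : ℝ)
    (n : ℤ) : u (t + n) = u t := by
  simpa using h.int_mul n t

/-- Near its limit the function is at distance less than `1` from it. This fixes the integer by
which lifts of the circle-valued coordinate differ while points vary a little. -/
theorem eventually_int_eq_zero {α : Type*} {l : Filter α} {u : α → ℝ} {c : ℝ}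
    (hu : Tendsto u l (𝓝 c)) : ∀ᶠ t in l, ∀ m : ℤ, u t = c + m → m = 0 := by
  filter_upwards [hu.eventually (Metric.ball_mem_nhds c one_pos)] with t ht m hm
  rw [Real.dist_eq, hm, add_sub_cancel_left, ← Int.cast_abs] at ht
  exact Int.abs_lt_one_iff.mp (by exact_mod_cast ht)

theorem eventually_ne_int {α : Type*} {l : Filter α} {u : α → ℝ} {c : ℝ}
    (hu : Tendsto u l (𝓝 c)) (hc : ∀ m : ℤ, c ≠ m) : ∀ᶠ t in l, ∀ m : ℤ, u t ≠ m := by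
  have : (range ((↑) : ℤ → ℝ))ᶜ ∈ 𝓝 c :=
    Int.isClosedEmbedding_coe_real.isClosed_range.isOpen_compl.mem_nhds
      (by rintro ⟨m, hm⟩; exact hc m hm.symm)
  filter_upwards [hu.eventually this] with t ht m hm using ht ⟨m, hm.symm⟩

namespace Projection

variable {ι : Type*}

/-- The representative in `Par` of a point of the link. -/
noncomputable def parOf (p : ι × ℝ) : ι × ℝ := (p.1, Int.fract p.2)

theorem parOf_mem (p : ι × ℝ) : parOf p ∈ Par ι := ⟨Int.fract_nonneg _, Int.fract_lt_one _⟩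

theorem parOf_of_mem {p : ι × ℝ} (hp : p ∈ Par ι) : parOf p = p :=
  Prod.ext rfl (Int.fract_eq_self.mpr hp)

theorem parOf_eq_parOf_iff {p q : ι × ℝ} :
    parOf p = parOf q ↔ p.1 = q.1 ∧ ∃ n : ℤ, p.2 = q.2 + n := by
  simp only [parOf, Prod.mk.injEq, Int.fract_eq_fract, sub_eq_iff_eq_add']

end Projection

namespace LegendrianLink

variable {ι : Type*} (L : LegendrianLink ι)

theorem periodic_deriv_x (i : ι) : Function.Periodic (deriv (L.x i)) 1 := by
  intro t
  rw [← deriv_comp_add_const, funext (L.x_add_one i), deriv_add_const]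

theorem periodic_deriv_deriv_x (i : ι) : Function.Periodic (deriv (deriv (L.x i))) 1 := by
  intro t
  rw [← deriv_comp_add_const, funext (L.periodic_deriv_x i)]

theorem periodic_deriv_y (i : ι) : Function.Periodic (deriv (L.y i)) 1 := by
  intro t
  rw [← deriv_comp_add_const, funext (L.periodic_y i)]

/-- The point `p` of the link lies over `ξ`. -/
def Over (ξ : ℝ) (p : ι × ℝ) : Prop := ∃ m : ℤ, L.x p.1 p.2 = ξ + m

variable {L}

theorem over_iff {ξ : ℝ} {p : ι × ℝ} : L.Over ξ p ↔ Int.fract (L.x p.1 p.2) = Int.fract ξ := by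
  rw [Int.fract_eq_fract]
  simp only [Over, sub_eq_iff_eq_add']

theorem over_iff_of_mem {ξ : ℝ} (hξ : ξ ∈ Ico (0 : ℝ) 1) {p : ι × ℝ} :
    L.Over ξ p ↔ Int.fract (L.x p.1 p.2) = ξ := by
  rw [over_iff, Int.fract_eq_self.mpr hξ]

theorem fract_x_parOf (p : ι × ℝ) :
    Int.fract (L.x (parOf p).1 (parOf p).2) = Int.fract (L.x p.1 p.2) := by
  have h := L.x_add_int p.1 (Int.fract p.2) ⌊p.2⌋
  rw [Int.fract_add_floor] at h
  rw [h, ← Int.cast_mul, Int.fract_add_intCast]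
  rfl

theorem over_parOf {ξ : ℝ} {p : ι × ℝ} : L.Over ξ (parOf p) ↔ L.Over ξ p := by
  rw [over_iff, over_iff, fract_x_parOf]

theorem over_of_parOf_eq {ξ : ℝ} {p q : ι × ℝ} (h : parOf p = parOf q) (hp : L.Over ξ p) :
    L.Over ξ q := by
  rwa [← over_parOf, ← h, over_parOf]

theorem y_parOf (p : ι × ℝ) : L.y (parOf p).1 (parOf p).2 = L.y p.1 p.2 :=
  (L.periodic_y p.1).apply_fract p.2

theorem z_parOf (p : ι × ℝ) : L.z (parOf p).1 (parOf p).2 = L.z p.1 p.2 :=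
  (L.periodic_z p.1).apply_fract p.2

theorem der_x_parOf (p : ι × ℝ) : der L.x (parOf p) = der L.x p :=
  (L.periodic_deriv_x p.1).apply_fract p.2

theorem der_y_parOf (p : ι × ℝ) : der L.y (parOf p) = der L.y p :=
  (L.periodic_deriv_y p.1).apply_fract p.2

theorem der2_x_parOf (p : ι × ℝ) : der2 L.x (parOf p) = der2 L.x p :=
  (L.periodic_deriv_deriv_x p.1).apply_fract p.2

theorem deriv_ne_or (hL : L.GenericFront) (i : ι) (t : ℝ) (h : deriv (L.x i) t = 0) :
    deriv (deriv (L.x i)) t ≠ 0 := by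
  have := hL.nondegenerate (parOf (i, t)) (parOf_mem _)
  rw [der_x_parOf, der2_x_parOf] at this
  exact this h

variable (L)

theorem contDiff_deriv_x (i : ι) : ContDiff ℝ ∞ (deriv (L.x i)) :=
  ((contDiff_infty_iff_deriv).mp (L.smooth_x i)).2

theorem contDiff_deriv_y (i : ι) : ContDiff ℝ ∞ (deriv (L.y i)) :=
  ((contDiff_infty_iff_deriv).mp (L.smooth_y i)).2

variable {L}

theorem hasDerivAt_x (i : ι) (t : ℝ) : HasDerivAt (L.x i) (deriv (L.x i) t) t :=
  ((L.smooth_x i).differentiable (by simp) t).hasDerivAt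

theorem hasDerivAt_y (i : ι) (t : ℝ) : HasDerivAt (L.y i) (deriv (L.y i) t) t :=
  ((L.smooth_y i).differentiable (by simp) t).hasDerivAt

theorem hasDerivAt_z (i : ι) (t : ℝ) : HasDerivAt (L.z i) (L.y i t * deriv (L.x i) t) t := by
  rw [← L.legendrian]
  exact ((L.smooth_z i).differentiable (by simp) t).hasDerivAt

theorem eventually_deriv_x_ne (hL : L.GenericFront) (i : ι) (t : ℝ) :
    ∀ᶠ s in 𝓝[≠] t, deriv (L.x i) s ≠ 0 := by
  by_cases h : deriv (L.x i) t = 0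
  · exact ((L.contDiff_deriv_x i).differentiable (by simp) t).hasDerivAt.eventually_ne
      (deriv_ne_or hL i t h)
  · exact ((L.contDiff_deriv_x i).continuous.continuousAt.eventually_ne h).filter_mono
      nhdsWithin_le_nhds

/-- By Rolle, a nearby parameter with the same `x` would produce a critical point of `x` in between,
and critical points are isolated by nondegeneracy. -/
theorem eventually_x_ne (hL : L.GenericFront) (i : ι) (t : ℝ) :
    ∀ᶠ s in 𝓝[≠] t, L.x i s ≠ L.x i t := by
  obtain ⟨η, hη, h⟩ := Metric.eventually_nhds_iff.mp
    (eventually_nhdsWithin_iff.mp (eventually_deriv_x_ne hL i t))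
  have hc := (L.smooth_x i).continuous
  refine eventually_nhdsWithin_iff.mpr (Metric.eventually_nhds_iff.mpr ⟨η, hη, ?_⟩)
  intro s hs hst heq
  rw [Real.dist_eq, abs_lt] at hs
  rcases lt_or_gt_of_ne hst with hlt | hlt
  · obtain ⟨c, hc, hc0⟩ := exists_deriv_eq_zero hlt hc.continuousOn heq
    refine h ?_ hc.2.ne hc0
    rw [Real.dist_eq, abs_lt]; constructor <;> linarith [hc.1, hc.2]
  · obtain ⟨c, hc, hc0⟩ := exists_deriv_eq_zero hlt hc.continuousOn heq.symm
    refine h ?_ hc.1.ne' hc0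
    rw [Real.dist_eq, abs_lt]; constructor <;> linarith [hc.1, hc.2]

/-- A set of parameters without accumulation point modulo `1` is finite. -/
theorem finite_par_of_eventually [Finite ι] {p : ι → ℝ → Prop}
    (h : ∀ i t, ∀ᶠ s in 𝓝[≠] t, ¬ p i s) : {q ∈ Par ι | p q.1 q.2}.Finite := by
  have hi : ∀ i, {s ∈ Icc (0 : ℝ) 1 | p i s}.Finite := by
    intro i
    by_contra hinf
    obtain ⟨t, -, ht⟩ := Set.Infinite.exists_accPt_of_subset_isCompact hinf
      (isCompact_Icc (a := (0 : ℝ)) (b := 1)) (fun s hs => hs.1)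
    rw [accPt_iff_frequently] at ht
    refine ht ?_
    filter_upwards [eventually_nhdsWithin_iff.mp (h i t)] with s hs hs'
    exact hs hs'.1 hs'.2.2
  refine (Set.finite_iUnion fun i => (hi i).image (Prod.mk i)).subset ?_
  rintro ⟨i, s⟩ ⟨h1, h2⟩
  exact Set.mem_iUnion.mpr ⟨i, s, ⟨⟨h1.1, h1.2.le⟩, h2⟩, rfl⟩

theorem finite_over [Finite ι] (hL : L.GenericFront) (ξ : ℝ) :
    {p ∈ Par ι | L.Over ξ p}.Finite := by
  refine finite_par_of_eventually (p := fun i s => L.Over ξ (i, s)) fun i t => ?_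
  have hc : Tendsto (L.x i) (𝓝[≠] t) (𝓝 (L.x i t)) :=
    (L.smooth_x i).continuous.continuousAt.mono_left nhdsWithin_le_nhds
  by_cases h : L.Over ξ (i, t)
  · obtain ⟨n, hn⟩ := h
    filter_upwards [eventually_int_eq_zero hc, eventually_x_ne hL i t] with s h1 h2
    rintro ⟨m, hm⟩
    have : m - n = 0 := h1 (m - n) (by
      push_cast; simp only at hn hm; linarith)
    have hmn : m = n := by omega
    subst hmn
    exact h2 (hm.trans hn.symm)
  · have h' : ∀ m : ℤ, L.x i t - ξ ≠ m := fun m hm => h ⟨m, by simp only; linarith⟩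
    filter_upwards [eventually_ne_int (hc.sub_const ξ) h'] with s hs
    rintro ⟨m, hm⟩
    exact hs m (by simp only at hm; linarith)

/-! ### The strands that run into a vertical line from the left -/

variable (L)

/-- The link reaches the vertical line through the image of `p` from the left, for parameters just
before (`true`) or just after (`false`) that of `p`. -/
def Reaches (p : ι × ℝ) : Bool → Prop
  | true => 0 < der L.x p ∨ RightTurn L.x p
  | false => der L.x p < 0 ∨ RightTurn L.x p

/-- The strands on the left of the vertical line over `x₀` that reach this line. -/
def Branch (x₀ : ℝ) : Type _ :=
  {k : (ι × ℝ) × Bool // (k.1 ∈ Par ι ∧ L.Over x₀ k.1) ∧ L.Reaches k.1 k.2}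

variable {L}

theorem finite_branch [Finite ι] (hL : L.GenericFront) (x₀ : ℝ) : Finite (L.Branch x₀) := by
  have h := (finite_over hL x₀).prod (Set.finite_univ (α := Bool))
  exact (h.subset (fun k hk => ⟨hk.1, Set.mem_univ _⟩) :
    {k : (ι × ℝ) × Bool | (k.1 ∈ Par ι ∧ L.Over x₀ k.1) ∧ L.Reaches k.1 k.2}.Finite).to_subtype

namespace Branch

variable {x₀ : ℝ}

/-- The component of a strand. -/
abbrev comp (k : L.Branch x₀) : ι := k.1.1.1

/-- The end point of a strand on the vertical line. -/
abbrev pt (k : L.Branch x₀) : ι × ℝ := k.1.1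

end Branch

/-- `σ` parametrizes all points over `ξ`, each of them once, by the strands over `ξ`. -/
structure IsStrandsAt (L : LegendrianLink ι) {x₀ : ℝ} (σ : L.Branch x₀ → ℝ → ℝ) (ξ : ℝ) : Prop where
  mem_over : ∀ k, L.Over ξ (k.comp, σ k ξ)
  deriv_ne : ∀ k, deriv (L.x k.comp) (σ k ξ) ≠ 0
  hasDerivAt : ∀ k, HasDerivAt (σ k) (deriv (L.x k.comp) (σ k ξ))⁻¹ ξ
  side_true : ∀ k, k.1.2 = true → σ k ξ < k.pt.2 ∧ 0 < deriv (L.x k.comp) (σ k ξ)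
  side_false : ∀ k, k.1.2 = false → k.pt.2 < σ k ξ ∧ deriv (L.x k.comp) (σ k ξ) < 0
  inj : ∀ k l, parOf (k.comp, σ k ξ) = parOf (l.comp, σ l ξ) → k = l
  surj : ∀ p, L.Over ξ p → ∃ k, parOf p = parOf (k.comp, σ k ξ)

/-- A strand is followed to the left of the line by inverting a lift of `x` on the chosen side of
its end point. The last clause is local uniqueness: a parameter on that side whose lift has the same
integer shift lies on the strand. -/
theorem exists_branch_section {x₀ : ℝ} (k : L.Branch x₀) :
    ∃ σ : ℝ → ℝ, Continuous σ ∧ σ x₀ = k.pt.2 ∧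
      (∀ᶠ ξ in 𝓝[<] x₀, L.Over ξ (k.comp, σ ξ) ∧ deriv (L.x k.comp) (σ ξ) ≠ 0 ∧
        HasDerivAt σ (deriv (L.x k.comp) (σ ξ))⁻¹ ξ ∧
        (k.1.2 = true → σ ξ < k.pt.2 ∧ 0 < deriv (L.x k.comp) (σ ξ)) ∧
        (k.1.2 = false → k.pt.2 < σ ξ ∧ deriv (L.x k.comp) (σ ξ) < 0)) ∧
      (∀ᶠ t in cond k.1.2 (𝓝[<] k.pt.2) (𝓝[>] k.pt.2), ∀ ξ, ∀ m : ℤ,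
        L.x k.comp k.pt.2 = x₀ + m → L.x k.comp t = ξ + m → σ ξ = t) := by
  obtain ⟨⟨⟨i, t₀⟩, b⟩, ⟨hp, n, hn⟩, hr⟩ := k
  simp only at hn hr ⊢
  have hs : ContDiff ℝ ∞ (fun t => L.x i t - n) := (L.smooth_x i).sub contDiff_const
  have hd : deriv (fun t => L.x i t - n) = deriv (L.x i) := by ext t; simp
  have h0 : L.x i t₀ - n = x₀ := by linarith
  cases b with
  | true =>
    obtain ⟨σ, h1, h2, h3, h4⟩ := exists_left_inverse (t₀ := t₀) hs (by
      rw [hd]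
      exact eventually_left_deriv_pos (L.smooth_x i) hr)
    simp only [hd, h0] at h2 h3 h4
    refine ⟨σ, h1, h2, ?_, ?_⟩
    · filter_upwards [h3] with ξ ⟨h5, h6, h7, h8⟩
      exact ⟨⟨n, by simp only; linarith⟩, h6.ne', h7, fun _ => ⟨h8, h6⟩, by simp⟩
    · simp only [cond_true]
      filter_upwards [h4] with t ht ξ m hm hξ
      have hmn : (m : ℝ) = n := by linarith
      rw [← ht, hξ, hmn, add_sub_cancel_right]
  | false =>
    obtain ⟨σ, h1, h2, h3, h4⟩ := exists_right_inverse (t₀ := t₀) hs (by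
      rw [hd]
      exact eventually_right_deriv_neg (L.smooth_x i) hr)
    simp only [hd, h0] at h2 h3 h4
    refine ⟨σ, h1, h2, ?_, ?_⟩
    · filter_upwards [h3] with ξ ⟨h5, h6, h7, h8⟩
      exact ⟨⟨n, by simp only; linarith⟩, h6.ne, h7, by simp, fun _ => ⟨h8, h6⟩⟩
    · simp only [cond_false]
      filter_upwards [h4] with t ht ξ m hm hξ
      have hmn : (m : ℝ) = n := by linarith
      rw [← ht, hξ, hmn, add_sub_cancel_right]

/-- Points near a point over `x₀` that lie to the left of `x₀` are on one of its branches. -/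
theorem eventually_mem_side (hL : L.GenericFront) {x₀ : ℝ} {p : ι × ℝ} (hp : p ∈ Par ι)
    (ho : L.Over x₀ p) {Q : L.Branch x₀ → ℝ → Prop}
    (hQ : ∀ k, ∀ᶠ t in cond k.1.2 (𝓝[<] k.pt.2) (𝓝[>] k.pt.2), Q k t) :
    ∀ᶠ t in 𝓝 p.2, L.x p.1 t < L.x p.1 p.2 → ∃ k : L.Branch x₀, k.pt = p ∧ Q k t := by
  have hleft : ∀ᶠ t in 𝓝[<] p.2, L.x p.1 t < L.x p.1 p.2 → ∃ k : L.Branch x₀, k.pt = p ∧ Q k t := by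
    by_cases hr : L.Reaches p true
    · filter_upwards [hQ ⟨(p, true), ⟨hp, ho⟩, hr⟩] with t ht _ using ⟨_, rfl, ht⟩
    -- If the link does not reach the line on this side of `p`, then `x` exceeds its value at `p`
    -- there, and nothing lies to the left.
    · simp only [Reaches, RightTurn, not_or, not_and, not_lt] at hr
      have hd : deriv (L.x p.1) p.2 < 0 ∨
          (deriv (L.x p.1) p.2 = 0 ∧ 0 < deriv (deriv (L.x p.1)) p.2) := by
        rcases hr.1.lt_or_eq with h | h
        · exact Or.inl h
        · exact Or.inr ⟨h, lt_of_le_of_ne (hr.2 h) (deriv_ne_or hL _ _ h).symm⟩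
      filter_upwards [eventually_left_lt (L.smooth_x p.1)
        (eventually_left_deriv_neg (L.smooth_x p.1) hd)] with t ht ht'
      exact absurd ht' ht.not_gt
  have hright : ∀ᶠ t in 𝓝[>] p.2, L.x p.1 t < L.x p.1 p.2 → ∃ k : L.Branch x₀, k.pt = p ∧ Q k t := by
    by_cases hr : L.Reaches p false
    · filter_upwards [hQ ⟨(p, false), ⟨hp, ho⟩, hr⟩] with t ht _ using ⟨_, rfl, ht⟩
    · simp only [Reaches, RightTurn, not_or, not_and, not_lt] at hr
      have hd : 0 < deriv (L.x p.1) p.2 ∨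
          (deriv (L.x p.1) p.2 = 0 ∧ 0 < deriv (deriv (L.x p.1)) p.2) := by
        rcases hr.1.lt_or_eq with h | h
        · exact Or.inl h
        · exact Or.inr ⟨h.symm, lt_of_le_of_ne (hr.2 h.symm) (deriv_ne_or hL _ _ h.symm).symm⟩
      filter_upwards [eventually_right_lt (L.smooth_x p.1)
        (eventually_right_deriv_pos (L.smooth_x p.1) hd)] with t ht ht'
      exact absurd ht' ht.not_gt
  rw [eventually_nhdsWithin_iff] at hleft hright
  filter_upwards [hleft, hright] with t h1 h2 hlt
  rcases lt_trichotomy t p.2 with h | h | h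
  · exact h1 h hlt
  · rw [h] at hlt; exact absurd hlt (lt_irrefl _)
  · exact h2 h hlt

/-- Just left of any vertical line the link consists of disjoint graphs, one for each branch.
Different end points stay apart modulo `1`, and two strands with a common end point lie on different
sides of it. No point over `ξ` is missed, by compactness of the parameter interval. -/
theorem exists_strands [Finite ι] (hL : L.GenericFront) (x₀ : ℝ) :
    ∃ σ : L.Branch x₀ → ℝ → ℝ, (∀ k, Continuous (σ k)) ∧ (∀ k, σ k x₀ = k.pt.2) ∧
      ∀ᶠ ξ in 𝓝[<] x₀, L.IsStrandsAt σ ξ := by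
  have := finite_branch hL x₀
  choose σ h1 h2 h3 h4 using fun k : L.Branch x₀ => exists_branch_section k
  have hlim : ∀ k, Tendsto (σ k) (𝓝[<] x₀) (𝓝 k.pt.2) := fun k => by
    rw [← h2 k]
    exact (h1 k).continuousAt.mono_left nhdsWithin_le_nhds
  have hinj : ∀ k l : L.Branch x₀, ∀ᶠ ξ in 𝓝[<] x₀,
      parOf (k.comp, σ k ξ) = parOf (l.comp, σ l ξ) → k = l := by
    intro k l
    by_cases hkl : k.pt = l.pt
    · have hz : Tendsto (fun ξ => σ k ξ - σ l ξ) (𝓝[<] x₀) (𝓝 0) := by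
        have := (hlim k).sub (hlim l)
        rwa [hkl, sub_self] at this
      filter_upwards [eventually_int_eq_zero hz, h3 k, h3 l] with ξ h5 hk hl heq
      obtain ⟨-, m, hm⟩ := parOf_eq_parOf_iff.mp heq
      have hm0 := h5 m (by simp only at hm; linarith)
      rw [hm0] at hm
      simp only [Int.cast_zero, add_zero] at hm
      refine Subtype.ext (Prod.ext hkl ?_)
      cases hb : k.1.2 <;> cases hb' : l.1.2
      · rfl
      · have h6 := (hk.2.2.2.2 hb).1
        have h7 := (hl.2.2.2.1 hb').1
        rw [hkl] at h6
        linarith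
      · have h6 := (hk.2.2.2.1 hb).1
        have h7 := (hl.2.2.2.2 hb').1
        rw [hkl] at h6
        linarith
      · rfl
    · by_cases hc : k.comp = l.comp
      · have hz := (hlim k).sub (hlim l)
        have hni : ∀ m : ℤ, k.pt.2 - l.pt.2 ≠ m := by
          intro m hm
          have : parOf k.pt = parOf l.pt := parOf_eq_parOf_iff.mpr ⟨hc, m, by linarith⟩
          rw [parOf_of_mem k.2.1.1, parOf_of_mem l.2.1.1] at this
          exact hkl this
        filter_upwards [eventually_ne_int hz hni] with ξ h5 heq
        obtain ⟨-, m, hm⟩ := parOf_eq_parOf_iff.mp heq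
        exact absurd (by simp only at hm; linarith) (h5 m)
      · exact Eventually.of_forall fun ξ h => absurd (parOf_eq_parOf_iff.mp h).1 hc
  have hsurj : ∀ i, ∀ᶠ ξ in 𝓝[<] x₀, ∀ t ∈ Icc (0 : ℝ) 1, L.Over ξ (i, t) →
      ∃ k : L.Branch x₀, parOf (i, t) = parOf (k.comp, σ k ξ) := by
    intro i
    refine isCompact_Icc.eventually_forall_of_prod
      (P := fun ξ t => L.Over ξ (i, t) → ∃ k : L.Branch x₀, parOf (i, t) = parOf (k.comp, σ k ξ)) ?_
    intro t₀ _
    have hx : Tendsto (fun q : ℝ × ℝ => L.x i q.2 - q.1) (𝓝[<] x₀ ×ˢ 𝓝 t₀)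
        (𝓝 (L.x i t₀ - x₀)) :=
      ((L.smooth_x i).continuous.continuousAt.tendsto.comp tendsto_snd).sub
        ((tendsto_id.mono_left nhdsWithin_le_nhds).comp tendsto_fst)
    by_cases ho : L.Over x₀ (i, t₀)
    · obtain ⟨n, hn⟩ := id ho
      have ho' := over_parOf.mpr ho
      obtain ⟨n', hn'⟩ := id ho'
      have h5 := eventually_mem_side hL (parOf_mem (i, t₀)) ho' h4
      -- Branches end at representatives in `[0, 1)`, so the parameter is shifted to lie near the
      -- representative of `t₀`; this matters at `t₀ = 1`.
      have hsh : Tendsto (fun q : ℝ × ℝ => q.2 - ⌊t₀⌋) (𝓝[<] x₀ ×ˢ 𝓝 t₀)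
          (𝓝 (parOf (i, t₀)).2) := (tendsto_snd.sub_const _)
      have hx' : Tendsto (fun q : ℝ × ℝ => L.x i (q.2 - ⌊t₀⌋) - q.1) (𝓝[<] x₀ ×ˢ 𝓝 t₀)
          (𝓝 (L.x i (parOf (i, t₀)).2 - x₀)) :=
        ((L.smooth_x i).continuous.continuousAt.tendsto.comp hsh).sub
          ((tendsto_id.mono_left nhdsWithin_le_nhds).comp tendsto_fst)
      have hlt : ∀ᶠ q : ℝ × ℝ in 𝓝[<] x₀ ×ˢ 𝓝 t₀, q.1 < x₀ :=
        tendsto_fst.eventually (eventually_mem_nhdsWithin (s := Iio x₀))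
      filter_upwards [eventually_int_eq_zero hx', hsh.eventually h5, hlt] with q h6 h7 h8 hq
      have hpar : parOf (i, q.2) = parOf (i, q.2 - ⌊t₀⌋) :=
        parOf_eq_parOf_iff.mpr ⟨rfl, ⌊t₀⌋, by simp⟩
      obtain ⟨m, hm⟩ := over_of_parOf_eq hpar hq
      simp only at hm hn'
      have hmn : m = n' := by
        have := h6 (m - n') (by push_cast; rw [hm, show L.x i (parOf (i, t₀)).2 = x₀ + n' from hn']; ring)
        omega
      subst hmn
      obtain ⟨k, hk, hkq⟩ := h7 (by
        change L.x i (q.2 - ⌊t₀⌋) < L.x i (parOf (i, t₀)).2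
        rw [hm, show L.x i (parOf (i, t₀)).2 = x₀ + m from hn']; linarith)
      have hkc : k.comp = i := congrArg Prod.fst hk
      have := hkq q.1 m (by rw [hkc, congrArg Prod.snd hk]; exact hn') (by rw [hkc]; exact hm)
      exact ⟨k, by rw [hpar, this, hkc]⟩
    · have h' : ∀ m : ℤ, L.x i t₀ - x₀ ≠ m := fun m hm => ho ⟨m, by simp only; linarith⟩
      filter_upwards [eventually_ne_int hx h'] with q hq
      rintro ⟨m, hm⟩
      exact absurd (by simp only at hm; linarith) (hq m)
  refine ⟨σ, h1, h2, ?_⟩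
  filter_upwards [eventually_all.mpr h3, eventually_all.mpr fun k => eventually_all.mpr (hinj k),
    eventually_all.mpr hsurj] with ξ h5 h6 h7
  refine ⟨fun k => (h5 k).1, fun k => (h5 k).2.1, fun k => (h5 k).2.2.1, fun k => (h5 k).2.2.2.1,
    fun k => (h5 k).2.2.2.2, h6, ?_⟩
  intro p hp
  have hm := parOf_mem p
  obtain ⟨k, hk⟩ := h7 p.1 (parOf p).2 ⟨hm.1, hm.2.le⟩ (over_parOf.mpr hp)
  refine ⟨k, ?_⟩
  rw [← hk]
  exact (parOf_of_mem hm).symm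

end LegendrianLink

end

section
open Set Filter Topology Projection

namespace LegendrianLink

variable {ι : Type*} {L : LegendrianLink ι}

/-! ### Counting strands -/

/-- All points over `ξ` are regular, so the summand of `strandsBelow` for right turns is empty and
the strands enumerate the rest. -/
theorem strandsBelow_eq_of_isStrandsAt {v : ι → ℝ → ℝ} (hv : ∀ i, Function.Periodic (v i) 1)
    {x₀ ξ c : ℝ} {σ : L.Branch x₀ → ℝ → ℝ} (hσ : L.IsStrandsAt σ ξ) (hξ : ξ ∈ Ico (0 : ℝ) 1) :
    strandsBelow L.x v (ξ, c) = {k : L.Branch x₀ | v k.comp (σ k ξ) < c}.ncard := by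
  have hreg : ∀ p ∈ Par ι, Int.fract (L.x p.1 p.2) = ξ →
      ∃ k, p = parOf (k.comp, σ k ξ) ∧ der L.x p ≠ 0 ∧ v p.1 p.2 = v k.comp (σ k ξ) := by
    intro p hp hpx
    obtain ⟨k, hk⟩ := hσ.surj p ((over_iff_of_mem hξ).mpr hpx)
    rw [parOf_of_mem hp] at hk
    refine ⟨k, hk, ?_, ?_⟩
    · rw [hk, der_x_parOf]; exact hσ.deriv_ne k
    · rw [hk]; exact (hv _).apply_fract _
  have h1 : {p ∈ Par ι | (point L.x v p).1 = (ξ, c).1 ∧ (point L.x v p).2 < (ξ, c).2 ∧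
      der L.x p ≠ 0} = (fun k : L.Branch x₀ => parOf (k.comp, σ k ξ)) ''
        {k : L.Branch x₀ | v k.comp (σ k ξ) < c} := by
    ext p
    constructor
    · rintro ⟨hp, hpx, hpv, -⟩
      obtain ⟨k, hk, -, hkv⟩ := hreg p hp hpx
      refine ⟨k, ?_, hk.symm⟩
      simp only [mem_ofPred_eq, ← hkv]
      exact hpv
    · rintro ⟨k, hk, rfl⟩
      refine ⟨parOf_mem _, ?_, ?_, ?_⟩
      · exact (over_iff_of_mem hξ).mp (over_parOf.mpr (hσ.mem_over k))
      · change v k.comp (Int.fract _) < c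
        rw [(hv _).apply_fract]
        exact hk
      · rw [der_x_parOf]; exact hσ.deriv_ne k
  have h2 : {p ∈ Par ι | (point L.x v p).1 = (ξ, c).1 ∧ (point L.x v p).2 < (ξ, c).2 ∧
      RightTurn L.x p} = ∅ := by
    refine eq_empty_of_forall_notMem ?_
    rintro p ⟨hp, hpx, -, hpr⟩
    obtain ⟨k, -, hk, -⟩ := hreg p hp hpx
    exact hk hpr.1
  rw [strandsBelow, h1, h2, ncard_empty, ncard_image_of_injective _ fun k l h => hσ.inj k l h]
  rfl

/-- The weights in `strandsBelow` are the numbers of branches: one at a regular point, two at a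
right turn, none at a left turn. This form of the count is stable under moving the line to the left
and under perturbing the vertical coordinate. -/
theorem strandsBelow_eq_ncard_branch [Finite ι] (hL : L.GenericFront) {v : ι → ℝ → ℝ} {x₀ c : ℝ}
    (hx₀ : x₀ ∈ Ico (0 : ℝ) 1) :
    strandsBelow L.x v (x₀, c) = {k : L.Branch x₀ | v k.pt.1 k.pt.2 < c}.ncard := by
  let A : Set (ι × ℝ) := {p | p ∈ Par ι ∧ L.Over x₀ p ∧ v p.1 p.2 < c}
  have hA : A.Finite := (finite_over hL x₀).subset fun p hp => ⟨hp.1, hp.2.1⟩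
  let P : Set (ι × ℝ) := {p ∈ A | 0 < der L.x p}
  let N : Set (ι × ℝ) := {p ∈ A | der L.x p < 0}
  let R : Set (ι × ℝ) := {p ∈ A | RightTurn L.x p}
  have hP : P.Finite := hA.subset fun p hp => hp.1
  have hN : N.Finite := hA.subset fun p hp => hp.1
  have hR : R.Finite := hA.subset fun p hp => hp.1
  have h1 : {p ∈ Par ι | (point L.x v p).1 = (x₀, c).1 ∧ (point L.x v p).2 < (x₀, c).2 ∧
      der L.x p ≠ 0} = P ∪ N := by
    ext p
    constructor
    · rintro ⟨hp, hpx, hpv, hd⟩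
      have : p ∈ A := ⟨hp, (over_iff_of_mem hx₀).mpr hpx, hpv⟩
      rcases lt_or_gt_of_ne hd with h | h
      · exact Or.inr ⟨this, h⟩
      · exact Or.inl ⟨this, h⟩
    · rintro (⟨⟨hp, hpx, hpv⟩, h⟩ | ⟨⟨hp, hpx, hpv⟩, h⟩)
      · exact ⟨hp, (over_iff_of_mem hx₀).mp hpx, hpv, h.ne'⟩
      · exact ⟨hp, (over_iff_of_mem hx₀).mp hpx, hpv, h.ne⟩
  have h2 : {p ∈ Par ι | (point L.x v p).1 = (x₀, c).1 ∧ (point L.x v p).2 < (x₀, c).2 ∧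
      RightTurn L.x p} = R := by
    ext p
    constructor
    · rintro ⟨hp, hpx, hpv, hd⟩
      exact ⟨⟨hp, (over_iff_of_mem hx₀).mpr hpx, hpv⟩, hd⟩
    · rintro ⟨⟨hp, hpx, hpv⟩, hd⟩
      exact ⟨hp, (over_iff_of_mem hx₀).mp hpx, hpv, hd⟩
  -- Sorting the branches by side, the right turns occur on both sides.
  have h3 : (Subtype.val '' {k : L.Branch x₀ | v k.pt.1 k.pt.2 < c}) =
      ((fun p => (p, true)) '' (P ∪ R)) ∪ ((fun p => (p, false)) '' (N ∪ R)) := by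
    ext ⟨p, b⟩
    constructor
    · rintro ⟨⟨⟨q, b'⟩, ⟨hq, ho⟩, hr⟩, hk, h⟩
      cases h
      have hkA : p ∈ A := ⟨hq, ho, hk⟩
      cases b
      · exact Or.inr ⟨p, hr.elim (fun h => Or.inl ⟨hkA, h⟩) fun h => Or.inr ⟨hkA, h⟩, rfl⟩
      · exact Or.inl ⟨p, hr.elim (fun h => Or.inl ⟨hkA, h⟩) fun h => Or.inr ⟨hkA, h⟩, rfl⟩
    · rintro (⟨q, hq, h⟩ | ⟨q, hq, h⟩) <;> cases h
      · have hpA : p ∈ A := hq.elim (fun h => h.1) fun h => h.1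
        exact ⟨⟨(p, true), ⟨hpA.1, hpA.2.1⟩, hq.imp (fun h => h.2) fun h => h.2⟩, hpA.2.2, rfl⟩
      · have hpA : p ∈ A := hq.elim (fun h => h.1) fun h => h.1
        exact ⟨⟨(p, false), ⟨hpA.1, hpA.2.1⟩, hq.imp (fun h => h.2) fun h => h.2⟩, hpA.2.2, rfl⟩
  have h4 : {k : L.Branch x₀ | v k.pt.1 k.pt.2 < c}.ncard =
      (Subtype.val '' {k : L.Branch x₀ | v k.pt.1 k.pt.2 < c}).ncard :=
    (ncard_image_of_injective _ Subtype.val_injective).symm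
  rw [strandsBelow, h1, h2, h4, h3,
    ncard_union_eq (by
      rw [Set.disjoint_left]
      rintro _ ⟨p, -, rfl⟩ ⟨q, -, h⟩
      simp at h) ((hP.union hR).image _) ((hN.union hR).image _),
    ncard_image_of_injective _ (fun p q h => congrArg Prod.fst h),
    ncard_image_of_injective _ (fun p q h => congrArg Prod.fst h),
    ncard_union_eq (by
      rw [Set.disjoint_left]
      intro p hp hq
      exact hp.2.ne' hq.2.1) hP hR,
    ncard_union_eq (by
      rw [Set.disjoint_left]
      intro p hp hq
      exact hp.2.ne hq.2.1) hN hR,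
    ncard_union_eq (by
      rw [Set.disjoint_left]
      intro p hp hq
      exact hp.2.not_gt hq.2) hP hN]
  omega

/-! ### Double points of fronts -/

/-- Near a cusp, the front curve has nonzero height differences over its own vertical chords. -/
theorem exists_strictMonoOn_cusp (hL : L.GenericFront) {i : ι} {t₀ : ℝ}
    (h0 : deriv (L.x i) t₀ = 0) : ∃ ρ > 0, StrictMonoOn
      (fun t => deriv (L.y i) t₀ * deriv (deriv (L.x i)) t₀ * (L.z i t - L.y i t₀ * L.x i t))
      (Icc (t₀ - ρ) (t₀ + ρ)) := by
  set κ := deriv (L.y i) t₀ * deriv (deriv (L.x i)) t₀ with hκ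
  have hy : deriv (L.y i) t₀ ≠ 0 := fun h => L.immersed i t₀ ⟨h0, h, by
    rw [L.legendrian, h0, mul_zero]⟩
  have hκ0 : κ ≠ 0 := mul_ne_zero hy (deriv_ne_or hL i t₀ h0)
  -- The derivative of the function is `κ * (y - y t₀) * x'`. Both `y - y t₀` and `x'` vanish to
  -- first order at `t₀`, so it behaves like `κ ^ 2 * (t - t₀) ^ 2` and is positive on both sides.
  have h1 := hasDerivAt_iff_tendsto_slope.mp (hasDerivAt_y (L := L) i t₀)
  have h2 := hasDerivAt_iff_tendsto_slope.mp
    ((L.contDiff_deriv_x i).differentiable (by simp) t₀).hasDerivAt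
  have h3 := (h1.mul h2).const_mul κ
  have h4 : 0 < κ * (deriv (L.y i) t₀ * deriv (deriv (L.x i)) t₀) := by
    rw [← hκ]; exact mul_self_pos.mpr hκ0
  have h5 : ∀ᶠ t in 𝓝[≠] t₀, 0 < κ * ((L.y i t - L.y i t₀) * deriv (L.x i) t) := by
    filter_upwards [h3.eventually_const_lt h4, self_mem_nhdsWithin] with t ht htt
    have hne : t - t₀ ≠ 0 := sub_ne_zero.mpr htt
    simp only [slope_def_field, h0, sub_zero] at ht
    have hmul := mul_pos ht (mul_self_pos.mpr hne)
    have : κ * ((L.y i t - L.y i t₀) / (t - t₀) * (deriv (L.x i) t / (t - t₀))) *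
        ((t - t₀) * (t - t₀)) = κ * ((L.y i t - L.y i t₀) * deriv (L.x i) t) := by
      field_simp
    rwa [this] at hmul
  obtain ⟨ρ, hρ, h6⟩ := Metric.eventually_nhds_iff.mp (eventually_nhdsWithin_iff.mp h5)
  have hd : ∀ t, HasDerivAt (fun t => κ * (L.z i t - L.y i t₀ * L.x i t))
      (κ * ((L.y i t - L.y i t₀) * deriv (L.x i) t)) t := by
    intro t
    have := ((hasDerivAt_z (L := L) i t).sub ((hasDerivAt_x (L := L) i t).const_mul
      (L.y i t₀))).const_mul κ
    exact this.congr_deriv (by ring)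
  have hcont : Continuous (fun t => κ * (L.z i t - L.y i t₀ * L.x i t)) :=
    continuous_iff_continuousAt.mpr fun t => (hd t).continuousAt
  refine ⟨ρ / 2, by linarith, ?_⟩
  have hA : StrictMonoOn (fun t => κ * (L.z i t - L.y i t₀ * L.x i t)) (Icc (t₀ - ρ / 2) t₀) := by
    refine strictMonoOn_of_deriv_pos (convex_Icc _ _) hcont.continuousOn fun t ht => ?_
    rw [interior_Icc] at ht
    rw [(hd t).deriv]
    refine h6 ?_ ht.2.ne
    rw [Real.dist_eq, abs_lt]; constructor <;> linarith [ht.1, ht.2]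
  have hB : StrictMonoOn (fun t => κ * (L.z i t - L.y i t₀ * L.x i t)) (Icc t₀ (t₀ + ρ / 2)) := by
    refine strictMonoOn_of_deriv_pos (convex_Icc _ _) hcont.continuousOn fun t ht => ?_
    rw [interior_Icc] at ht
    rw [(hd t).deriv]
    refine h6 ?_ ht.1.ne'
    rw [Real.dist_eq, abs_lt]; constructor <;> linarith [ht.1, ht.2]
  have hAB := hA.union hB ⟨right_mem_Icc.mpr (by linarith), fun t ht => ht.2⟩
    ⟨left_mem_Icc.mpr (by linarith), fun t ht => ht.1⟩
  rwa [Icc_union_Icc_eq_Icc (by linarith) (by linarith)] at hAB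

theorem eventually_x_injective {i : ι} {t₀ : ℝ} (h : deriv (L.x i) t₀ ≠ 0) :
    ∀ᶠ q in 𝓝 t₀ ×ˢ 𝓝 t₀, L.x i q.1 = L.x i q.2 → q.1 = q.2 := by
  obtain ⟨σ, -, -, h3⟩ := exists_local_inverse (L.smooth_x i) h
  filter_upwards [tendsto_fst.eventually h3, tendsto_snd.eventually h3] with q h4 h5 heq
  rw [← h4, ← h5, heq]

/-- Points of the link near `(i, s₀)` and `(j, t₀)` lie over each other only if these two points do,
and then with the same shift. -/
theorem eventually_shift_eq (i j : ι) (s₀ t₀ : ℝ) : ∀ᶠ q in 𝓝 s₀ ×ˢ 𝓝 t₀, ∀ n : ℤ,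
    L.x i q.1 = L.x j q.2 + n → L.x i s₀ = L.x j t₀ + n := by
  have hx : Tendsto (fun q : ℝ × ℝ => L.x i q.1 - L.x j q.2) (𝓝 s₀ ×ˢ 𝓝 t₀)
      (𝓝 (L.x i s₀ - L.x j t₀)) :=
    ((L.smooth_x i).continuous.continuousAt.tendsto.comp tendsto_fst).sub
      ((L.smooth_x j).continuous.continuousAt.tendsto.comp tendsto_snd)
  by_cases h : ∃ m : ℤ, L.x i s₀ - L.x j t₀ = m
  · obtain ⟨m, hm⟩ := h
    filter_upwards [eventually_int_eq_zero hx] with q hq n hn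
    have := hq (n - m) (by push_cast; linarith)
    have hnm : n = m := by omega
    subst hnm
    linarith
  · filter_upwards [eventually_ne_int hx fun m hm => h ⟨m, hm⟩] with q hq n hn
    exact absurd (by linarith) (hq n)

/-- The two curves through a transverse double point of a front, as graphs over the base. -/
theorem exists_sections {i j : ι} {s₀ t₀ : ℝ} {n : ℤ} (hx : L.x i s₀ = L.x j t₀ + n)
    (hi : deriv (L.x i) s₀ ≠ 0) (hj : deriv (L.x j) t₀ ≠ 0) :
    ∃ σ τ : ℝ → ℝ, σ (L.x i s₀) = s₀ ∧ τ (L.x i s₀) = t₀ ∧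
      (∀ᶠ ξ in 𝓝 (L.x i s₀), L.x i (σ ξ) = ξ ∧ L.x j (τ ξ) + n = ξ ∧
        deriv (L.x i) (σ ξ) ≠ 0 ∧ deriv (L.x j) (τ ξ) ≠ 0 ∧
        HasDerivAt σ (deriv (L.x i) (σ ξ))⁻¹ ξ ∧ HasDerivAt τ (deriv (L.x j) (τ ξ))⁻¹ ξ) ∧
      (∀ᶠ s in 𝓝 s₀, σ (L.x i s) = s) ∧ ∀ᶠ t in 𝓝 t₀, τ (L.x j t + n) = t := by
  obtain ⟨σ, a1, a2, a3⟩ := exists_local_inverse (L.smooth_x i) hi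
  have hs : ContDiff ℝ ∞ (fun t => L.x j t + n) := (L.smooth_x j).add contDiff_const
  have hd : deriv (fun t => L.x j t + n) = deriv (L.x j) := by ext t; simp
  obtain ⟨τ, b1, b2, b3⟩ := exists_local_inverse (t₀ := t₀) hs (by rw [hd]; exact hj)
  rw [hd] at b2
  simp only [← hx] at b1 b2
  refine ⟨σ, τ, a1, b1, ?_, a3, b3⟩
  filter_upwards [a2, b2] with ξ h1 h2
  exact ⟨h1.1, h2.1, h1.2.1, h2.2.1, h1.2.2, h2.2.2⟩

/-- The height difference along two sections. -/
theorem hasDerivAt_z_section {i : ι} {σ : ℝ → ℝ} {ξ : ℝ} (h : deriv (L.x i) (σ ξ) ≠ 0)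
    (hσ : HasDerivAt σ (deriv (L.x i) (σ ξ))⁻¹ ξ) :
    HasDerivAt (fun ξ => L.z i (σ ξ)) (L.y i (σ ξ)) ξ := by
  have := (hasDerivAt_z (L := L) i (σ ξ)).comp ξ hσ
  rwa [mul_assoc, mul_inv_cancel₀ h, mul_one] at this

theorem hasDerivAt_y_section {i : ι} {σ : ℝ → ℝ} {ξ : ℝ}
    (hσ : HasDerivAt σ (deriv (L.x i) (σ ξ))⁻¹ ξ) :
    HasDerivAt (fun ξ => L.y i (σ ξ)) (deriv (L.y i) (σ ξ) / deriv (L.x i) (σ ξ)) ξ :=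
  (hasDerivAt_y (L := L) i (σ ξ)).comp ξ hσ

theorem point_eq_of_over {v : ι → ℝ → ℝ} {p q : ι × ℝ}
    (h : Int.fract (L.x p.1 p.2) = Int.fract (L.x q.1 q.2)) (hv : v p.1 p.2 = v q.1 q.2) :
    point L.x v p = point L.x v q := Prod.ext h hv

/-- At a double point of a generic front, both curves are regular, with different slopes. -/
theorem double_regular (hL : L.GenericFront) {i j : ι} {s t : ℝ} {n : ℤ}
    (hne : parOf (i, s) ≠ parOf (j, t)) (hx : L.x i s = L.x j t + n)
    (hz : L.z i s = L.z j t) :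
    deriv (L.x i) s ≠ 0 ∧ deriv (L.x j) t ≠ 0 ∧ L.y i s ≠ L.y j t := by
  have hpt : point L.x L.z (parOf (i, s)) = point L.x L.z (parOf (j, t)) := by
    refine point_eq_of_over ?_ ?_
    · rw [fract_x_parOf, fract_x_parOf]; simp only [hx, Int.fract_add_intCast]
    · rw [z_parOf, z_parOf]; exact hz
  have h1 := hL.double_ne_turn _ (parOf_mem _) _ (parOf_mem _) hne hpt
  have h2 := hL.double_ne_turn _ (parOf_mem _) _ (parOf_mem _) hne.symm hpt.symm
  rw [der_x_parOf] at h1 h2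
  -- Equal `y` would make the two points coincide in `J¹(S¹)`, so embeddedness separates the slopes.
  refine ⟨h1, h2, fun hy => L.embedded i j s t ⟨n, hx⟩ hy hz |> fun h => hne ?_⟩
  exact parOf_eq_parOf_iff.mpr h

/-- Double points of a generic front are isolated. -/
theorem eventually_not_double (hL : L.GenericFront) (i j : ι) (s₀ t₀ : ℝ) :
    ∀ᶠ q in 𝓝 s₀ ×ˢ 𝓝 t₀, parOf (i, q.1) ≠ parOf (j, q.2) → ∀ n : ℤ,
      L.x i q.1 = L.x j q.2 + n → L.z i q.1 = L.z j q.2 → q = (s₀, t₀) := by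
  have hz : Tendsto (fun q : ℝ × ℝ => L.z i q.1 - L.z j q.2) (𝓝 s₀ ×ˢ 𝓝 t₀)
      (𝓝 (L.z i s₀ - L.z j t₀)) :=
    ((L.smooth_z i).continuous.continuousAt.tendsto.comp tendsto_fst).sub
      ((L.smooth_z j).continuous.continuousAt.tendsto.comp tendsto_snd)
  by_cases hz0 : L.z i s₀ = L.z j t₀
  swap
  · filter_upwards [hz.eventually_ne (sub_ne_zero.mpr hz0)] with q hq _ n _ h
    exact absurd (sub_eq_zero.mpr h) hq
  by_cases hx0 : ∃ n : ℤ, L.x i s₀ = L.x j t₀ + n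
  swap
  · filter_upwards [eventually_shift_eq i j s₀ t₀] with q hq _ n h _
    exact absurd ⟨n, hq n h⟩ hx0
  obtain ⟨n, hn⟩ := hx0
  -- Near one point of the link, the curve has no double points, by the monotone function at a cusp
  -- or by injectivity of `x` elsewhere. Near a genuine crossing, the height difference along the
  -- two graphs has nonzero derivative, the difference of the `y`-values.
  by_cases hpar : parOf (i, s₀) = parOf (j, t₀)
  · obtain ⟨hij, m, hm⟩ := parOf_eq_parOf_iff.mp hpar
    simp only at hij hm
    subst hij
    have hsh : Tendsto (fun q : ℝ × ℝ => (q.1, q.2 + m)) (𝓝 s₀ ×ˢ 𝓝 t₀) (𝓝 s₀ ×ˢ 𝓝 s₀) := by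
      refine tendsto_fst.prodMk ?_
      rw [hm]
      exact tendsto_snd.add_const _
    have hinj : ∀ᶠ q in 𝓝 s₀ ×ˢ 𝓝 s₀, L.x i q.1 = L.x i q.2 → L.z i q.1 = L.z i q.2 →
        q.1 = q.2 := by
      by_cases hd : deriv (L.x i) s₀ = 0
      · obtain ⟨ρ, hρ, h⟩ := exists_strictMonoOn_cusp hL hd
        have hmem : Icc (s₀ - ρ) (s₀ + ρ) ∈ 𝓝 s₀ := Icc_mem_nhds (by linarith) (by linarith)
        filter_upwards [prod_mem_prod hmem hmem] with q hq h1 h2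
        exact h.injOn hq.1 hq.2 (by simp only [h1, h2])
      · filter_upwards [eventually_x_injective hd] with q hq h1 _ using hq h1
    filter_upwards [eventually_shift_eq i i s₀ t₀, hsh.eventually hinj] with q h1 h2 hne k hk hzq
    have hxm := L.x_add_int i t₀ m
    have hxq := L.x_add_int i q.2 m
    rw [← hm] at hxm
    have := h2 (by linarith [h1 k hk]) (by rw [(L.periodic_z i).add_int]; exact hzq)
    exact (hne (parOf_eq_parOf_iff.mpr ⟨rfl, m, this⟩)).elim
  · obtain ⟨hi, hj, hy⟩ := double_regular hL hpar hn hz0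
    obtain ⟨σ, τ, h1, h2, h3, h4, h4'⟩ := exists_sections hn hi hj
    have h5 := h3.self_of_nhds
    have hD := (hasDerivAt_z_section h5.2.2.1 h5.2.2.2.2.1).sub
      (hasDerivAt_z_section h5.2.2.2.1 h5.2.2.2.2.2)
    rw [h1, h2] at hD
    have hev := eventually_nhdsWithin_iff.mp (hD.eventually_ne (c := 0) (sub_ne_zero.mpr hy))
    have hxc : Tendsto (fun q : ℝ × ℝ => L.x i q.1) (𝓝 s₀ ×ˢ 𝓝 t₀) (𝓝 (L.x i s₀)) :=
      (L.smooth_x i).continuous.continuousAt.tendsto.comp tendsto_fst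
    filter_upwards [tendsto_fst.eventually h4, tendsto_snd.eventually h4', hxc.eventually hev,
      eventually_shift_eq i j s₀ t₀] with q h6 h6' h7 hsh _ k hk hzq
    have hkn : (k : ℝ) = n := by linarith [hsh k hk]
    have h8 : q.1 = σ (L.x i q.1) := h6.symm
    have h9 : q.2 = τ (L.x i q.1) := by rw [hk, hkn, h6']
    by_cases hξ : L.x i q.1 = L.x i s₀
    · rw [hξ, h1] at h8
      rw [hξ, h2] at h9
      exact Prod.ext h8 h9
    · refine absurd ?_ (h7 hξ)
      simp only [Pi.sub_apply, ← h8, ← h9, hzq, sub_self]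

theorem exists_shift_of_fract {p q : ι × ℝ}
    (h : Int.fract (L.x p.1 p.2) = Int.fract (L.x q.1 q.2)) :
    ∃ n : ℤ, L.x p.1 p.2 = L.x q.1 q.2 + n := by
  obtain ⟨n, hn⟩ := Int.fract_eq_fract.mp h
  exact ⟨n, by linarith⟩

theorem finite_turn [Finite ι] (hL : L.GenericFront) : {p ∈ Par ι | der L.x p = 0}.Finite :=
  finite_par_of_eventually (p := fun i s => deriv (L.x i) s = 0) (eventually_deriv_x_ne hL)

/-- Infinitely many double points would accumulate in the compact square of parameters, against
`eventually_not_double`. -/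
theorem finite_singular [Finite ι] (hL : L.GenericFront) :
    {P | Singular L.x L.z P}.Finite := by
  have h2 : ∀ i j, {q : ℝ × ℝ | q ∈ Icc (0 : ℝ) 1 ×ˢ Icc (0 : ℝ) 1 ∧
      parOf (i, q.1) ≠ parOf (j, q.2) ∧ (∃ n : ℤ, L.x i q.1 = L.x j q.2 + n) ∧
      L.z i q.1 = L.z j q.2}.Finite := by
    intro i j
    by_contra hinf
    obtain ⟨⟨s, t⟩, -, ht⟩ := Set.Infinite.exists_accPt_of_subset_isCompact hinf
      ((isCompact_Icc (a := (0 : ℝ)) (b := 1)).prod (isCompact_Icc (a := (0 : ℝ)) (b := 1)))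
      (fun s hs => hs.1)
    rw [accPt_iff_frequently] at ht
    refine ht ?_
    rw [nhds_prod_eq]
    filter_upwards [eventually_not_double hL i j s t] with q hq
    rintro ⟨hne, -, h3, ⟨n, h4⟩, h5⟩
    exact hne (hq h3 n h4 h5)
  refine (((finite_turn hL).image (point L.x L.z)).union (Set.finite_iUnion fun ij : ι × ι =>
    (h2 ij.1 ij.2).image fun q => point L.x L.z (ij.1, q.1))).subset ?_
  rintro P (⟨p, hp, rfl, hd⟩ | ⟨p, hp, q, hq, hne, hpP, hqP⟩)
  · exact Or.inl ⟨p, ⟨hp, hd⟩, rfl⟩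
  · refine Or.inr (Set.mem_iUnion.mpr ⟨(p.1, q.1), (p.2, q.2), ⟨⟨⟨hp.1, hp.2.le⟩, hq.1, hq.2.le⟩,
      ?_, ?_, ?_⟩, hpP⟩)
    · change parOf p ≠ parOf q
      rwa [parOf_of_mem hp, parOf_of_mem hq]
    · exact exists_shift_of_fract (congrArg Prod.fst (hpP.trans hqP.symm))
    · exact congrArg Prod.snd (hpP.trans hqP.symm)

theorem exists_isFrontEvent (hL : L.GenericFront) {P : ℝ × ℝ} (hP : Singular L.x L.z P) :
    ∃ e, L.IsFrontEvent P e := by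
  rcases hP with ⟨p, hp, hpP, hd⟩ | h
  · rcases lt_or_gt_of_ne (hL.nondegenerate p hp hd) with h | h
    · exact ⟨⟨.rightCusp, _⟩, rfl, p, hp, hpP, hd, h⟩
    · exact ⟨⟨.leftCusp, _⟩, rfl, p, hp, hpP, hd, h⟩
  · exact ⟨⟨.crossing, _⟩, rfl, h⟩

theorem exists_hasFront [Finite ι] (hL : L.GenericFront) : ∃ Z : FrontDiagram, L.HasFront Z := by
  classical
  have hfin := finite_singular hL
  obtain ⟨a, hp, ha⟩ := exists_perm_pairwise_readsBefore id hfin.toFinset.toList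
    (by rw [List.map_id]; exact Finset.nodup_toList _)
  have hmem : ∀ P, P ∈ a ↔ Singular L.x L.z P := fun P => by
    rw [hp.mem_iff, Finset.mem_toList, Set.Finite.mem_toFinset, mem_ofPred_eq]
  have hev : ∀ P, ∃ e, Singular L.x L.z P → L.IsFrontEvent P e := fun P => by
    by_cases h : Singular L.x L.z P
    · obtain ⟨e, he⟩ := exists_isFrontEvent hL h
      exact ⟨e, fun _ => he⟩
    · exact ⟨⟨.crossing, 0⟩, fun h' => absurd h' h⟩
  choose e he using hev
  refine ⟨⟨_, a.map e⟩, hL, rfl, a, ha, hmem, ?_⟩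
  rw [List.forall₂_map_right_iff, List.forall₂_same]
  exact fun P hP => he P ((hmem P).mp hP)

end LegendrianLink

end

section
open Set Filter Topology Projection

namespace LegendrianLink

variable {ι : Type*} {L : LegendrianLink ι}

/-! ### Small perturbations of a front -/

variable (L)

/-- The front, perturbed in the direction of its slope. -/
noncomputable def height (ε : ℝ) (i : ι) (t : ℝ) : ℝ := L.z i t + ε * L.y i t

/-- The slope of the perturbed front. -/
noncomputable def heightSlope (ε : ℝ) (p : ι × ℝ) : ℝ :=
  L.y p.1 p.2 + ε * (der L.y p / der L.x p)

variable {L}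

theorem periodic_height (ε : ℝ) (i : ι) : Function.Periodic (L.height ε i) 1 := by
  intro t
  simp only [height, L.periodic_z i t, L.periodic_y i t]

theorem height_parOf (ε : ℝ) (p : ι × ℝ) :
    L.height ε (parOf p).1 (parOf p).2 = L.height ε p.1 p.2 :=
  (periodic_height ε p.1).apply_fract p.2

theorem heightSlope_parOf (ε : ℝ) (p : ι × ℝ) :
    L.heightSlope ε (parOf p) = L.heightSlope ε p := by
  rw [heightSlope, y_parOf, der_x_parOf, der_y_parOf, heightSlope]

theorem hasDerivAt_height_section {i : ι} {σ : ℝ → ℝ} {ξ : ℝ} (ε : ℝ)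
    (h : deriv (L.x i) (σ ξ) ≠ 0) (hσ : HasDerivAt σ (deriv (L.x i) (σ ξ))⁻¹ ξ) :
    HasDerivAt (fun ξ => L.height ε i (σ ξ)) (L.heightSlope ε (i, σ ξ)) ξ :=
  (hasDerivAt_z_section h hσ).add ((hasDerivAt_y_section hσ).const_mul ε)

theorem continuous_height (i : ι) : Continuous fun q : ℝ × ℝ => L.height q.1 i q.2 :=
  ((L.smooth_z i).continuous.comp continuous_snd).add
    (continuous_fst.mul ((L.smooth_y i).continuous.comp continuous_snd))

theorem tendsto_height {α : Type*} {l : Filter α} {e u : α → ℝ} {t : ℝ} (i : ι)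
    (he : Tendsto e l (𝓝 0)) (hu : Tendsto u l (𝓝 t)) :
    Tendsto (fun a => L.height (e a) i (u a)) l (𝓝 (L.z i t)) := by
  have h := (continuous_height (L := L) i).tendsto (0, t)
  have h0 : L.height (0, t).1 i (0, t).2 = L.z i t := by simp [height]
  rw [h0] at h
  exact h.comp (he.prodMk_nhds hu)

/-- Representatives of the points of the link near `p`. -/
noncomputable def nearPar (p : ι × ℝ) : Filter (ι × ℝ) := map (fun t => parOf (p.1, t)) (𝓝 p.2)

theorem eventually_near {l : Filter ℝ} {p q : ι × ℝ} {Q : ℝ × (ι × ℝ) × (ι × ℝ) → Prop}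
    (h : ∀ᶠ w in l ×ˢ (𝓝 p.2 ×ˢ 𝓝 q.2), Q (w.1, parOf (p.1, w.2.1), parOf (q.1, w.2.2))) :
    ∀ᶠ w in l ×ˢ (nearPar p ×ˢ nearPar q), Q w := by
  rw [nearPar, nearPar, prod_map_map_eq, ← map_id (f := l), prod_map_map_eq, eventually_map]
  exact h

theorem eventually_near_iff {l : Filter ℝ} {p q : ι × ℝ} {Q : ℝ × (ι × ℝ) × (ι × ℝ) → Prop} :
    (∀ᶠ w in l ×ˢ (nearPar p ×ˢ nearPar q), Q w) ↔
    ∀ᶠ w in l ×ˢ (𝓝 p.2 ×ˢ 𝓝 q.2), Q (w.1, parOf (p.1, w.2.1), parOf (q.1, w.2.2)) := by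
  rw [nearPar, nearPar, prod_map_map_eq, ← map_id (f := l), prod_map_map_eq, eventually_map]
  rfl

theorem nearPar_parOf (p : ι × ℝ) : nearPar (parOf p) = nearPar p := by
  have h : (fun t => parOf (p.1, t)) = (fun t => parOf (p.1, t)) ∘ (fun t => t + (-⌊p.2⌋ : ℤ)) := by
    ext1 t
    exact parOf_eq_parOf_iff.mpr ⟨rfl, ⌊p.2⌋, by simp⟩
  have h2 : map (fun t : ℝ => t + (-⌊p.2⌋ : ℤ)) (𝓝 p.2) = 𝓝 (parOf p).2 := by
    rw [map_add_right_nhds]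
    simp [parOf, Int.fract, sub_eq_add_neg]
  conv_rhs => rw [nearPar, h, ← map_map, h2]
  rfl

theorem eventually_near_swap {l : Filter ℝ} {p q : ι × ℝ} {Q : ℝ × (ι × ℝ) × (ι × ℝ) → Prop}
    (h : ∀ᶠ w in l ×ˢ (nearPar p ×ˢ nearPar q), Q (w.1, w.2.2, w.2.1)) :
    ∀ᶠ w in l ×ˢ (nearPar q ×ˢ nearPar p), Q w := by
  have ht : Tendsto (fun w : ℝ × (ι × ℝ) × (ι × ℝ) => (w.1, w.2.2, w.2.1))
      (l ×ˢ (nearPar q ×ˢ nearPar p)) (l ×ˢ (nearPar p ×ˢ nearPar q)) :=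
    tendsto_fst.prodMk ((tendsto_snd.comp tendsto_snd).prodMk (tendsto_fst.comp tendsto_snd))
  exact ht.eventually h

/-- Two distinct points of the link at the same place of the perturbed front. -/
def IsDouble (L : LegendrianLink ι) (w : ℝ × (ι × ℝ) × (ι × ℝ)) : Prop :=
  w.2.1 ≠ w.2.2 ∧ Int.fract (L.x w.2.1.1 w.2.1.2) = Int.fract (L.x w.2.2.1 w.2.2.2) ∧
    L.height w.1 w.2.1.1 w.2.1.2 = L.height w.1 w.2.2.1 w.2.2.2

theorem isDouble_parOf {ε s t : ℝ} {i j : ι}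
    (h : L.IsDouble (ε, parOf (i, s), parOf (j, t))) :
    parOf (i, s) ≠ parOf (j, t) ∧ (∃ n : ℤ, L.x i s = L.x j t + n) ∧
      L.height ε i s = L.height ε j t := by
  obtain ⟨h1, h2, h3⟩ := h
  simp only at h1 h2 h3
  rw [fract_x_parOf, fract_x_parOf] at h2
  rw [height_parOf, height_parOf] at h3
  exact ⟨h1, exists_shift_of_fract h2, h3⟩

theorem tendsto_fst_zero {α : Type*} {l : Filter α} :
    Tendsto (fun w : ℝ × α => w.1) (𝓝[>] 0 ×ˢ l) (𝓝 0) :=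
  (tendsto_id.mono_left nhdsWithin_le_nhds).comp tendsto_fst

theorem eventually_not_isDouble_of_z_ne {p q : ι × ℝ} (h : L.z p.1 p.2 ≠ L.z q.1 q.2) :
    ∀ᶠ w in 𝓝[>] 0 ×ˢ (nearPar p ×ˢ nearPar q), ¬ L.IsDouble w := by
  refine eventually_near ?_
  have h1 := tendsto_height (L := L) p.1 (tendsto_fst_zero (l := 𝓝 p.2 ×ˢ 𝓝 q.2))
    (tendsto_fst.comp tendsto_snd)
  have h2 := tendsto_height (L := L) q.1 (tendsto_fst_zero (l := 𝓝 p.2 ×ˢ 𝓝 q.2))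
    (tendsto_snd.comp tendsto_snd)
  filter_upwards [(h1.sub h2).eventually_ne (sub_ne_zero.mpr h)] with w hw hd
  exact hw (sub_eq_zero.mpr (isDouble_parOf hd).2.2)

theorem eventually_not_isDouble_of_fract_ne {p q : ι × ℝ}
    (h : Int.fract (L.x p.1 p.2) ≠ Int.fract (L.x q.1 q.2)) :
    ∀ᶠ w in 𝓝[>] 0 ×ˢ (nearPar p ×ˢ nearPar q), ¬ L.IsDouble w := by
  refine eventually_near ?_
  filter_upwards [tendsto_snd.eventually (eventually_shift_eq (L := L) p.1 q.1 p.2 q.2)] with w hw hd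
  obtain ⟨n, hn⟩ := (isDouble_parOf hd).2.1
  exact h (by rw [hw n hn, Int.fract_add_intCast])

theorem shift_self {i : ι} {t₀ : ℝ} : ∀ᶠ q in 𝓝 t₀ ×ˢ 𝓝 t₀, ∀ n : ℤ,
    L.x i q.1 = L.x i q.2 + n → L.x i q.1 = L.x i q.2 := by
  filter_upwards [eventually_shift_eq (L := L) i i t₀ t₀] with q hq n hn
  have := hq n hn
  linarith

theorem eventually_not_isDouble_of_regular {p : ι × ℝ} (h : der L.x p ≠ 0) :
    ∀ᶠ w in 𝓝[>] 0 ×ˢ (nearPar p ×ˢ nearPar p), ¬ L.IsDouble w := by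
  refine eventually_near ?_
  filter_upwards [tendsto_snd.eventually (shift_self (L := L) (i := p.1) (t₀ := p.2)),
    tendsto_snd.eventually (eventually_x_injective (L := L) h)] with w h1 h2 hd
  obtain ⟨h3, ⟨n, hn⟩, -⟩ := isDouble_parOf hd
  exact h3 (by rw [h2 (h1 n hn)])

/-- With `β = y' (t₀)`, at two parameters with equal `x` near a left cusp both `β * z` and `β * y`
are larger at the later one. For `ε > 0` the differences of `z` and `ε * y` therefore add up instead
of cancelling. For `z` this uses `x'' (t₀) > 0`; at a right cusp the sign of that difference is
reversed. -/
theorem eventually_not_isDouble_of_leftTurn (hL : L.GenericFront) {p : ι × ℝ}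
    (h : LeftTurn L.x p) :
    ∀ᶠ w in 𝓝[>] 0 ×ˢ (nearPar p ×ˢ nearPar p), ¬ L.IsDouble w := by
  obtain ⟨i, t₀⟩ := p
  obtain ⟨h0, h1⟩ := h
  change deriv (L.x i) t₀ = 0 at h0
  change 0 < deriv (deriv (L.x i)) t₀ at h1
  obtain ⟨ρ, hρ, hΦ⟩ := exists_strictMonoOn_cusp hL h0
  set β := deriv (L.y i) t₀ with hβ
  set α := deriv (deriv (L.x i)) t₀
  have hy : β ≠ 0 := fun h => L.immersed i t₀ ⟨h0, h, by rw [L.legendrian, h0, mul_zero]⟩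
  have hpos : ∀ᶠ t in 𝓝 t₀, 0 < β * deriv (L.y i) t := by
    have hc := ((L.contDiff_deriv_y i).continuous.const_mul β).tendsto t₀
    exact hc.eventually_const_lt (mul_self_pos.mpr hy)
  obtain ⟨ρ', hρ', hball⟩ := Metric.eventually_nhds_iff.mp hpos
  have hmono : StrictMonoOn (fun t => β * L.y i t) (Icc (t₀ - ρ' / 2) (t₀ + ρ' / 2)) := by
    refine strictMonoOn_of_deriv_pos (convex_Icc _ _)
      ((L.smooth_y i).continuous.const_mul β).continuousOn fun t ht => ?_
    rw [interior_Icc] at ht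
    rw [((hasDerivAt_y (L := L) i t).const_mul β).deriv]
    refine hball ?_
    rw [Real.dist_eq, abs_lt]; constructor <;> linarith [ht.1, ht.2]
  have hm1 : Icc (t₀ - ρ) (t₀ + ρ) ∈ 𝓝 t₀ := Icc_mem_nhds (by linarith) (by linarith)
  have hm2 : Icc (t₀ - ρ' / 2) (t₀ + ρ' / 2) ∈ 𝓝 t₀ := Icc_mem_nhds (by linarith) (by linarith)
  have key : ∀ ε > 0, ∀ s ∈ Icc (t₀ - ρ) (t₀ + ρ) ∩ Icc (t₀ - ρ' / 2) (t₀ + ρ' / 2),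
      ∀ t ∈ Icc (t₀ - ρ) (t₀ + ρ) ∩ Icc (t₀ - ρ' / 2) (t₀ + ρ' / 2), s < t → L.x i s = L.x i t →
      L.height ε i s ≠ L.height ε i t := by
    intro ε hε s hs t ht hst hx heq
    have a1 := hΦ hs.1 ht.1 hst
    have a2 := hmono hs.2 ht.2 hst
    simp only [height, hx] at a1 a2 heq
    have a3 : β * L.z i s < β * L.z i t := by
      have : α * (β * L.z i s) < α * (β * L.z i t) := by linarith
      exact lt_of_mul_lt_mul_left this h1.le
    have a4 := mul_lt_mul_of_pos_left a2 hε
    have a5 := congrArg (β * ·) heq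
    linarith
  refine eventually_near ?_
  have hpos' : ∀ᶠ w : ℝ × ℝ × ℝ in 𝓝[>] 0 ×ˢ (𝓝 t₀ ×ˢ 𝓝 t₀), 0 < w.1 :=
    tendsto_fst.eventually (eventually_mem_nhdsWithin (s := Ioi (0 : ℝ)))
  have hm := inter_mem hm1 hm2
  filter_upwards [tendsto_snd.eventually (shift_self (L := L) (i := i) (t₀ := t₀)), hpos',
    tendsto_snd.eventually (tendsto_fst.eventually hm),
    tendsto_snd.eventually (tendsto_snd.eventually hm)] with w h2 h3 h4 h5 hd
  obtain ⟨h6, ⟨n, hn⟩, h7⟩ := isDouble_parOf hd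
  have h8 := h2 n hn
  rcases lt_trichotomy w.2.1 w.2.2 with h | h | h
  · exact key w.1 h3 _ h4 _ h5 h h8 h7
  · exact h6 (by rw [h])
  · exact key w.1 h3 _ h5 _ h4 h h8.symm h7.symm

/-- The points `p` (above) and `q` of the link form the crossing of the perturbed front which
belongs to the singularity `P` of the front. -/
structure ResolvesAt (L : LegendrianLink ι) (P : ℝ × ℝ) (ε : ℝ) (p q : ι × ℝ) : Prop where
  mem_left : p ∈ Par ι
  mem_right : q ∈ Par ι
  fract_eq : Int.fract (L.x p.1 p.2) = Int.fract (L.x q.1 q.2)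
  z_lt : L.z q.1 q.2 < L.z p.1 p.2
  height_eq : L.height ε p.1 p.2 = L.height ε q.1 q.2
  regular_left : der L.x p ≠ 0
  regular_right : der L.x q ≠ 0
  slope_lt : L.heightSlope ε p < L.heightSlope ε q
  strands : strandsBelow L.x (L.height ε) (Int.fract (L.x p.1 p.2), L.height ε p.1 p.2) =
    strandsBelow L.x L.z P
  eq_or_eq : ∀ r ∈ Par ι, Int.fract (L.x r.1 r.2) = Int.fract (L.x p.1 p.2) →
    L.height ε r.1 r.2 = L.height ε p.1 p.2 → r = p ∨ r = q

/-- A family of crossings of the perturbed fronts which belongs to the singularity `P` of the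
front; these are the only crossings near `P`. -/
structure IsResolution (L : LegendrianLink ι) (P : ℝ × ℝ) (p q : ℝ → ι × ℝ) : Prop where
  tendsto : Tendsto (fun ε => Int.fract (L.x (p ε).1 (p ε).2)) (𝓝[>] 0) (𝓝[<] P.1)
  resolves : ∀ᶠ ε in 𝓝[>] 0, L.ResolvesAt P ε (p ε) (q ε)
  isolated : ∀ p₀ ∈ Par ι, ∀ q₀ ∈ Par ι, point L.x L.z p₀ = P → point L.x L.z q₀ = P →
    ∀ᶠ w in 𝓝[>] 0 ×ˢ (nearPar p₀ ×ˢ nearPar q₀), L.IsDouble w →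
      w.2.1 = p w.1 ∨ w.2.1 = q w.1

theorem over_of_point {p : ι × ℝ} {v : ι → ℝ → ℝ} {P : ℝ × ℝ} (h : point L.x v p = P) :
    P.1 ∈ Ico (0 : ℝ) 1 ∧ L.Over P.1 p := by
  have h1 : Int.fract (L.x p.1 p.2) = P.1 := congrArg Prod.fst h
  have h2 : P.1 ∈ Ico (0 : ℝ) 1 := by rw [← h1]; exact ⟨Int.fract_nonneg _, Int.fract_lt_one _⟩
  exact ⟨h2, (over_iff_of_mem h2).mpr h1⟩

theorem point_branch {P : ℝ × ℝ} (hP : P.1 ∈ Ico (0 : ℝ) 1) (k : L.Branch P.1)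
    (h : L.z k.pt.1 k.pt.2 = P.2) : point L.x L.z k.pt = P :=
  Prod.ext ((over_iff_of_mem hP).mp k.2.1.2) h

/-- Strands that end above or below the point `z = c` of a vertical line remain above or below the
curve `τ` through this point. -/
theorem eventually_height_lt [Finite ι] (hL : L.GenericFront) {x₀ c t₀ : ℝ} {i : ι}
    {σ : L.Branch x₀ → ℝ → ℝ} (hσ : ∀ k, Continuous (σ k)) (hσ' : ∀ k, σ k x₀ = k.pt.2)
    {l : Filter (ℝ × ℝ)} (h1 : Tendsto Prod.fst l (𝓝 0)) (h2 : Tendsto Prod.snd l (𝓝 x₀))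
    {τ : ℝ → ℝ} (hτ : Tendsto (fun w => τ w.2) l (𝓝 t₀)) (hc : L.z i t₀ = c) :
    ∀ᶠ w in l, ∀ k : L.Branch x₀,
      (L.z k.pt.1 k.pt.2 < c → L.height w.1 k.comp (σ k w.2) < L.height w.1 i (τ w.2)) ∧
      (c < L.z k.pt.1 k.pt.2 → L.height w.1 i (τ w.2) < L.height w.1 k.comp (σ k w.2)) := by
  have := finite_branch hL x₀
  refine eventually_all.mpr fun k => ?_
  have hk : Tendsto (fun w : ℝ × ℝ => σ k w.2) l (𝓝 k.pt.2) := by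
    rw [← hσ' k]
    exact (hσ k).continuousAt.tendsto.comp h2
  have h3 := tendsto_height (L := L) k.comp h1 hk
  have h4 := tendsto_height (L := L) i h1 hτ
  rw [hc] at h4
  refine Eventually.and ?_ ?_
  · by_cases h : L.z k.pt.1 k.pt.2 < c
    · filter_upwards [h3.eventually_lt h4 h] with w hw _ using hw
    · exact Eventually.of_forall fun w h' => absurd h' h
  · by_cases h : c < L.z k.pt.1 k.pt.2
    · filter_upwards [h4.eventually_lt h3 h] with w hw _ using hw
    · exact Eventually.of_forall fun w h' => absurd h' h

/-- Position and uniqueness of a crossing of the perturbed front. -/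
theorem strandsBelow_eq_and_eq_or_eq [Finite ι] (hL : L.GenericFront) {P : ℝ × ℝ}
    (hP : P.1 ∈ Ico (0 : ℝ) 1) {σ : L.Branch P.1 → ℝ → ℝ} {ξ ε : ℝ} (hξ : ξ ∈ Ico (0 : ℝ) 1)
    (hσ : L.IsStrandsAt σ ξ) {p q : ι × ℝ} {c : ℝ} (hp : L.height ε p.1 p.2 = c)
    (hq : L.height ε q.1 q.2 = c)
    (hlt : ∀ k : L.Branch P.1, (L.z k.pt.1 k.pt.2 < P.2 → L.height ε k.comp (σ k ξ) < c) ∧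
      (P.2 < L.z k.pt.1 k.pt.2 → c < L.height ε k.comp (σ k ξ)))
    (heq : ∀ k : L.Branch P.1, L.z k.pt.1 k.pt.2 = P.2 →
      parOf (k.comp, σ k ξ) = p ∨ parOf (k.comp, σ k ξ) = q) :
    strandsBelow L.x (L.height ε) (ξ, c) = strandsBelow L.x L.z P ∧
      ∀ r ∈ Par ι, Int.fract (L.x r.1 r.2) = ξ → L.height ε r.1 r.2 = c → r = p ∨ r = q := by
  -- The strands that end at the singular point all pass through the crossing itself, so they do not
  -- count as lying below it.
  have heq' : ∀ k : L.Branch P.1, L.z k.pt.1 k.pt.2 = P.2 → L.height ε k.comp (σ k ξ) = c := by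
    intro k hk
    rw [← height_parOf ε (k.comp, σ k ξ)]
    rcases heq k hk with h | h <;> rw [h] <;> assumption
  constructor
  · rw [strandsBelow_eq_of_isStrandsAt (periodic_height ε) hσ hξ,
      show strandsBelow L.x L.z P = _ from strandsBelow_eq_ncard_branch hL (c := P.2) hP]
    congr 1
    ext k
    refine ⟨fun hk => ?_, fun hk => (hlt k).1 hk⟩
    by_contra hk'
    rw [Set.mem_ofPred_eq] at hk hk'
    rcases (not_lt.mp hk').lt_or_eq with h | h
    · exact absurd hk ((hlt k).2 h).not_gt
    · exact absurd hk (heq' k h.symm).not_lt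
  · intro r hr hrx hrc
    obtain ⟨k, hk⟩ := hσ.surj r ((over_iff_of_mem hξ).mpr hrx)
    rw [parOf_of_mem hr] at hk
    rw [hk] at hrc ⊢
    rw [height_parOf] at hrc
    rcases lt_trichotomy (L.z k.pt.1 k.pt.2) P.2 with h | h | h
    · exact absurd hrc ((hlt k).1 h).ne
    · exact heq k h
    · exact absurd hrc ((hlt k).2 h).ne'

end LegendrianLink

end

section
open Set Filter Topology Projection

namespace LegendrianLink

variable {ι : Type*} {L : LegendrianLink ι}

/-! ### Crossings of the front -/

theorem tendsto_slope_section {i : ι} {σ : ℝ → ℝ} {ξ₀ : ℝ} {α : Type*} {l : Filter α}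
    {e u : α → ℝ} (he : Tendsto e l (𝓝 0)) (hu : Tendsto u l (𝓝 ξ₀)) (hσ : ContinuousAt σ ξ₀)
    (hd : deriv (L.x i) (σ ξ₀) ≠ 0) :
    Tendsto (fun a => L.heightSlope (e a) (i, σ (u a))) l (𝓝 (L.y i (σ ξ₀))) := by
  have hs : Tendsto (fun a => σ (u a)) l (𝓝 (σ ξ₀)) := hσ.tendsto.comp hu
  have h1 := (((L.smooth_y i).continuous.tendsto _).comp hs)
  have h2 := (((L.contDiff_deriv_y i).continuous.tendsto _).comp hs)
  have h3 := (((L.contDiff_deriv_x i).continuous.tendsto _).comp hs)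
  have h4 := h1.add (he.mul (h2.div h3 hd))
  rw [zero_mul, add_zero] at h4
  exact h4

/-- Here `p₀` has the lesser slope. The difference of perturbed heights has for `ε = 0` a simple
zero at the crossing, with negative derivative `y p₀ - y q₀`, and this zero persists. It moves to
the left, and on that side the unperturbed difference is positive: the strand of lesser slope is the
upper one. -/
theorem isResolution_crossing_aux [Finite ι] (hL : L.GenericFront) {P : ℝ × ℝ} {p₀ q₀ : ι × ℝ}
    (hp₀ : p₀ ∈ Par ι) (hq₀ : q₀ ∈ Par ι) (hne : p₀ ≠ q₀) (hpP : point L.x L.z p₀ = P)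
    (hqP : point L.x L.z q₀ = P) (hy : L.y p₀.1 p₀.2 < L.y q₀.1 q₀.2) :
    ∃ p q : ℝ → ι × ℝ, L.IsResolution P p q := by
  obtain ⟨hP, m, hm⟩ := over_of_point hpP
  obtain ⟨n, hn⟩ := exists_shift_of_fract (congrArg Prod.fst (hpP.trans hqP.symm))
  have hz : L.z p₀.1 p₀.2 = L.z q₀.1 q₀.2 := congrArg Prod.snd (hpP.trans hqP.symm)
  have hzP : L.z p₀.1 p₀.2 = P.2 := congrArg Prod.snd hpP
  obtain ⟨hdp, hdq, -⟩ := double_regular (i := p₀.1) (j := q₀.1) hL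
    (by rwa [Prod.mk.eta, Prod.mk.eta, parOf_of_mem hp₀, parOf_of_mem hq₀]) hn hz
  obtain ⟨σ', τ', s1, s2, s3, s4, s5⟩ := exists_sections hn hdp hdq
  rw [hm] at s1 s2 s3
  -- the two curves, as functions of `ξ` near `P.1`
  let σ : ℝ → ℝ := fun ξ => σ' (ξ + m)
  let τ : ℝ → ℝ := fun ξ => τ' (ξ + m)
  have hsh : Tendsto (fun ξ : ℝ => ξ + m) (𝓝 P.1) (𝓝 (P.1 + m)) := tendsto_id.add_const _
  have hσ0 : σ P.1 = p₀.2 := s1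
  have hτ0 : τ P.1 = q₀.2 := s2
  have hreg : ∀ᶠ ξ in 𝓝 P.1, L.x p₀.1 (σ ξ) = ξ + m ∧ L.x q₀.1 (τ ξ) + n = ξ + m ∧
      deriv (L.x p₀.1) (σ ξ) ≠ 0 ∧ deriv (L.x q₀.1) (τ ξ) ≠ 0 ∧
      HasDerivAt σ (deriv (L.x p₀.1) (σ ξ))⁻¹ ξ ∧ HasDerivAt τ (deriv (L.x q₀.1) (τ ξ))⁻¹ ξ := by
    filter_upwards [hsh.eventually s3] with ξ ⟨h1, h2, h3, h4, h5, h6⟩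
    exact ⟨h1, h2, h3, h4, h5.comp_add_const, h6.comp_add_const⟩
  obtain ⟨-, -, r1, r2, r3, r4⟩ := hreg.self_of_nhds
  let H : ℝ → ℝ → ℝ := fun ε ξ => L.height ε p₀.1 (σ ξ) - L.height ε q₀.1 (τ ξ)
  let H' : ℝ → ℝ → ℝ := fun ε ξ => L.heightSlope ε (p₀.1, σ ξ) - L.heightSlope ε (q₀.1, τ ξ)
  have hderiv : ∀ᶠ ξ in 𝓝 P.1, ∀ ε, HasDerivAt (H ε) (H' ε ξ) ξ := by
    filter_upwards [hreg] with ξ ⟨_, _, h3, h4, h5, h6⟩ ε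
    exact (hasDerivAt_height_section ε h3 h5).sub (hasDerivAt_height_section ε h4 h6)
  have hH0 : H 0 P.1 = 0 := by simp [H, height, hσ0, hτ0, hz]
  have hHd : H' 0 P.1 = L.y p₀.1 p₀.2 - L.y q₀.1 q₀.2 := by simp [H', heightSlope, hσ0, hτ0]
  have hlin : ∀ ε ξ, H ε ξ = H 0 ξ + ε * (L.y p₀.1 (σ ξ) - L.y q₀.1 (τ ξ)) := by
    intro ε ξ; simp only [H, height]; ring
  have hε : ∀ ξ, Tendsto (fun ε => H ε ξ) (𝓝[>] 0) (𝓝 (H 0 ξ)) := by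
    intro ξ
    rw [show (fun ε => H ε ξ) = fun ε => H 0 ξ + ε * (L.y p₀.1 (σ ξ) - L.y q₀.1 (τ ξ)) from
      funext fun ε => hlin ε ξ]
    have : Tendsto (fun ε : ℝ => H 0 ξ + ε * (L.y p₀.1 (σ ξ) - L.y q₀.1 (τ ξ))) (𝓝 0)
        (𝓝 (H 0 ξ + 0 * (L.y p₀.1 (σ ξ) - L.y q₀.1 (τ ξ)))) :=
      (tendsto_id.mul_const _).const_add _
    rw [zero_mul, add_zero] at this
    exact this.mono_left nhdsWithin_le_nhds
  have hd0 := hderiv.self_of_nhds 0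
  have hsign := eventually_nhdsWithin_sign_eq_of_deriv_neg (f := H 0) (x₀ := P.1)
    (by rw [hd0.deriv, hHd]; linarith) hH0
  have hposD : ∀ᶠ ξ in 𝓝[<] P.1, 0 < H 0 ξ := by
    filter_upwards [hsign.filter_mono nhdsWithin_le_nhds, self_mem_nhdsWithin] with ξ h1 h2
    have h3 : 0 < P.1 - ξ := sub_pos.mpr (Set.mem_Iio.mp h2)
    rw [sign_pos h3] at h1
    exact sign_eq_one_iff.mp h1
  have hnegD : ∀ᶠ ξ in 𝓝[>] P.1, H 0 ξ < 0 := by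
    filter_upwards [hsign.filter_mono nhdsWithin_le_nhds, self_mem_nhdsWithin] with ξ h1 h2
    have h3 : P.1 - ξ < 0 := sub_neg.mpr (Set.mem_Ioi.mp h2)
    rw [sign_neg h3] at h1
    exact sign_eq_neg_one_iff.mp h1
  have hσc : ContinuousAt σ P.1 := r3.continuousAt
  have hτc : ContinuousAt τ P.1 := r4.continuousAt
  obtain ⟨X, hX, η, hη, hXη⟩ := exists_simple_zero (H := H) (H' := H') (x₁ := P.1)
    (m := L.y p₀.1 p₀.2 - L.y q₀.1 q₀.2) (by linarith)
    (by filter_upwards [tendsto_snd.eventually hderiv] with w hw using hw w.1)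
    (by
      have h1 := tendsto_slope_section (L := L) (tendsto_fst_zero (l := 𝓝 P.1)) tendsto_snd hσc r1
      have h2 := tendsto_slope_section (L := L) (tendsto_fst_zero (l := 𝓝 P.1)) tendsto_snd hτc r2
      rw [hσ0] at h1
      rw [hτ0] at h2
      exact h1.sub h2)
    (by filter_upwards [hposD] with ξ hξ using (hε ξ).eventually_const_lt hξ)
    (by filter_upwards [hnegD] with ξ hξ using (hε ξ).eventually_lt_const hξ)
  -- Over the original crossing the perturbed difference equals `ε * (y p₀ - y q₀) < 0`, so its zero
  -- lies further left.
  have hXlt : ∀ᶠ ε in 𝓝[>] 0, X ε < P.1 := by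
    filter_upwards [hXη, self_mem_nhdsWithin] with ε ⟨h1, _, _, h4⟩ hpos
    have h0 : H ε P.1 < 0 := by
      rw [hlin, hH0, hσ0, hτ0, zero_add]
      exact mul_neg_of_pos_of_neg hpos (by linarith)
    by_contra hle
    rcases (not_lt.mp hle).lt_or_eq with h | h
    · exact absurd h0 ((h4 P.1 (by simpa using hη)).1 h).not_gt
    · rw [h, h1] at h0
      exact lt_irrefl _ h0
  have hX' : Tendsto X (𝓝[>] 0) (𝓝[<] P.1) := tendsto_nhdsWithin_iff.mpr ⟨hX, hXlt⟩
  let p : ℝ → ι × ℝ := fun ε => parOf (p₀.1, σ (X ε))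
  let q : ℝ → ι × ℝ := fun ε => parOf (q₀.1, τ (X ε))
  have hmem : ∀ᶠ ε in 𝓝[>] 0, X ε ∈ Ico (0 : ℝ) 1 := by
    have h0 : 0 < P.1 := lt_of_le_of_ne hP.1 fun h =>
      hL.double_off_cut p₀ hp₀ q₀ hq₀ hne (hpP.trans hqP.symm) (by rw [hpP, ← h])
    filter_upwards [hX.eventually (Ioo_mem_nhds h0 hP.2)] with ε h using ⟨h.1.le, h.2⟩
  have hfr : ∀ᶠ ε in 𝓝[>] 0, Int.fract (L.x (p ε).1 (p ε).2) = X ε ∧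
      Int.fract (L.x (q ε).1 (q ε).2) = X ε := by
    filter_upwards [hX.eventually hreg, hmem] with ε ⟨h1, h2, _⟩ h3
    have h2' : L.x q₀.1 (τ (X ε)) = X ε + (m - n : ℤ) := by push_cast; linarith
    constructor
    · simp only [p]
      rw [fract_x_parOf, h1, Int.fract_add_intCast, Int.fract_eq_self.mpr h3]
    · simp only [q]
      rw [fract_x_parOf, h2', Int.fract_add_intCast, Int.fract_eq_self.mpr h3]
  have hchain : ∀ r ∈ Par ι, point L.x L.z r = P → r = p₀ ∨ r = q₀ := by
    intro r hr hrP
    by_contra hcon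
    rw [not_or] at hcon
    exact hL.no_triple r hr p₀ hp₀ q₀ hq₀ hcon.1 hne hcon.2 ⟨hrP.trans hpP.symm, hpP.trans hqP.symm⟩
  -- nearby double points
  have hiso : ∀ᶠ w in 𝓝[>] 0 ×ˢ (nearPar p₀ ×ˢ nearPar q₀), L.IsDouble w →
      w.2.1 = p w.1 ∧ w.2.2 = q w.1 := by
    refine eventually_near ?_
    have hxs : Tendsto (fun w : ℝ × ℝ × ℝ => L.x p₀.1 w.2.1 - m) (𝓝[>] 0 ×ˢ (𝓝 p₀.2 ×ˢ 𝓝 q₀.2))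
        (𝓝 P.1) := by
      have h := ((L.smooth_x p₀.1).continuous.tendsto p₀.2).sub_const (m : ℝ)
      rw [hm, add_sub_cancel_right] at h
      exact h.comp (tendsto_fst.comp tendsto_snd)
    filter_upwards [tendsto_snd.eventually (tendsto_fst.eventually s4),
      tendsto_snd.eventually (tendsto_snd.eventually s5),
      tendsto_snd.eventually (eventually_shift_eq (L := L) p₀.1 q₀.1 p₀.2 q₀.2),
      tendsto_fst.eventually hXη, hxs.eventually (Metric.ball_mem_nhds _ hη)]
      with w h1 h2 h3 ⟨h4, _, _, h5⟩ h6 hd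
    obtain ⟨_, ⟨k, hk⟩, hv⟩ := isDouble_parOf hd
    have hkn : (k : ℝ) = n := by linarith [h3 k hk]
    set ξ := L.x p₀.1 w.2.1 - m with hξ
    have e1 : w.2.1 = σ ξ := by
      simp only [σ, hξ, sub_add_cancel]; exact h1.symm
    have e2 : w.2.2 = τ ξ := by
      simp only [τ, hξ, sub_add_cancel]; rw [hk, hkn]; exact h2.symm
    have hH : H w.1 ξ = 0 := by
      simp only [H]; rw [← e1, ← e2, hv, sub_self]
    have hXξ : ξ = X w.1 := by
      rcases lt_trichotomy ξ (X w.1) with h | h | h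
      · exact absurd hH ((h5 ξ h6).1 h).ne'
      · exact h
      · exact absurd hH ((h5 ξ h6).2 h).ne
    simp only [p, q, ← hXξ, ← e1, ← e2, and_self]
  refine ⟨p, q, ?_, ?_, ?_⟩
  · refine hX'.congr' ?_
    filter_upwards [hfr] with ε h using h.1.symm
  · obtain ⟨ς, c1, c2, c3⟩ := exists_strands hL P.1
    -- Only the two branches of the crossing end at `P`; local uniqueness of the inverses identifies
    -- them with the graphs `σ` and `τ`.
    have hco : ∀ᶠ ξ in 𝓝[<] P.1, ∀ k : L.Branch P.1, L.z k.pt.1 k.pt.2 = P.2 →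
        parOf (k.comp, ς k ξ) = parOf (p₀.1, σ ξ) ∨ parOf (k.comp, ς k ξ) = parOf (q₀.1, τ ξ) := by
      have := finite_branch hL P.1
      refine eventually_all.mpr fun k => ?_
      by_cases hk : L.z k.pt.1 k.pt.2 = P.2
      swap
      · exact Eventually.of_forall fun ξ h => absurd h hk
      have hlim : Tendsto (ς k) (𝓝[<] P.1) (𝓝 k.pt.2) := by
        rw [← c2 k]; exact (c1 k).continuousAt.mono_left nhdsWithin_le_nhds
      have hid : Tendsto (fun ξ : ℝ => ξ) (𝓝[<] P.1) (𝓝 P.1) := nhdsWithin_le_nhds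
      have hxk := (((L.smooth_x k.comp).continuous.tendsto _).comp hlim).sub hid
      rcases hchain k.pt k.2.1.1 (point_branch hP k hk) with h | h
      · have hkc : k.comp = p₀.1 := congrArg Prod.fst h
        rw [h] at hlim
        have hc : L.x k.comp k.pt.2 - P.1 = m := by rw [hkc, h, hm]; ring
        rw [hc] at hxk
        filter_upwards [hlim.eventually s4, c3, eventually_int_eq_zero hxk] with ξ h1 h2 h3 _
        obtain ⟨k', hk'⟩ := h2.mem_over k
        have : k' - m = 0 := h3 (k' - m) (by
          push_cast; simp only [Function.comp_apply] at hk' ⊢; linarith)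
        have hkm : k' = m := by omega
        subst hkm
        left
        simp only [hkc] at hk'
        rw [hk'] at h1
        rw [hkc, ← h1]
      · have hkc : k.comp = q₀.1 := congrArg Prod.fst h
        rw [h] at hlim
        have hc : L.x k.comp k.pt.2 - P.1 = (m - n : ℤ) := by
          rw [hkc, h]; push_cast; linarith
        rw [hc] at hxk
        filter_upwards [hlim.eventually s5, c3, eventually_int_eq_zero hxk] with ξ h1 h2 h3 _
        obtain ⟨k', hk'⟩ := h2.mem_over k
        have : k' - (m - n) = 0 := h3 (k' - (m - n)) (by
          push_cast; simp only [Function.comp_apply] at hk' ⊢; linarith)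
        have hkm : k' = m - n := by omega
        subst hkm
        right
        simp only [hkc] at hk'
        push_cast at hk'
        rw [hk', show ξ + ((m : ℝ) - n) + n = ξ + m by ring] at h1
        rw [hkc, ← h1]
    have hpair : Tendsto (fun ε => (ε, X ε)) (𝓝[>] 0) (𝓝[>] 0 ×ˢ 𝓝 P.1) := tendsto_id.prodMk hX
    have hlt := hpair.eventually (eventually_height_lt (x₀ := P.1) (c := P.2) (i := p₀.1)
      (t₀ := p₀.2) hL c1 c2 tendsto_fst_zero tendsto_snd (τ := σ)
      (by rw [← hσ0]; exact hσc.tendsto.comp tendsto_snd) hzP)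
    filter_upwards [hXη, hX.eventually hreg, hfr, hmem, hX'.eventually hposD, hX'.eventually c3,
      hX'.eventually hco, hlt] with ε ⟨h1, _, h2, _⟩ ⟨_, _, h3, h4, _⟩ ⟨h5, h6⟩ h7 h8 h9 h10 h11
    have hv : L.height ε (p ε).1 (p ε).2 = L.height ε (q ε).1 (q ε).2 := by
      simp only [p, q, height_parOf]; exact sub_eq_zero.mp h1
    have hvp : L.height ε (p ε).1 (p ε).2 = L.height ε p₀.1 (σ (X ε)) := height_parOf ε _
    obtain ⟨h12, h13⟩ := strandsBelow_eq_and_eq_or_eq hL hP h7 h9 hvp (hv.symm.trans hvp) h11 h10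
    refine ⟨parOf_mem _, parOf_mem _, h5.trans h6.symm, ?_, hv, ?_, ?_, ?_, ?_, ?_⟩
    · simp only [p, q, z_parOf]
      simp only [H, height, zero_mul, add_zero] at h8
      linarith
    · simp only [p, der_x_parOf]; exact h3
    · simp only [q, der_x_parOf]; exact h4
    · simp only [p, q, heightSlope_parOf]; exact sub_neg.mp h2
    · rw [h5, hvp]; exact h12
    · rw [h5, hvp]; exact h13
  · intro p₁ hp₁ q₁ hq₁ hp₁P hq₁P
    rcases hchain p₁ hp₁ hp₁P with rfl | rfl <;> rcases hchain q₁ hq₁ hq₁P with rfl | rfl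
    · filter_upwards [eventually_not_isDouble_of_regular (L := L) hdp] with w h1 h2 using absurd h2 h1
    · filter_upwards [hiso] with w h1 h2 using Or.inl (h1 h2).1
    · refine eventually_near_swap ?_
      filter_upwards [hiso] with w h1 ⟨a1, a2, a3⟩ using Or.inr (h1 ⟨a1.symm, a2.symm, a3.symm⟩).2
    · filter_upwards [eventually_not_isDouble_of_regular (L := L) hdq] with w h1 h2 using absurd h2 h1

theorem exists_isResolution_crossing [Finite ι] (hL : L.GenericFront) {P : ℝ × ℝ} {p₀ q₀ : ι × ℝ}
    (hp₀ : p₀ ∈ Par ι) (hq₀ : q₀ ∈ Par ι) (hne : p₀ ≠ q₀) (hpP : point L.x L.z p₀ = P)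
    (hqP : point L.x L.z q₀ = P) : ∃ p q : ℝ → ι × ℝ, L.IsResolution P p q := by
  obtain ⟨n, hn⟩ := exists_shift_of_fract (congrArg Prod.fst (hpP.trans hqP.symm))
  obtain ⟨-, -, hy⟩ := double_regular (i := p₀.1) (j := q₀.1) hL
    (by rwa [Prod.mk.eta, Prod.mk.eta, parOf_of_mem hp₀, parOf_of_mem hq₀]) hn
    (congrArg Prod.snd (hpP.trans hqP.symm))
  rcases lt_or_gt_of_ne hy with h | h
  · exact isResolution_crossing_aux hL hp₀ hq₀ hne hpP hqP h
  · exact isResolution_crossing_aux hL hq₀ hp₀ hne.symm hqP hpP h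

end LegendrianLink

end

section
open Set Filter Topology Projection

/-! ### Asymptotics at a cusp -/

/-- A function that decreases to `0` on the left of `x₀` takes each small positive value exactly
once there. At a right cusp, `r` will be the ratio of the differences of `z` and `y` over a vertical
chord, and the equation `r = ε` selects the chord where they cancel. -/
theorem exists_tendsto_left_inverse {r r' : ℝ → ℝ} {x₀ : ℝ}
    (hr : ∀ᶠ ξ in 𝓝[<] x₀, HasDerivAt r (r' ξ) ξ ∧ r' ξ < 0 ∧ 0 < r ξ)
    (h0 : Tendsto r (𝓝[<] x₀) (𝓝 0)) :
    ∃ X : ℝ → ℝ, Tendsto X (𝓝[>] 0) (𝓝[<] x₀) ∧ (∀ᶠ ε in 𝓝[>] 0, r (X ε) = ε) ∧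
      ∀ᶠ ξ in 𝓝[<] x₀, ∀ ε, r ξ = ε → ξ = X ε := by
  obtain ⟨a, ha, h⟩ := exists_Icc_left_of_eventually hr
  have hanti : StrictAntiOn r (Ico a x₀) := by
    refine strictAntiOn_of_deriv_neg (convex_Ico _ _)
      (fun ξ hξ => (h ξ hξ).1.continuousAt.continuousWithinAt) fun ξ hξ => ?_
    rw [interior_Ico] at hξ
    have := h ξ ⟨hξ.1.le, hξ.2⟩
    rw [this.1.deriv]
    exact this.2.1
  classical
  let X : ℝ → ℝ := fun ε => if h : ∃ ξ ∈ Ico a x₀, r ξ = ε then h.choose else a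
  have hX : ∀ ξ ∈ Ico a x₀, ∀ ε, r ξ = ε → X ε = ξ := by
    intro ξ hξ ε he
    have hex : ∃ ξ ∈ Ico a x₀, r ξ = ε := ⟨ξ, hξ, he⟩
    simp only [X, dif_pos hex]
    exact hanti.injOn hex.choose_spec.1 hξ (hex.choose_spec.2.trans he.symm)
  have hex : ∀ c ∈ Ico a x₀, ∀ᶠ ε in 𝓝[>] 0, ∃ ξ ∈ Ioo c x₀, r ξ = ε := by
    intro c hc
    filter_upwards [Ioo_mem_nhdsGT (h c hc).2.2] with ε hε
    obtain ⟨b, hb, hbm⟩ := ((h0.eventually_lt_const hε.1).and (Ioo_mem_nhdsLT hc.2)).exists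
    have hcont : ContinuousOn r (Icc c b) := fun ξ hξ =>
      (h ξ ⟨hc.1.trans hξ.1, hξ.2.trans_lt hbm.2⟩).1.continuousAt.continuousWithinAt
    obtain ⟨ξ, hξ, he⟩ := intermediate_value_Icc' hbm.1.le hcont ⟨hb.le, hε.2.le⟩
    refine ⟨ξ, ⟨lt_of_le_of_ne hξ.1 ?_, hξ.2.trans_lt hbm.2⟩, he⟩
    rintro rfl
    exact hε.2.ne' he
  refine ⟨X, ?_, ?_, ?_⟩
  · refine (nhdsLT_basis x₀).tendsto_right_iff.mpr fun c hc => ?_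
    have hm : max a c ∈ Ico a x₀ := ⟨le_max_left _ _, max_lt ha hc⟩
    filter_upwards [hex _ hm] with ε ⟨ξ, hξ, he⟩
    rw [hX ξ ⟨(le_max_left _ _).trans hξ.1.le, hξ.2⟩ ε he]
    exact ⟨(le_max_right _ _).trans_lt hξ.1, hξ.2⟩
  · filter_upwards [hex a ⟨le_rfl, ha⟩] with ε ⟨ξ, hξ, he⟩
    rw [hX ξ ⟨hξ.1.le, hξ.2⟩ ε he, he]
  · filter_upwards [Ioo_mem_nhdsLT ha] with ξ hξ ε he using (hX ξ ⟨hξ.1.le, hξ.2⟩ ε he).symm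

theorem tendsto_div_of_hasDerivAt_zero {f : ℝ → ℝ} {f' : ℝ} (h : HasDerivAt f f' 0) (h0 : f 0 = 0) :
    Tendsto (fun a => f a / a) (𝓝[>] 0) (𝓝 f') := by
  have := (hasDerivAt_iff_tendsto_slope.mp h).mono_left
    (nhdsWithin_mono 0 (fun a (ha : 0 < a) => ha.ne'))
  refine this.congr fun a => ?_
  rw [slope_def_field, h0, sub_zero, sub_zero]

theorem eventually_pos_of_deriv_pos {f f' : ℝ → ℝ} (hf : ∀ a, HasDerivAt f (f' a) a)
    (h0 : f 0 = 0) (h : ∀ᶠ a in 𝓝[>] 0, 0 < f' a) : ∀ᶠ a in 𝓝[>] 0, 0 < f a := by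
  obtain ⟨b, hb, h⟩ := exists_Icc_right_of_eventually h
  have hm : StrictMonoOn f (Icc 0 b) :=
    strictMonoOn_of_deriv_pos (convex_Icc _ _)
      (fun a _ => (hf a).continuousAt.continuousWithinAt) fun t ht => by
      rw [interior_Icc] at ht
      rw [(hf t).deriv]
      exact h t ⟨ht.1, ht.2.le⟩
  filter_upwards [Ioo_mem_nhdsGT hb] with t ht
  rw [← h0]
  exact hm (left_mem_Icc.mpr hb.le) ⟨ht.1.le, ht.2.le⟩ ht.1

/-- One side of a semicubical cusp: `X`, `Y`, `Z` behave like `a²`, `a`, `a³`. -/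
theorem eventually_cusp_side {X Y Z X₁ Y₁ : ℝ → ℝ} {α γ : ℝ} (hα : 0 < α) (hγ : 0 < γ)
    (hX : ∀ a, HasDerivAt X (X₁ a) a) (hY : ∀ a, HasDerivAt Y (Y₁ a) a)
    (hZ : ∀ a, HasDerivAt Z (Y a * X₁ a) a) (hX0 : X 0 = 0) (hY0 : Y 0 = 0) (hZ0 : Z 0 = 0)
    (hX₁0 : X₁ 0 = 0) (hX₁ : HasDerivAt X₁ α 0) (hY₁ : ContinuousAt Y₁ 0) (hY₁0 : Y₁ 0 = γ) :
    ∀ᶠ a in 𝓝[>] 0, 0 < X a ∧ 0 < Y a ∧ 0 < X₁ a ∧ 0 < Z a ∧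
      Z a ≤ 9 / 10 * (X a * Y a) ∧ X a * Y₁ a ≤ 9 / 10 * (Y a * X₁ a) := by
  have l1 := tendsto_div_of_hasDerivAt_zero hX₁ hX₁0
  have l2 : Tendsto (fun a => Y a / a) (𝓝[>] 0) (𝓝 γ) :=
    tendsto_div_of_hasDerivAt_zero (hY₁0 ▸ hY 0) hY0
  have l3 : Tendsto Y₁ (𝓝[>] 0) (𝓝 γ) := by
    rw [← hY₁0]; exact hY₁.tendsto.mono_left nhdsWithin_le_nhds
  have l4 : Tendsto (fun a => X a / a ^ 2) (𝓝[>] 0) (𝓝 (α / 2)) := by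
    refine HasDerivAt.lhopital_zero_nhdsGT (f' := X₁) (g' := fun a => 2 * a)
      (Eventually.of_forall hX) (Eventually.of_forall fun a => ?_) ?_ ?_ ?_ ?_
    · simpa using hasDerivAt_pow 2 a
    · filter_upwards [self_mem_nhdsWithin] with a ha
      exact mul_ne_zero two_ne_zero (ne_of_gt ha)
    · have := (hX 0).continuousAt.tendsto
      rw [hX0] at this
      exact this.mono_left nhdsWithin_le_nhds
    · have : Tendsto (fun a : ℝ => a ^ 2) (𝓝 0) (𝓝 (0 ^ 2)) := (continuous_pow 2).tendsto 0
      rw [zero_pow two_ne_zero] at this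
      exact this.mono_left nhdsWithin_le_nhds
    · refine (l1.div_const 2).congr fun a => ?_
      rw [div_div, mul_comm]
  have hpos : ∀ᶠ a : ℝ in 𝓝[>] 0, 0 < a := eventually_mem_nhdsWithin
  have hX₁p : ∀ᶠ a in 𝓝[>] 0, 0 < X₁ a := by
    filter_upwards [l1.eventually_const_lt hα, hpos] with a h1 h2
    exact (div_pos_iff_of_pos_right h2).mp h1
  have hYp : ∀ᶠ a in 𝓝[>] 0, 0 < Y a := by
    filter_upwards [l2.eventually_const_lt hγ, hpos] with a h1 h2
    exact (div_pos_iff_of_pos_right h2).mp h1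
  have hXp := eventually_pos_of_deriv_pos hX hX0 hX₁p
  have hZp := eventually_pos_of_deriv_pos hZ hZ0 (by
    filter_upwards [hX₁p, hYp] with a h1 h2 using mul_pos h2 h1)
  have l5 : Tendsto (fun a => (X a * Y₁ a) / (Y a * X₁ a)) (𝓝[>] 0) (𝓝 (1 / 2)) := by
    have := (l4.mul l3).div (l2.mul l1) (mul_ne_zero hγ.ne' hα.ne')
    have he : α / 2 * γ / (γ * α) = 1 / 2 := by field_simp
    rw [he] at this
    refine this.congr' ?_
    filter_upwards [hpos, hX₁p, hYp] with a h1 h2 h3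
    simp only [Pi.div_apply]
    field_simp
  -- The ratio tends to `1 / 2`. The bound `1 / 9` is what makes the derivative of `9 / 10 * (X * Y)
  -- - Z` positive, and `9 / 10` is any convenient constant less than `1` for both final estimates;
  -- the first ratio behaves like `2 / 3`.
  have hlo : ∀ᶠ a in 𝓝[>] 0, 1 / 9 * (Y a * X₁ a) < X a * Y₁ a := by
    filter_upwards [l5.eventually_const_lt (show (1 : ℝ) / 9 < 1 / 2 by norm_num), hX₁p, hYp]
      with a h1 h2 h3
    exact (lt_div_iff₀ (mul_pos h3 h2)).mp h1
  have hhi : ∀ᶠ a in 𝓝[>] 0, X a * Y₁ a < 9 / 10 * (Y a * X₁ a) := by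
    filter_upwards [l5.eventually_lt_const (show (1 : ℝ) / 2 < 9 / 10 by norm_num), hX₁p, hYp]
      with a h1 h2 h3
    exact (div_lt_iff₀ (mul_pos h3 h2)).mp h1
  have hW := eventually_pos_of_deriv_pos (f := fun a => 9 / 10 * (X a * Y a) - Z a)
    (f' := fun a => 9 / 10 * (X₁ a * Y a + X a * Y₁ a) - Y a * X₁ a)
    (fun a => (((hX a).mul (hY a)).const_mul _).sub (hZ a)) (by simp [hX0, hZ0]) (by
      filter_upwards [hlo] with a h1
      linarith)
  filter_upwards [hXp, hYp, hX₁p, hZp, hW, hhi] with a h1 h2 h3 h4 h5 h6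
  exact ⟨h1, h2, h3, h4, by linarith, h6.le⟩

namespace LegendrianLink

variable {ι : Type*} {L : LegendrianLink ι}

/-- One side of a right cusp of a front, where `ς = ± 1` is the side. -/
theorem eventually_rightCusp_side {i : ι} {t₀ : ℝ}
    (h0 : deriv (L.x i) t₀ = 0) (h1 : deriv (deriv (L.x i)) t₀ < 0) {ς : ℝ} (hς : ς * ς = 1) :
    ∀ᶠ a in 𝓝[>] 0, 0 < ς * deriv (L.y i) t₀ * (L.y i (t₀ + ς * a) - L.y i t₀) ∧
      0 < -ς * deriv (L.x i) (t₀ + ς * a) ∧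
      0 < -ς * deriv (L.y i) t₀ * (L.z i (t₀ + ς * a) - L.z i t₀ -
        L.y i t₀ * (L.x i (t₀ + ς * a) - L.x i t₀)) ∧
      -ς * deriv (L.y i) t₀ * (L.z i (t₀ + ς * a) - L.z i t₀ -
        L.y i t₀ * (L.x i (t₀ + ς * a) - L.x i t₀)) ≤
        9 / 10 * ((L.x i t₀ - L.x i (t₀ + ς * a)) *
          (ς * deriv (L.y i) t₀ * (L.y i (t₀ + ς * a) - L.y i t₀))) ∧
      (L.x i t₀ - L.x i (t₀ + ς * a)) * (deriv (L.y i) t₀ * deriv (L.y i) (t₀ + ς * a)) ≤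
        9 / 10 * ((ς * deriv (L.y i) t₀ * (L.y i (t₀ + ς * a) - L.y i t₀)) *
          (-ς * deriv (L.x i) (t₀ + ς * a))) := by
  set β := deriv (L.y i) t₀ with hβ
  have hy : β ≠ 0 := fun h => L.immersed i t₀ ⟨h0, h, by rw [L.legendrian, h0, mul_zero]⟩
  have hl : ∀ a : ℝ, HasDerivAt (fun a => t₀ + ς * a) ς a := fun a => by
    simpa using ((hasDerivAt_id a).const_mul ς).const_add t₀
  have hx : ∀ a : ℝ, HasDerivAt (fun a => L.x i (t₀ + ς * a)) (deriv (L.x i) (t₀ + ς * a) * ς) a :=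
    fun a => (hasDerivAt_x (L := L) i _).comp a (hl a)
  have hyd : ∀ a : ℝ, HasDerivAt (fun a => L.y i (t₀ + ς * a))
      (deriv (L.y i) (t₀ + ς * a) * ς) a :=
    fun a => (hasDerivAt_y (L := L) i _).comp a (hl a)
  have hz : ∀ a : ℝ, HasDerivAt (fun a => L.z i (t₀ + ς * a))
      (L.y i (t₀ + ς * a) * deriv (L.x i) (t₀ + ς * a) * ς) a :=
    fun a => (hasDerivAt_z (L := L) i _).comp a (hl a)
  -- The factors `ς` and `y' (t₀)` normalise the signs, so that both sides of the cusp and both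
  -- signs of `y' (t₀)` fall under the same model `a²`, `a`, `a³`.
  have h := eventually_cusp_side (X := fun a => L.x i t₀ - L.x i (t₀ + ς * a))
    (Y := fun a => ς * β * (L.y i (t₀ + ς * a) - L.y i t₀))
    (Z := fun a => -ς * β * (L.z i (t₀ + ς * a) - L.z i t₀ -
        L.y i t₀ * (L.x i (t₀ + ς * a) - L.x i t₀)))
    (X₁ := fun a => -ς * deriv (L.x i) (t₀ + ς * a))
    (Y₁ := fun a => β * deriv (L.y i) (t₀ + ς * a))
    (α := -deriv (deriv (L.x i)) t₀) (γ := β * β) (by linarith) (mul_self_pos.mpr hy)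
    (fun a => ((hx a).const_sub _).congr_deriv (by ring))
    (fun a => (((hyd a).sub_const _).const_mul _).congr_deriv (by
      linear_combination β * deriv (L.y i) (t₀ + ς * a) * hς))
    (fun a => ((((hz a).sub_const _).sub (((hx a).sub_const _).const_mul _)).const_mul _).congr_deriv
      (by ring))
    (by simp) (by simp) (by simp) (by simp [h0])
    (by
      have h2 := ((L.contDiff_deriv_x i).differentiable (by simp) (t₀ + ς * 0)).hasDerivAt
      have h3 := (h2.comp (0 : ℝ) (hl 0)).const_mul (-ς)
      refine h3.congr_deriv ?_
      rw [mul_zero, add_zero]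
      linear_combination -deriv (deriv (L.x i)) t₀ * hς)
    (by
      have : Continuous fun a : ℝ => β * deriv (L.y i) (t₀ + ς * a) :=
        continuous_const.mul ((L.contDiff_deriv_y i).continuous.comp (by fun_prop))
      exact this.continuousAt)
    (by simp [hβ])
  filter_upwards [h] with a ⟨_, a2, a3, a4, a5, a6⟩
  exact ⟨a2, a3, a4, a5, a6⟩

end LegendrianLink

end

/-! ### The crossing at a right cusp -/

section
open Set Filter Topology Projection

namespace LegendrianLink

variable {ι : Type*} {L : LegendrianLink ι}

theorem eventually_lt_of_rightTurn {i : ι} {t₀ : ℝ} (h0 : deriv (L.x i) t₀ = 0)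
    (h1 : deriv (deriv (L.x i)) t₀ < 0) : ∀ᶠ s in 𝓝 t₀, s ≠ t₀ → L.x i s < L.x i t₀ := by
  have hd : deriv (fun t => -L.x i t) = fun t => -deriv (L.x i) t := by ext t; exact deriv.fun_neg
  have hl := eventually_left_lt (f := fun t => -L.x i t) (t₀ := t₀) (L.smooth_x i).neg (by
    rw [hd]
    simpa using eventually_left_deriv_pos (L.smooth_x i) (Or.inr ⟨h0, h1⟩))
  have hr := eventually_right_lt (f := fun t => -L.x i t) (t₀ := t₀) (L.smooth_x i).neg (by
    rw [hd]
    simpa using eventually_right_deriv_neg (L.smooth_x i) (Or.inr ⟨h0, h1⟩))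
  rw [eventually_nhdsWithin_iff] at hl hr
  filter_upwards [hl, hr] with s h2 h3 hne
  rcases lt_or_gt_of_ne hne with h | h
  · exact neg_lt_neg_iff.mp (h2 h)
  · exact neg_lt_neg_iff.mp (h3 h)

/-- The inequality which makes the crossing near a right cusp unique and transverse. -/
theorem cusp_ratio_inequality {D E h Yp Ym Xp Xm Ap Am : ℝ} (hE : E = Yp + Ym)
    (hYp : 0 < Yp) (hYm : 0 < Ym) (hXp : 0 < Xp) (hXm : 0 < Xm)
    (hD : D ≤ 9 / 10 * (h * E)) (hp : h * Ap ≤ 9 / 10 * (Yp * Xp))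
    (hD0 : 0 < D) (hm : h * Am ≤ 9 / 10 * (Ym * Xm)) : D * (Ap / Xp + Am / Xm) < E * E := by
  have hE0 : 0 < E := by rw [hE]; exact add_pos hYp hYm
  have h1 : h * (Ap / Xp) ≤ 9 / 10 * Yp := by
    rw [← mul_div_assoc, div_le_iff₀ hXp]; linarith
  have h2 : h * (Am / Xm) ≤ 9 / 10 * Ym := by
    rw [← mul_div_assoc, div_le_iff₀ hXm]; linarith
  set S := Ap / Xp + Am / Xm
  have h3 : h * S ≤ 9 / 10 * E := by rw [hE]; simp only [S]; linarith
  -- For positive `S` the two bounds multiply to `D * S ≤ 81 / 100 * E ^ 2`.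
  rcases le_or_gt S 0 with hS | hS
  · exact lt_of_le_of_lt (mul_nonpos_of_nonneg_of_nonpos hD0.le hS) (mul_pos hE0 hE0)
  · have h4 := mul_le_mul_of_nonneg_right hD hS.le
    have h5 := mul_le_mul_of_nonneg_left h3 hE0.le
    have h6 := mul_pos hE0 hE0
    nlinarith

/-- On the two branches `s` and `t` to the left of the cusp, `D` and `E` are positive and the
perturbed heights agree exactly when `D = ε * E`. Since `D' = -E` and `E' = -S`, the derivative of
`D / E` has the sign of `D * S - E ^ 2`, negative by `cusp_ratio_inequality`. As `D / E` tends to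
`0`, there is one crossing for each small `ε`. The same inequality, read at the crossing, says that
the branch with larger `z` has the lesser slope. -/
theorem exists_isResolution_rightTurn [Finite ι] (hL : L.GenericFront) {P : ℝ × ℝ} {p₀ : ι × ℝ}
    (hp₀ : p₀ ∈ Par ι) (hpP : point L.x L.z p₀ = P) (hturn : RightTurn L.x p₀) :
    ∃ p q : ℝ → ι × ℝ, L.IsResolution P p q := by
  obtain ⟨i, t₀⟩ := p₀
  obtain ⟨hP, m, hm⟩ := over_of_point hpP
  obtain ⟨h0, h1⟩ := id hturn
  change deriv (L.x i) t₀ = 0 at h0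
  change deriv (deriv (L.x i)) t₀ < 0 at h1
  change L.x i t₀ = P.1 + m at hm
  have hzP : L.z i t₀ = P.2 := congrArg Prod.snd hpP
  obtain ⟨σ, c1, c2, c3⟩ := exists_strands hL P.1
  let kT : L.Branch P.1 := ⟨((i, t₀), true), ⟨hp₀, m, hm⟩, Or.inr hturn⟩
  let kF : L.Branch P.1 := ⟨((i, t₀), false), ⟨hp₀, m, hm⟩, Or.inr hturn⟩
  let s : ℝ → ℝ := σ kT
  let t : ℝ → ℝ := σ kF
  set β := deriv (L.y i) t₀ with hβ
  have hβ0 : β ≠ 0 := fun h => L.immersed i t₀ ⟨h0, h, by rw [L.legendrian, h0, mul_zero]⟩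
  have hlim : ∀ k : L.Branch P.1, Tendsto (σ k) (𝓝[<] P.1) (𝓝 k.pt.2) := fun k => by
    rw [← c2 k]; exact (c1 k).continuousAt.mono_left nhdsWithin_le_nhds
  have hs : Tendsto s (𝓝[<] P.1) (𝓝 t₀) := hlim kT
  have ht : Tendsto t (𝓝[<] P.1) (𝓝 t₀) := hlim kF
  have hid : Tendsto (fun ξ : ℝ => ξ) (𝓝[<] P.1) (𝓝 P.1) := nhdsWithin_le_nhds
  have hover : ∀ u : ℝ → ℝ, Tendsto u (𝓝[<] P.1) (𝓝 t₀) → ∀ᶠ ξ in 𝓝[<] P.1,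
      L.Over ξ (i, u ξ) → L.x i (u ξ) = ξ + m := by
    intro u hu
    have h2 := (((L.smooth_x i).continuous.tendsto _).comp hu).sub hid
    rw [show L.x i t₀ - P.1 = m by rw [hm]; ring] at h2
    filter_upwards [eventually_int_eq_zero h2] with ξ h3
    rintro ⟨n, hn⟩
    have := h3 (n - m) (by push_cast; simp only [Function.comp_apply] at hn ⊢; linarith)
    have hnm : n = m := by omega
    subst hnm
    exact hn
  have hta : Tendsto (fun ξ => t ξ - t₀) (𝓝[<] P.1) (𝓝[>] 0) := by
    refine tendsto_nhdsWithin_iff.mpr ⟨by simpa using ht.sub_const t₀, ?_⟩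
    filter_upwards [c3] with ξ h
    exact sub_pos.mpr (h.side_false kF rfl).1
  have hsa : Tendsto (fun ξ => t₀ - s ξ) (𝓝[<] P.1) (𝓝[>] 0) := by
    refine tendsto_nhdsWithin_iff.mpr ⟨by simpa using hs.const_sub t₀, ?_⟩
    filter_upwards [c3] with ξ h
    exact sub_pos.mpr (h.side_true kT rfl).1
  let D : ℝ → ℝ := fun ξ => β * (L.z i (s ξ) - L.z i (t ξ))
  let E : ℝ → ℝ := fun ξ => β * (L.y i (t ξ) - L.y i (s ξ))
  let S : ℝ → ℝ := fun ξ => β * deriv (L.y i) (t ξ) / (-deriv (L.x i) (t ξ)) +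
    β * deriv (L.y i) (s ξ) / deriv (L.x i) (s ξ)
  have hbasic : ∀ᶠ ξ in 𝓝[<] P.1, L.x i (s ξ) = ξ + m ∧ L.x i (t ξ) = ξ + m ∧
      0 < D ξ ∧ 0 < E ξ ∧ D ξ ≤ 9 / 10 * ((P.1 - ξ) * E ξ) ∧ D ξ * S ξ < E ξ * E ξ ∧
      HasDerivAt D (-E ξ) ξ ∧ HasDerivAt E (-S ξ) ξ ∧
      deriv (L.x i) (s ξ) ≠ 0 ∧ deriv (L.x i) (t ξ) ≠ 0 := by
    filter_upwards [c3, hover s hs, hover t ht,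
      hta.eventually (eventually_rightCusp_side h0 h1 (ς := 1) (by norm_num)),
      hsa.eventually (eventually_rightCusp_side h0 h1 (ς := -1) (by norm_num)),
      self_mem_nhdsWithin] with ξ h2 h3 h4 h5 h6 hlt
    have hxs := h3 (h2.mem_over kT)
    have hxt := h4 (h2.mem_over kF)
    have hh : 0 < P.1 - ξ := sub_pos.mpr (Set.mem_Iio.mp hlt)
    rw [show t₀ + 1 * (t ξ - t₀) = t ξ by ring, ← hβ, hxt, hm] at h5
    rw [show t₀ + -1 * (t₀ - s ξ) = s ξ by ring, ← hβ, hxs, hm] at h6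
    rw [show P.1 + (m : ℝ) - (ξ + m) = P.1 - ξ by ring] at h5 h6
    obtain ⟨a1, a2, a3, a4, a5⟩ := h5
    obtain ⟨b1, b2, b3, b4, b5⟩ := h6
    have hE : E ξ = 1 * β * (L.y i (t ξ) - L.y i t₀) + -1 * β * (L.y i (s ξ) - L.y i t₀) := by
      simp only [E]; ring
    have hD : D ξ = -1 * β * (L.z i (t ξ) - L.z i t₀ - L.y i t₀ * (ξ + m - (P.1 + m))) +
        -(-1) * β * (L.z i (s ξ) - L.z i t₀ - L.y i t₀ * (ξ + m - (P.1 + m))) := by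
      simp only [D]; ring
    have hD0 : 0 < D ξ := by rw [hD]; exact add_pos a3 b3
    have hE0 : 0 < E ξ := by rw [hE]; exact add_pos a1 b1
    have hDE : D ξ ≤ 9 / 10 * ((P.1 - ξ) * E ξ) := by
      rw [hD, hE]; linarith
    have hds := h2.deriv_ne kT
    have hdt := h2.deriv_ne kF
    refine ⟨hxs, hxt, hD0, hE0, hDE, ?_, ?_, ?_, hds, hdt⟩
    · have := cusp_ratio_inequality hE a1 b1 a2 b2 hDE a5 hD0 b5
      simpa [S] using this
    · have h7 := ((hasDerivAt_z_section hds (h2.hasDerivAt kT)).sub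
        (hasDerivAt_z_section hdt (h2.hasDerivAt kF))).const_mul β
      refine h7.congr_deriv ?_
      simp only [E, s, t, kT, kF]; ring
    · have h7 := ((hasDerivAt_y_section (h2.hasDerivAt kF)).sub
        (hasDerivAt_y_section (h2.hasDerivAt kT))).const_mul β
      refine h7.congr_deriv ?_
      simp only [S, s, t, kT, kF, div_neg]; ring
  obtain ⟨X, hX, hXr, hXu⟩ := exists_tendsto_left_inverse (x₀ := P.1) (r := fun ξ => D ξ / E ξ)
    (r' := fun ξ => (-E ξ * E ξ - D ξ * -S ξ) / E ξ ^ 2)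
    (by
      filter_upwards [hbasic] with ξ ⟨_, _, a1, a2, _, a3, a4, a5, _⟩
      refine ⟨a4.div a5 a2.ne', div_neg_of_neg_of_pos (by linarith) (by positivity), by positivity⟩)
    (by
      have hsq : Tendsto (fun ξ => 9 / 10 * (P.1 - ξ)) (𝓝[<] P.1) (𝓝 0) := by
        simpa using (hid.const_sub P.1).const_mul (9 / 10)
      refine tendsto_of_tendsto_of_tendsto_of_le_of_le' tendsto_const_nhds hsq ?_ ?_
      · filter_upwards [hbasic] with ξ ⟨_, _, a1, a2, _⟩
        positivity
      · filter_upwards [hbasic] with ξ ⟨_, _, a1, a2, a3, _⟩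
        rw [div_le_iff₀ a2]; linarith)
  have hheight : ∀ ε ξ, L.height ε i (s ξ) = L.height ε i (t ξ) ↔ D ξ = ε * E ξ := by
    intro ε ξ
    simp only [D, E, height]
    constructor
    · intro h; linear_combination β * h
    · intro h
      have : β * (L.z i (s ξ) + ε * L.y i (s ξ)) = β * (L.z i (t ξ) + ε * L.y i (t ξ)) := by
        linear_combination h
      exact mul_left_cancel₀ hβ0 this
  have hXmem : ∀ᶠ ε in 𝓝[>] 0, X ε ∈ Ico (0 : ℝ) 1 := by
    have hP0 : 0 < P.1 := lt_of_le_of_ne hP.1 fun h =>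
      hL.turn_off_cut _ hp₀ h0 (by rw [hpP, ← h])
    filter_upwards [(hX.mono_right nhdsWithin_le_nhds).eventually (Ioo_mem_nhds hP0 hP.2)]
      with ε h using ⟨h.1.le, h.2⟩
  have hunique : ∀ r ∈ Par ι, point L.x L.z r = P → r = (i, t₀) := by
    intro r hr hrP
    by_contra hne
    exact hL.double_ne_turn _ hp₀ r hr (Ne.symm hne) (hpP.trans hrP.symm) h0
  have hbranch : ∀ k : L.Branch P.1, k.pt = (i, t₀) → k = kT ∨ k = kF := by
    rintro ⟨⟨q, b⟩, hk⟩ hq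
    change q = (i, t₀) at hq
    subst hq
    cases b
    · exact Or.inr rfl
    · exact Or.inl rfl
  have hfin := finite_branch hL P.1
  -- Which branch lies above depends on the sign of `β`, so the construction is carried out for both
  -- assignments.
  have hmain : ∀ u w : ℝ → ℝ, ((u = s ∧ w = t) ∨ (u = t ∧ w = s)) →
      (∀ᶠ ε in 𝓝[>] 0, L.z i (w (X ε)) < L.z i (u (X ε)) ∧
        L.heightSlope ε (i, u (X ε)) < L.heightSlope ε (i, w (X ε))) →
      L.IsResolution P (fun ε => parOf (i, u (X ε))) (fun ε => parOf (i, w (X ε))) := by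
    intro u w huw hlast
    have hfr : ∀ᶠ ε in 𝓝[>] 0, Int.fract (L.x i (u (X ε))) = X ε ∧
        Int.fract (L.x i (w (X ε))) = X ε ∧ deriv (L.x i) (u (X ε)) ≠ 0 ∧
        deriv (L.x i) (w (X ε)) ≠ 0 ∧ L.height ε i (u (X ε)) = L.height ε i (w (X ε)) := by
      filter_upwards [hX.eventually hbasic, hXmem, hXr] with ε ⟨a1, a2, _, aE, _, _, _, _, a3, a4⟩ a5 a6
      have hf : Int.fract (X ε + m) = X ε := by
        rw [Int.fract_add_intCast, Int.fract_eq_self.mpr a5]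
      have hv : L.height ε i (s (X ε)) = L.height ε i (t (X ε)) :=
        (hheight _ _).mpr ((div_eq_iff aE.ne').mp a6)
      rcases huw with ⟨rfl, rfl⟩ | ⟨rfl, rfl⟩
      · exact ⟨by rw [a1, hf], by rw [a2, hf], a3, a4, hv⟩
      · exact ⟨by rw [a2, hf], by rw [a1, hf], a4, a3, hv.symm⟩
    refine ⟨?_, ?_, ?_⟩
    · refine hX.congr' ?_
      filter_upwards [hfr] with ε h
      rw [fract_x_parOf]; exact h.1.symm
    · have hu : Tendsto u (𝓝[<] P.1) (𝓝 t₀) := by rcases huw with ⟨rfl, -⟩ | ⟨rfl, -⟩ <;> assumption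
      have hpair : Tendsto (fun ε => (ε, X ε)) (𝓝[>] 0) (𝓝[>] 0 ×ˢ 𝓝[<] P.1) :=
        tendsto_id.prodMk hX
      have hlt := hpair.eventually (eventually_height_lt (x₀ := P.1) (c := P.2) (i := i)
        (t₀ := t₀) hL c1 c2 tendsto_fst_zero
        (tendsto_snd.mono_right nhdsWithin_le_nhds) (τ := u) (hu.comp tendsto_snd) hzP)
      filter_upwards [hfr, hXmem, hX.eventually c3, hlt, hlast]
        with ε ⟨a1, a2, a3, a4, a5⟩ a6 a7 a8 ⟨a9, a10⟩
      obtain ⟨b1, b2⟩ := strandsBelow_eq_and_eq_or_eq hL hP (p := parOf (i, u (X ε)))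
        (q := parOf (i, w (X ε))) (c := L.height ε i (u (X ε))) a6 a7 (height_parOf ε _)
        ((height_parOf ε _).trans a5.symm) a8 (by
          intro k hk
          rcases hbranch k (hunique _ k.2.1.1 (point_branch hP k hk)) with rfl | rfl <;>
          rcases huw with ⟨rfl, rfl⟩ | ⟨rfl, rfl⟩
          · exact Or.inl rfl
          · exact Or.inr rfl
          · exact Or.inr rfl
          · exact Or.inl rfl)
      have hf : Int.fract (L.x (parOf (i, u (X ε))).1 (parOf (i, u (X ε))).2) = X ε := by
        rw [fract_x_parOf]; exact a1
      refine ⟨parOf_mem _, parOf_mem _, ?_, ?_, ?_, ?_, ?_, ?_, ?_, ?_⟩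
      · rw [fract_x_parOf, fract_x_parOf, a1, a2]
      · rw [z_parOf, z_parOf]; exact a9
      · rw [height_parOf, height_parOf]; exact a5
      · rw [der_x_parOf]; exact a3
      · rw [der_x_parOf]; exact a4
      · rw [heightSlope_parOf, heightSlope_parOf]; exact a10
      · rw [hf, height_parOf]; exact b1
      · rw [hf, height_parOf]; exact b2
    · intro p₁ hp₁ q₁ hq₁ hp₁P hq₁P
      rw [hunique p₁ hp₁ hp₁P, hunique q₁ hq₁ hq₁P]
      refine eventually_near ?_
      simp only
      have hξ : Tendsto (fun a => L.x i a - m) (𝓝 t₀) (𝓝 P.1) := by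
        have := ((L.smooth_x i).continuous.tendsto t₀).sub_const (m : ℝ)
        rwa [hm, add_sub_cancel_right] at this
      -- Strands with other end points stay away from the cusp modulo `1`, so nearby points over the
      -- left side lie on `s` or `t`.
      have hnear : ∀ᶠ a in 𝓝 t₀, L.x i a < L.x i t₀ →
          parOf (i, a) = parOf (i, s (L.x i a - m)) ∨ parOf (i, a) = parOf (i, t (L.x i a - m)) := by
        have hk : ∀ k : L.Branch P.1, ∀ᶠ a in 𝓝 t₀, k.pt ≠ (i, t₀) →
            parOf (i, a) ≠ parOf (k.comp, σ k (L.x i a - m)) := by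
          intro k
          by_cases hk : k.pt = (i, t₀)
          · exact Eventually.of_forall fun a h => absurd hk h
          by_cases hc : i = k.comp
          swap
          · exact Eventually.of_forall fun a _ h => hc (parOf_eq_parOf_iff.mp h).1
          have h2 : Tendsto (fun a => a - σ k (L.x i a - m)) (𝓝 t₀) (𝓝 (t₀ - k.pt.2)) := by
            refine Tendsto.sub tendsto_id ?_
            rw [← c2 k]
            exact ((c1 k).tendsto P.1).comp hξ
          have h3 : ∀ n : ℤ, t₀ - k.pt.2 ≠ n := by
            intro n hn
            have : parOf k.pt = parOf (i, t₀) := (parOf_eq_parOf_iff.mpr ⟨hc, n, by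
              simp only; linarith⟩).symm
            rw [parOf_of_mem k.2.1.1, parOf_of_mem hp₀] at this
            exact hk this
          filter_upwards [eventually_ne_int h2 h3] with a h4 _ h5
          obtain ⟨-, n, hn⟩ := parOf_eq_parOf_iff.mp h5
          exact h4 n (by simp only at hn; linarith)
        filter_upwards [eventually_all.mpr hk, hξ.eventually (eventually_nhdsWithin_iff.mp c3)]
          with a h2 h3 h4
        have h5 := h3 (Set.mem_Iio.mpr (by linarith))
        obtain ⟨k, hka⟩ := h5.surj (i, a) ⟨m, by simp⟩
        by_cases hkp : k.pt = (i, t₀)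
        · rcases hbranch k hkp with rfl | rfl
          · exact Or.inl hka
          · exact Or.inr hka
        · exact absurd hka (h2 k hkp)
      filter_upwards [tendsto_snd.eventually (shift_self (L := L) (i := i) (t₀ := t₀)),
        tendsto_snd.eventually (tendsto_fst.eventually hnear),
        tendsto_snd.eventually (tendsto_snd.eventually hnear),
        tendsto_snd.eventually (tendsto_fst.eventually (eventually_lt_of_rightTurn h0 h1)),
        tendsto_snd.eventually (tendsto_snd.eventually (eventually_lt_of_rightTurn h0 h1)),
        tendsto_snd.eventually (tendsto_fst.eventually
          (hξ.eventually (eventually_nhdsWithin_iff.mp (hXu.and hbasic))))]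
        with v h2 h3 h4 h5 h6 h7 hd
      obtain ⟨d1, ⟨n, hn⟩, d2⟩ := isDouble_parOf hd
      have hx := h2 n hn
      -- Over the cusp itself the only nearby parameter is `t₀`, which would make the two points
      -- equal.
      have hlt : L.x i v.2.1 < L.x i t₀ := by
        by_contra hcon
        have e1 : v.2.1 = t₀ := by by_contra h; exact hcon (h5 h)
        have e2 : v.2.2 = t₀ := by by_contra h; exact hcon (hx ▸ h6 h)
        exact d1 (by rw [e1, e2])
      obtain ⟨h8, _, _, _, aE, _⟩ := h7 (Set.mem_Iio.mpr (by linarith))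
      have h3' := h3 hlt
      have h4' := h4 (hx ▸ hlt)
      rw [← hx] at h4'
      set ξ := L.x i v.2.1 - m
      have hst : L.height v.1 i (s ξ) = L.height v.1 i (t ξ) := by
        have e1 := height_parOf (L := L) v.1 (i, v.2.1)
        have e2 := height_parOf (L := L) v.1 (i, v.2.2)
        have es := height_parOf (L := L) v.1 (i, s ξ)
        have et := height_parOf (L := L) v.1 (i, t ξ)
        rcases h3' with h | h <;> rcases h4' with h' | h'
        · exact absurd (h.trans h'.symm) d1
        · rw [h] at e1; rw [h'] at e2
          exact (es.symm.trans e1).trans (d2.trans (e2.symm.trans et))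
        · rw [h] at e1; rw [h'] at e2
          exact ((et.symm.trans e1).trans (d2.trans (e2.symm.trans es))).symm
        · exact absurd (h.trans h'.symm) d1
      have hξX : ξ = X v.1 := h8 v.1 ((div_eq_iff aE.ne').mpr ((hheight _ _).mp hst))
      rw [hξX] at h3'
      rcases huw with ⟨rfl, rfl⟩ | ⟨rfl, rfl⟩
      · exact h3'
      · exact h3'.symm
  have hsl : ∀ᶠ ε in 𝓝[>] 0, 0 < β * (L.z i (s (X ε)) - L.z i (t (X ε))) ∧
      β * (L.heightSlope ε (i, s (X ε)) - L.heightSlope ε (i, t (X ε))) < 0 := by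
    filter_upwards [hX.eventually hbasic, hXr] with ε ⟨_, _, aD, aE, _, aS, _, _, a3, a4⟩ a6
    refine ⟨aD, ?_⟩
    have hε : ε * E (X ε) = D (X ε) := ((div_eq_iff aE.ne').mp a6).symm
    have h2 : β * (L.heightSlope ε (i, s (X ε)) - L.heightSlope ε (i, t (X ε))) =
        -E (X ε) + ε * S (X ε) := by
      simp only [heightSlope, E, S, der, div_neg]; ring
    rw [h2]
    have h3 : E (X ε) * (-E (X ε) + ε * S (X ε)) < 0 := by
      have : E (X ε) * (-E (X ε) + ε * S (X ε)) = -(E (X ε) * E (X ε)) + D (X ε) * S (X ε) := by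
        rw [← hε]; ring
      rw [this]; linarith
    exact (pos_iff_neg_of_mul_neg h3).mp aE
  rcases lt_or_gt_of_ne hβ0 with hβs | hβs
  · refine ⟨_, _, hmain t s (Or.inr ⟨rfl, rfl⟩) ?_⟩
    filter_upwards [hsl] with ε ⟨a1, a2⟩
    exact ⟨sub_neg.mp (neg_of_mul_pos_right a1 hβs.le), sub_pos.mp (pos_of_mul_neg_right a2 hβs.le)⟩
  · refine ⟨_, _, hmain s t (Or.inl ⟨rfl, rfl⟩) ?_⟩
    filter_upwards [hsl] with ε ⟨a1, a2⟩
    exact ⟨sub_pos.mp (pos_of_mul_pos_right a1 hβs.le), sub_neg.mp (neg_of_mul_neg_right a2 hβs.le)⟩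

end LegendrianLink

end

section
open Set Filter Topology Projection

namespace LegendrianLink

variable {ι : Type*} {L : LegendrianLink ι}

/-! ### All singularities of the perturbed front -/

/-- The points of a front that are resolved by a crossing: crossings and right cusps. -/
def HasCrossing (L : LegendrianLink ι) (P : ℝ × ℝ) : Prop :=
  (∃ p ∈ Par ι, point L.x L.z p = P ∧ RightTurn L.x p) ∨
  (∃ p ∈ Par ι, ∃ q ∈ Par ι, p ≠ q ∧ point L.x L.z p = P ∧ point L.x L.z q = P)

theorem HasCrossing.singular {P : ℝ × ℝ} (h : L.HasCrossing P) : Singular L.x L.z P :=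
  h.imp (fun ⟨p, hp, hpP, ht⟩ => ⟨p, hp, hpP, ht.1⟩) id

theorem HasCrossing.exists_isResolution [Finite ι] (hL : L.GenericFront) {P : ℝ × ℝ}
    (h : L.HasCrossing P) : ∃ p q : ℝ → ι × ℝ, L.IsResolution P p q := by
  rcases h with ⟨p, hp, hpP, ht⟩ | ⟨p, hp, q, hq, hne, hpP, hqP⟩
  · exact exists_isResolution_rightTurn hL hp hpP ht
  · exact exists_isResolution_crossing hL hp hq hne hpP hqP

theorem eventually_height_lt_height {p q : ι × ℝ} (h : L.z p.1 p.2 < L.z q.1 q.2) :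
    ∀ᶠ ε in 𝓝[>] 0, L.height ε p.1 p.2 < L.height ε q.1 q.2 := by
  have h0 : Tendsto (fun ε : ℝ => ε) (𝓝[>] 0) (𝓝 0) := nhdsWithin_le_nhds
  exact (tendsto_height p.1 h0 tendsto_const_nhds).eventually_lt
    (tendsto_height q.1 h0 tendsto_const_nhds) h

/-- The position of a turning point does not change under small perturbations. -/
theorem eventually_strandsBelow_turn [Finite ι] (hL : L.GenericFront) {p : ι × ℝ} (hp : p ∈ Par ι)
    (hd : der L.x p = 0) : ∀ᶠ ε in 𝓝[>] 0,
      strandsBelow L.x (L.height ε) (Int.fract (L.x p.1 p.2), L.height ε p.1 p.2) =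
        strandsBelow L.x L.z (point L.x L.z p) := by
  have hx₀ : Int.fract (L.x p.1 p.2) ∈ Ico (0 : ℝ) 1 := ⟨Int.fract_nonneg _, Int.fract_lt_one _⟩
  have := finite_branch hL (Int.fract (L.x p.1 p.2))
  have hk : ∀ᶠ ε in 𝓝[>] 0, ∀ k : L.Branch (Int.fract (L.x p.1 p.2)),
      (L.height ε k.pt.1 k.pt.2 < L.height ε p.1 p.2 ↔ L.z k.pt.1 k.pt.2 < L.z p.1 p.2) := by
    refine eventually_all.mpr fun k => ?_
    rcases lt_trichotomy (L.z k.pt.1 k.pt.2) (L.z p.1 p.2) with h | h | h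
    · filter_upwards [eventually_height_lt_height h] with ε hε using iff_of_true hε h
    -- A second point at the height of a turning point would be a double point at a cusp, excluded
    -- by genericity. Hence the only equality is trivial and persists.
    · have hkp : k.pt = p := by
        by_contra hne
        refine hL.double_ne_turn p hp k.pt k.2.1.1 (Ne.symm hne) ?_ hd
        exact Prod.ext ((over_iff_of_mem hx₀).mp k.2.1.2).symm h.symm
      rw [hkp]
      exact Eventually.of_forall fun ε => iff_of_false (lt_irrefl _) (lt_irrefl _)
    · filter_upwards [eventually_height_lt_height h] with ε hε
      exact iff_of_false hε.not_gt h.not_gt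
  filter_upwards [hk] with ε hε
  rw [strandsBelow_eq_ncard_branch hL hx₀, point, strandsBelow_eq_ncard_branch hL hx₀]
  simp only [hε]

theorem exists_branch_of_regular {x₀ : ℝ} {p : ι × ℝ} (hp : p ∈ Par ι) (ho : L.Over x₀ p)
    (hd : der L.x p ≠ 0) : ∃ k : L.Branch x₀, k.pt = p := by
  rcases lt_or_gt_of_ne hd with h | h
  · exact ⟨⟨(p, false), ⟨hp, ho⟩, Or.inl h⟩, rfl⟩
  · exact ⟨⟨(p, true), ⟨hp, ho⟩, Or.inl h⟩, rfl⟩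

/-- Two strands reach a crossing or a right cusp from the left. -/
theorem HasCrossing.exists_branches (hL : L.GenericFront) {P : ℝ × ℝ} (h : L.HasCrossing P) :
    ∃ k l : L.Branch P.1, k ≠ l ∧ L.z k.pt.1 k.pt.2 = P.2 ∧ L.z l.pt.1 l.pt.2 = P.2 := by
  rcases h with ⟨p, hp, hpP, ht⟩ | ⟨p, hp, q, hq, hne, hpP, hqP⟩
  · refine ⟨⟨(p, true), ⟨hp, (over_of_point hpP).2⟩, Or.inr ht⟩,
      ⟨(p, false), ⟨hp, (over_of_point hpP).2⟩, Or.inr ht⟩, fun h => ?_,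
      congrArg Prod.snd hpP, congrArg Prod.snd hpP⟩
    have := congrArg (fun k => k.1.2) h
    simp at this
  · obtain ⟨k, hk⟩ := exists_branch_of_regular hp (over_of_point hpP).2
      (hL.double_ne_turn p hp q hq hne (hpP.trans hqP.symm))
    obtain ⟨l, hl⟩ := exists_branch_of_regular hq (over_of_point hqP).2
      (hL.double_ne_turn q hq p hp hne.symm (hqP.trans hpP.symm))
    refine ⟨k, l, fun h => hne (by rw [← hk, ← hl, h]), ?_, ?_⟩
    · rw [hk]; exact congrArg Prod.snd hpP
    · rw [hl]; exact congrArg Prod.snd hqP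

/-- The two strands that meet at `Q` count below `P` but not below `Q`. This is the room that
`SlidesLeft` requires when a crossing lies below another singularity on the same vertical line. -/
theorem strandsBelow_add_two_le [Finite ι] (hL : L.GenericFront) {P Q : ℝ × ℝ}
    (hQ : L.HasCrossing Q) (hx : P.1 = Q.1) (hz : Q.2 < P.2) :
    strandsBelow L.x L.z Q + 2 ≤ strandsBelow L.x L.z P := by
  have hQ1 : Q.1 ∈ Ico (0 : ℝ) 1 := by
    rcases hQ with ⟨p, -, h, -⟩ | ⟨p, -, -, -, -, h, -⟩ <;> exact (over_of_point h).1
  have := finite_branch hL Q.1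
  obtain ⟨k, l, hkl, hk, hl⟩ := hQ.exists_branches hL
  obtain ⟨x, z⟩ := P
  obtain ⟨x', z'⟩ := Q
  simp only at hx hz hk hl hQ1 this
  subst hx
  rw [strandsBelow_eq_ncard_branch hL hQ1, strandsBelow_eq_ncard_branch hL hQ1,
    ← ncard_pair hkl, ← ncard_union_eq]
  · refine ncard_le_ncard ?_ (toFinite _)
    rintro m (hm | rfl | rfl)
    · exact lt_trans hm hz
    · exact lt_of_eq_of_lt hk hz
    · exact lt_of_eq_of_lt hl hz
  · rw [Set.disjoint_right]
    rintro m (rfl | rfl) hm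
    · exact hm.ne hk
    · exact hm.ne hl

/-- All double points of a slightly perturbed front come from its crossings and right cusps. -/
theorem eventually_isDouble_imp [Finite ι] (hL : L.GenericFront) {p q : ∀ P, L.HasCrossing P → ℝ → ι × ℝ}
    (hpq : ∀ P h, L.IsResolution P (p P h) (q P h)) :
    ∀ᶠ ε in 𝓝[>] 0, ∀ r ∈ Par ι, ∀ s ∈ Par ι, L.IsDouble (ε, r, s) →
      ∃ P h, r = p P h ε ∨ r = q P h ε := by
  -- The limit of double points is a pair at one place of the front. It is a crossing, a right cusp,
  -- a left cusp or a regular point; only the first two allow double points nearby, and those are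
  -- the chosen ones.
  have key : ∀ p₀ ∈ Par ι, ∀ q₀ ∈ Par ι, ∀ᶠ w in 𝓝[>] 0 ×ˢ (nearPar p₀ ×ˢ nearPar q₀),
      L.IsDouble w → ∃ P h, w.2.1 = p P h w.1 ∨ w.2.1 = q P h w.1 := by
    intro p₀ hp₀ q₀ hq₀
    by_cases hx : Int.fract (L.x p₀.1 p₀.2) = Int.fract (L.x q₀.1 q₀.2)
    swap
    · filter_upwards [eventually_not_isDouble_of_fract_ne hx] with w hw h using absurd h hw
    by_cases hz : L.z p₀.1 p₀.2 = L.z q₀.1 q₀.2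
    swap
    · filter_upwards [eventually_not_isDouble_of_z_ne hz] with w hw h using absurd h hw
    have hres : L.HasCrossing (point L.x L.z p₀) → ∀ᶠ w in 𝓝[>] 0 ×ˢ (nearPar p₀ ×ˢ nearPar q₀),
        L.IsDouble w → ∃ P h, w.2.1 = p P h w.1 ∨ w.2.1 = q P h w.1 := by
      intro h
      filter_upwards [(hpq _ h).isolated p₀ hp₀ q₀ hq₀ rfl (Prod.ext hx.symm hz.symm)] with w hw hd
      exact ⟨_, h, hw hd⟩
    by_cases hpq₀ : p₀ = q₀
    · subst hpq₀
      by_cases hd : der L.x p₀ = 0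
      · rcases lt_or_gt_of_ne (hL.nondegenerate p₀ hp₀ hd) with h | h
        · exact hres (Or.inl ⟨p₀, hp₀, rfl, hd, h⟩)
        · filter_upwards [eventually_not_isDouble_of_leftTurn hL ⟨hd, h⟩] with w hw h
            using absurd h hw
      · filter_upwards [eventually_not_isDouble_of_regular hd] with w hw h using absurd h hw
    · exact hres (Or.inr ⟨p₀, hp₀, q₀, hq₀, hpq₀, rfl, Prod.ext hx.symm hz.symm⟩)
  have key' : ∀ i j, ∀ᶠ ε in 𝓝[>] 0, ∀ y ∈ Icc (0 : ℝ) 1 ×ˢ Icc (0 : ℝ) 1,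
      L.IsDouble (ε, parOf (i, y.1), parOf (j, y.2)) → ∃ P h,
        parOf (i, y.1) = p P h ε ∨ parOf (i, y.1) = q P h ε := by
    intro i j
    refine (isCompact_Icc.prod isCompact_Icc).eventually_forall_of_prod fun y _ => ?_
    have h := key (parOf (i, y.1)) (parOf_mem _) (parOf (j, y.2)) (parOf_mem _)
    rw [nearPar_parOf, nearPar_parOf, eventually_near_iff] at h
    rw [nhds_prod_eq]
    exact h
  filter_upwards [eventually_all.mpr fun i => eventually_all.mpr fun j => key' i j]
    with ε hε r hr s hs hd
  have := hε r.1 s.1 (r.2, s.2) ⟨⟨hr.1, hr.2.le⟩, hs.1, hs.2.le⟩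
  simp only [Prod.mk.eta, parOf_of_mem hr, parOf_of_mem hs] at this
  exact this hd

end LegendrianLink

end

section
open Set Filter Topology

/-! ### A smooth staircase -/

/-- A nonnegative function of period `1` which is positive on `(0, w)` and vanishes on
`[w - 1, 0]`. -/
noncomputable def periodicBump (w s : ℝ) : ℝ :=
  expNegInvGlue (Real.cos (2 * Real.pi * (s - w / 2)) - Real.cos (Real.pi * w))

theorem contDiff_periodicBump (w : ℝ) : ContDiff ℝ ∞ (periodicBump w) :=
  expNegInvGlue.contDiff.comp ((Real.contDiff_cos.comp
    (contDiff_const.mul (contDiff_id.sub contDiff_const))).sub contDiff_const)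

theorem periodicBump_nonneg (w s : ℝ) : 0 ≤ periodicBump w s := expNegInvGlue.nonneg _

theorem periodic_periodicBump (w : ℝ) : Function.Periodic (periodicBump w) 1 := by
  intro s
  rw [periodicBump, show 2 * Real.pi * (s + 1 - w / 2) = 2 * Real.pi * (s - w / 2) + 2 * Real.pi by
    ring, Real.cos_add_two_pi, periodicBump]

theorem periodicBump_symm (w s : ℝ) : periodicBump w (w - s) = periodicBump w s := by
  rw [periodicBump, show 2 * Real.pi * (w - s - w / 2) = -(2 * Real.pi * (s - w / 2)) by ring,
    Real.cos_neg, periodicBump]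

theorem periodicBump_eq_zero {w s : ℝ} (hw : 0 < w) (hw1 : w < 1) (hs : s ∈ Icc (w - 1) 0) :
    periodicBump w s = 0 := by
  have hpi := Real.pi_pos
  refine expNegInvGlue.zero_of_nonpos (sub_nonpos.mpr ?_)
  have h1 : Real.cos (2 * Real.pi * (s - w / 2)) =
      Real.cos (Real.pi - (Real.pi + 2 * Real.pi * (s - w / 2))) := by
    rw [← Real.cos_neg]; ring_nf
  rw [h1, Real.cos_pi_sub, neg_le, ← Real.cos_pi_sub, ← Real.cos_abs (Real.pi + _)]
  refine Real.cos_le_cos_of_nonneg_of_le_pi (abs_nonneg _) (by nlinarith) (abs_le.mpr ⟨?_, ?_⟩)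
  · nlinarith [hs.1]
  · nlinarith [hs.2]

theorem hasDerivAt_expNegInvGlue {x : ℝ} (hx : 0 < x) :
    HasDerivAt expNegInvGlue (Real.exp (-x⁻¹) * (x ^ 2)⁻¹) x := by
  have h := ((hasDerivAt_inv hx.ne').neg).exp
  rw [neg_neg] at h
  refine h.congr_of_eventuallyEq ?_
  filter_upwards [lt_mem_nhds hx] with y hy
  simp [expNegInvGlue, hy.not_ge]

theorem exists_hasDerivAt_periodicBump {w s : ℝ} (hw1 : w < 1) (hs : s ∈ Ioo 0 (w / 2)) :
    0 < periodicBump w s ∧ ∃ d > 0, HasDerivAt (periodicBump w) d s := by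
  have hpi := Real.pi_pos
  obtain ⟨h0, h1⟩ := hs
  have h2 : 0 < Real.cos (2 * Real.pi * (s - w / 2)) - Real.cos (Real.pi * w) := by
    rw [sub_pos, ← Real.cos_neg (2 * Real.pi * _)]
    refine Real.cos_lt_cos_of_nonneg_of_le_pi ?_ ?_ ?_ <;> nlinarith
  have h3 : HasDerivAt (fun s => Real.cos (2 * Real.pi * (s - w / 2)) - Real.cos (Real.pi * w))
      (-Real.sin (2 * Real.pi * (s - w / 2)) * (2 * Real.pi * 1)) s :=
    ((((hasDerivAt_id s).sub_const (w / 2)).const_mul (2 * Real.pi)).cos).sub_const _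
  have h4 : 0 < -Real.sin (2 * Real.pi * (s - w / 2)) := by
    rw [← Real.sin_neg]
    refine Real.sin_pos_of_pos_of_lt_pi ?_ ?_ <;> nlinarith
  exact ⟨expNegInvGlue.pos_of_pos h2, _, by positivity, (hasDerivAt_expNegInvGlue h2).comp s h3⟩

theorem strictMonoOn_periodicBump {w : ℝ} (hw1 : w < 1) :
    StrictMonoOn (periodicBump w) (Icc 0 (w / 2)) := by
  refine strictMonoOn_of_deriv_pos (convex_Icc _ _) (contDiff_periodicBump w).continuous.continuousOn
    fun s hs => ?_
  rw [interior_Icc] at hs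
  obtain ⟨-, d, hd, h⟩ := exists_hasDerivAt_periodicBump hw1 hs
  rwa [h.deriv]

/-- A smooth monotone function on the real line which lifts a map of degree one of the circle, and
is constant outside `(0, w)` modulo `1`; its derivative passes through `1` only twice. -/
structure Staircase (w : ℝ) where
  toFun : ℝ → ℝ
  slope : ℝ → ℝ
  up : ℝ
  down : ℝ
  width_lt_one : w < 1
  smooth : ContDiff ℝ ∞ toFun
  smooth_slope : ContDiff ℝ ∞ slope
  hasDerivAt : ∀ s, HasDerivAt toFun (slope s) s
  slope_nonneg : ∀ s, 0 ≤ slope s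
  slope_add_one : ∀ s, slope (s + 1) = slope s
  add_one : ∀ s, toFun (s + 1) = toFun s + 1
  eq_zero : ∀ s ∈ Icc (w - 1) 0, toFun s = 0
  slope_eq_zero : ∀ s ∈ Icc (w - 1) 0, slope s = 0
  up_pos : 0 < up
  up_lt_down : up < down
  down_lt : down < w
  slope_up : slope up = 1
  slope_down : slope down = 1
  slope_lt_left : ∀ s ∈ Ico 0 up, slope s < 1
  lt_slope : ∀ s ∈ Ioo up down, 1 < slope s
  slope_lt_right : ∀ s ∈ Ioc down w, slope s < 1
  deriv_up : 0 < deriv slope up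
  deriv_down : deriv slope down < 0

/-- The staircase is the integral of a bump divided by its integral `I` over a period. The slope is
`1` where the bump takes the value `I`. This lies strictly between `0` and the maximum, so it is
attained once on each half of the window, with nonzero derivative. -/
theorem exists_staircase {w : ℝ} (hw : 0 < w) (hw1 : w < 1) : Nonempty (Staircase w) := by
  set B := periodicBump w with hB
  have hBc : Continuous B := (contDiff_periodicBump w).continuous
  have hBi : ∀ a b, IntervalIntegrable B MeasureTheory.volume a b := fun a b => hBc.intervalIntegrable a b
  have hB0 : ∀ s ∈ Icc (w - 1) 0, B s = 0 := fun s hs => periodicBump_eq_zero hw hw1 hs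
  have hmono := strictMonoOn_periodicBump hw1
  have hB00 : B 0 = 0 := hB0 0 ⟨by linarith, le_rfl⟩
  have hBtop : 0 < B (w / 2) := by
    rw [← hB00]
    exact hmono ⟨le_rfl, by linarith⟩ ⟨by linarith, le_rfl⟩ (by linarith)
  have hBle : ∀ s ∈ Icc 0 w, B s ≤ B (w / 2) := by
    intro s hs
    rcases le_total s (w / 2) with h | h
    · exact hmono.monotoneOn ⟨hs.1, h⟩ ⟨by linarith, le_rfl⟩ h
    · rw [hB, ← periodicBump_symm w s]
      exact hmono.monotoneOn ⟨by linarith [hs.2], by linarith⟩ ⟨by linarith, le_rfl⟩ (by linarith)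
  set I := ∫ s in (0 : ℝ)..1, B s with hI
  have hIpos : 0 < I := by
    refine intervalIntegral.intervalIntegral_pos_of_pos_on (a := 0) (b := w / 4) (hBi _ _)
      (fun s hs => (exists_hasDerivAt_periodicBump hw1 ⟨hs.1, by linarith [hs.2]⟩).1)
      (by linarith) |>.trans_le ?_
    refine intervalIntegral.integral_mono_interval le_rfl (by linarith) (by linarith) ?_ (hBi _ _)
    exact Eventually.of_forall fun s => periodicBump_nonneg w s
  -- The bump lives on a window of width `w < 1`, so `I ≤ w * B (w / 2)`.
  have hIlt : I < B (w / 2) := by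
    have h1 : (∫ s in (0 : ℝ)..w, B s) + ∫ s in w..1, B s = I :=
      intervalIntegral.integral_add_adjacent_intervals (hBi _ _) (hBi _ _)
    have h2 : ∫ s in w..1, B s = 0 := by
      rw [intervalIntegral.integral_congr (g := fun _ => 0), intervalIntegral.integral_zero]
      intro s hs
      rw [uIcc_of_le hw1.le] at hs
      have := periodic_periodicBump w (s - 1)
      rw [sub_add_cancel] at this
      change B s = 0
      rw [hB, this]
      exact hB0 _ ⟨by linarith [hs.1], by linarith [hs.2]⟩
    have h3 : (∫ s in (0 : ℝ)..w, B s) ≤ ∫ _ in (0 : ℝ)..w, B (w / 2) :=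
      intervalIntegral.integral_mono_on hw.le (hBi _ _) (by simp) hBle
    rw [intervalIntegral.integral_const, smul_eq_mul, sub_zero] at h3
    nlinarith
  -- `u` becomes the rising passage through slope `1`, and `w - u` the falling one, by the symmetry
  -- of the bump.
  obtain ⟨u, hu, hu1⟩ : I ∈ B '' Ioo 0 (w / 2) :=
    intermediate_value_Ioo (by linarith) hBc.continuousOn ⟨by rwa [hB00], hIlt⟩
  obtain ⟨-, d, hd, hdu⟩ := exists_hasDerivAt_periodicBump hw1 hu
  have hdu' : HasDerivAt B (-d) (w - u) := by
    have h1 : HasDerivAt (fun s => w - s) (-1) (w - u) := (hasDerivAt_id _).const_sub w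
    have h2 : HasDerivAt B d (w - (w - u)) := by rwa [sub_sub_cancel]
    have h3 := h2.comp (w - u) h1
    rw [mul_neg_one] at h3
    refine h3.congr_of_eventuallyEq (Eventually.of_forall fun s => ?_)
    exact (periodicBump_symm w s).symm
  have hl : ∀ s ∈ Ico 0 u, B s < I := fun s hs => by
    rw [← hu1]
    exact hmono ⟨hs.1, by linarith [hs.2, hu.2]⟩ ⟨hu.1.le, hu.2.le⟩ hs.2
  have hm : ∀ s ∈ Ioc u (w / 2), I < B s := fun s hs => by
    rw [← hu1]
    exact hmono ⟨hu.1.le, hu.2.le⟩ ⟨by linarith [hs.1, hu.1], hs.2⟩ hs.1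
  have hd' : ∀ s, HasDerivAt (fun s => ∫ t in (0 : ℝ)..s, B t / I) (B s / I) s := fun s =>
    (hBc.div_const I).integral_hasStrictDerivAt 0 s |>.hasDerivAt
  refine ⟨⟨fun s => ∫ t in (0 : ℝ)..s, B t / I, fun s => B s / I, u, w - u, hw1, ?_,
    (contDiff_periodicBump w).div_const I, hd', fun s => div_nonneg (periodicBump_nonneg w s) hIpos.le,
    fun s => by rw [hB, periodic_periodicBump w s], ?_, ?_, fun s hs => by rw [hB0 s hs, zero_div],
    hu.1, by linarith [hu.2], by linarith [hu.1], by rw [hu1, div_self hIpos.ne'], ?_, ?_, ?_, ?_, ?_, ?_⟩⟩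
  · rw [contDiff_infty_iff_deriv]
    refine ⟨fun s => (hd' s).differentiableAt, ?_⟩
    rw [show deriv (fun s => ∫ t in (0 : ℝ)..s, B t / I) = fun s => B s / I from
      funext fun s => (hd' s).deriv]
    exact (contDiff_periodicBump w).div_const I
  · intro s
    have hi : ∀ a b, IntervalIntegrable (fun t => B t / I) MeasureTheory.volume a b := fun a b =>
      (hBc.div_const I).intervalIntegrable a b
    have h1 := intervalIntegral.integral_add_adjacent_intervals (hi 0 s) (hi s (s + 1))
    have hper : Function.Periodic (fun t => B t / I) 1 := fun t => by
      simp only [hB, periodic_periodicBump w t]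
    have h2 := hper.intervalIntegral_add_eq s 0
    have h3 : (∫ t in (0 : ℝ)..1, B t / I) = 1 := by
      rw [intervalIntegral.integral_div, ← hI, div_self hIpos.ne']
    rw [← h1, h2, zero_add, h3]
  · intro s hs
    rw [intervalIntegral.integral_congr (g := fun _ => 0), intervalIntegral.integral_zero]
    intro t ht
    rw [uIcc_of_ge hs.2] at ht
    change B t / I = 0
    rw [hB0 t ⟨hs.1.trans ht.1, ht.2⟩, zero_div]
  · rw [hB, periodicBump_symm, ← hB, hu1, div_self hIpos.ne']
  · intro s hs
    exact (div_lt_one hIpos).mpr (hl s hs)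
  · intro s hs
    refine (one_lt_div hIpos).mpr ?_
    rcases le_total s (w / 2) with h | h
    · exact hm s ⟨hs.1, h⟩
    · rw [hB, ← periodicBump_symm w s]
      exact hm _ ⟨by linarith [hs.2], by linarith⟩
  · intro s hs
    refine (div_lt_one hIpos).mpr ?_
    rw [hB, ← periodicBump_symm w s]
    exact hl _ ⟨by linarith [hs.2], by linarith [hs.1]⟩
  · rw [(hdu.div_const I).deriv]; positivity
  · rw [(hdu'.div_const I).deriv, neg_div, neg_neg_iff_pos]; positivity

end

/-! ### The dip of one strand below another -/

section
open Set Filter Topology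

namespace Staircase

variable {w : ℝ} (S : Staircase w)

theorem pos (S : Staircase w) : 0 < w := S.up_pos.trans (S.up_lt_down.trans S.down_lt)

theorem monotone : Monotone S.toFun :=
  monotone_of_deriv_nonneg (fun s => (S.hasDerivAt s).differentiableAt)
    fun s => by rw [(S.hasDerivAt s).deriv]; exact S.slope_nonneg s

theorem eq_one {s : ℝ} (hs : s ∈ Icc w 1) : S.toFun s = 1 := by
  rw [show s = s - 1 + 1 by ring, S.add_one, S.eq_zero, zero_add]
  exact ⟨by linarith [hs.1], by linarith [hs.2]⟩

theorem slope_eq_zero' {s : ℝ} (hs : s ∈ Icc w 1) : S.slope s = 0 := by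
  rw [show s = s - 1 + 1 by ring, S.slope_add_one, S.slope_eq_zero]
  exact ⟨by linarith [hs.1], by linarith [hs.2]⟩

theorem nonneg {s : ℝ} (hs : w - 1 ≤ s) : 0 ≤ S.toFun s := by
  rw [← S.eq_zero (w - 1) ⟨le_rfl, by linarith [S.width_lt_one]⟩]
  exact S.monotone hs

theorem le_one {s : ℝ} (hs : s ≤ 1) : S.toFun s ≤ 1 := by
  rw [← S.eq_one ⟨S.width_lt_one.le, le_rfl⟩]
  exact S.monotone hs

/-- By monotonicity the staircase is constant from `s` to `w`, and its derivative can be computed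
from the right. Hence at the points of slope `1` the value is less than `1`, which makes the lower
strands negligible there. -/
theorem slope_eq_zero_of_eq_one {s : ℝ} (hs : s < w) (h : S.toFun s = 1) :
    S.slope s = 0 := by
  have hc : ∀ x ∈ Icc s w, S.toFun x = 1 := fun x hx => le_antisymm
    ((S.monotone hx.2).trans (S.eq_one ⟨le_rfl, S.width_lt_one.le⟩).le) (h.symm.le.trans (S.monotone hx.1))
  have h1 : HasDerivWithinAt S.toFun 0 (Icc s w) s :=
    (hasDerivWithinAt_const s _ (1 : ℝ)).congr hc (hc s ⟨le_rfl, hs.le⟩)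
  exact ((uniqueDiffWithinAt_convex (convex_Icc s w) (by rw [interior_Icc]; exact nonempty_Ioo.mpr hs)
    (subset_closure ⟨le_rfl, hs.le⟩)).eq_deriv _ (S.hasDerivAt s).hasDerivWithinAt h1)

theorem lt_one {s : ℝ} (hs : s < w) (h : S.slope s ≠ 0) : S.toFun s < 1 := by
  refine lt_of_le_of_ne ?_ fun h' => h (S.slope_eq_zero_of_eq_one hs h')
  exact S.le_one (hs.le.trans S.width_lt_one.le)

/-- The difference of two strands, the upper one of which dips below the lower one; up to a
positive factor. -/
noncomputable def dipDiff (t : ℝ) (Z Y Z' Y' : ℝ → ℝ) (ε x : ℝ) : ℝ :=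
  Z x * (1 - S.slope (x - t)) + ε * Y x -
    Real.exp (-(ε⁻¹ * (1 - S.toFun (x - t)))) * (Z' x + ε * Y' x)

/-- The derivative of `dipDiff`. -/
noncomputable def dipDiffDeriv (t : ℝ) (Z Y D Z' Y' D' : ℝ → ℝ) (ε x : ℝ) : ℝ :=
  Y x * (1 - S.slope (x - t)) - Z x * deriv S.slope (x - t) + ε * D x -
    (ε⁻¹ * Real.exp (-(ε⁻¹ * (1 - S.toFun (x - t)))) * (S.slope (x - t) * (Z' x + ε * Y' x)) +
      Real.exp (-(ε⁻¹ * (1 - S.toFun (x - t)))) * (Y' x + ε * D' x))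

theorem hasDerivAt_dipDiff {t ε x : ℝ} {Z Y D Z' Y' D' : ℝ → ℝ} (hZ : HasDerivAt Z (Y x) x)
    (hY : HasDerivAt Y (D x) x) (hZ' : HasDerivAt Z' (Y' x) x) (hY' : HasDerivAt Y' (D' x) x) :
    HasDerivAt (S.dipDiff t Z Y Z' Y' ε) (S.dipDiffDeriv t Z Y D Z' Y' D' ε x) x := by
  have hs : HasDerivAt (fun x => x - t) 1 x := (hasDerivAt_id x).sub_const t
  have h1 : HasDerivAt (fun x => S.slope (x - t)) (deriv S.slope (x - t) * 1) x :=
    ((S.smooth_slope.differentiable (by simp) (x - t)).hasDerivAt).comp x hs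
  have h2 : HasDerivAt (fun x => S.toFun (x - t)) (S.slope (x - t) * 1) x :=
    (S.hasDerivAt (x - t)).comp x hs
  have h3 := (((h2.const_sub 1).const_mul ε⁻¹).fun_neg).exp
  refine (((hZ.mul (h1.const_sub 1)).add (hY.const_mul ε)).sub
    (h3.mul (hZ'.add (hY'.const_mul ε)))).congr_deriv ?_
  simp only [dipDiffDeriv, Pi.add_apply]
  ring

/-- Near `x₁` the exponent is at most `-κ / ε` with a fixed `κ > 0`, and the exponential beats
`ε⁻¹`. This controls the term of `dipDiffDeriv` that comes from differentiating the exponential. -/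
theorem tendsto_inv_mul_exp {t x₁ : ℝ} (h : S.toFun (x₁ - t) < 1) :
    Tendsto (fun q : ℝ × ℝ => q.1⁻¹ * Real.exp (-(q.1⁻¹ * (1 - S.toFun (q.2 - t)))))
      (𝓝[>] 0 ×ˢ 𝓝 x₁) (𝓝 0) := by
  set κ := (1 - S.toFun (x₁ - t)) / 2
  have hκ : 0 < κ := by simp only [κ]; linarith
  have h1 : Tendsto (fun ε : ℝ => κ⁻¹ * ((κ * ε⁻¹) ^ 1 * Real.exp (-(κ * ε⁻¹)))) (𝓝[>] 0)
      (𝓝 (κ⁻¹ * 0)) :=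
    ((Real.tendsto_pow_mul_exp_neg_atTop_nhds_zero 1).comp
      (tendsto_inv_nhdsGT_zero.const_mul_atTop hκ)).const_mul _
  rw [mul_zero] at h1
  have hc : Tendsto (fun x => 1 - S.toFun (x - t)) (𝓝 x₁) (𝓝 (1 - S.toFun (x₁ - t))) :=
    (((S.smooth.continuous.comp (continuous_id.sub continuous_const)).tendsto x₁).const_sub 1)
  have h2 : ∀ᶠ x in 𝓝 x₁, κ < 1 - S.toFun (x - t) :=
    hc.eventually_const_lt (by simp only [κ]; linarith)
  have hpos : ∀ᶠ ε : ℝ in 𝓝[>] 0, 0 < ε := eventually_mem_nhdsWithin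
  refine squeeze_zero' ?_ ?_ (h1.comp tendsto_fst)
  · filter_upwards [tendsto_fst.eventually hpos] with q hq
    positivity
  · filter_upwards [tendsto_fst.eventually hpos, tendsto_snd.eventually h2] with q hq hq2
    simp only [Function.comp_apply, pow_one]
    rw [← mul_assoc, ← mul_assoc, inv_mul_cancel₀ hκ.ne', one_mul]
    refine mul_le_mul_of_nonneg_left (Real.exp_le_exp.mpr ?_) (by positivity)
    rw [neg_le_neg_iff, mul_comm]
    exact mul_le_mul_of_nonneg_left hq2.le (by positivity)

theorem tendsto_exp {t x₁ : ℝ} (h : S.toFun (x₁ - t) < 1) :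
    Tendsto (fun q : ℝ × ℝ => Real.exp (-(q.1⁻¹ * (1 - S.toFun (q.2 - t)))))
      (𝓝[>] 0 ×ˢ 𝓝 x₁) (𝓝 0) := by
  have h0 : Tendsto (fun q : ℝ × ℝ => q.1) (𝓝[>] 0 ×ˢ 𝓝 x₁) (𝓝 0) :=
    (tendsto_id.mono_left nhdsWithin_le_nhds).comp tendsto_fst
  have hpos : ∀ᶠ ε : ℝ in 𝓝[>] 0, 0 < ε := eventually_mem_nhdsWithin
  have h1 := h0.mul (S.tendsto_inv_mul_exp h)
  rw [mul_zero] at h1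
  refine h1.congr' ?_
  filter_upwards [tendsto_fst.eventually hpos] with q hq
  rw [← mul_assoc, mul_inv_cancel₀ (ne_of_gt hq), one_mul]

theorem tendsto_dipDiff {t x₁ : ℝ} {Z Y Z' Y' : ℝ → ℝ} (hZ : ContinuousAt Z x₁)
    (hY : ContinuousAt Y x₁) (hZ' : ContinuousAt Z' x₁) (hY' : ContinuousAt Y' x₁)
    (h : S.toFun (x₁ - t) < 1) :
    Tendsto (fun q : ℝ × ℝ => S.dipDiff t Z Y Z' Y' q.1 q.2) (𝓝[>] 0 ×ˢ 𝓝 x₁)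
      (𝓝 (Z x₁ * (1 - S.slope (x₁ - t)))) := by
  have h0 : Tendsto (fun q : ℝ × ℝ => q.1) (𝓝[>] 0 ×ˢ 𝓝 x₁) (𝓝 0) :=
    (tendsto_id.mono_left nhdsWithin_le_nhds).comp tendsto_fst
  have hs : Tendsto (fun q : ℝ × ℝ => S.slope (q.2 - t)) (𝓝[>] 0 ×ˢ 𝓝 x₁)
      (𝓝 (S.slope (x₁ - t))) :=
    ((S.smooth_slope.continuous.comp (continuous_id.sub continuous_const)).tendsto x₁).comp
      tendsto_snd
  have h1 := (((hZ.tendsto.comp tendsto_snd).mul (hs.const_sub 1)).add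
    (h0.mul (hY.tendsto.comp tendsto_snd))).sub ((S.tendsto_exp h).mul
    ((hZ'.tendsto.comp tendsto_snd).add (h0.mul (hY'.tendsto.comp tendsto_snd))))
  simpa [dipDiff] using h1

theorem tendsto_dipDiffDeriv {t x₁ : ℝ} {Z Y D Z' Y' D' : ℝ → ℝ} (hZ : ContinuousAt Z x₁)
    (hY : ContinuousAt Y x₁) (hD : ContinuousAt D x₁) (hZ' : ContinuousAt Z' x₁)
    (hY' : ContinuousAt Y' x₁) (hD' : ContinuousAt D' x₁)
    (h : S.toFun (x₁ - t) < 1) :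
    Tendsto (fun q : ℝ × ℝ => S.dipDiffDeriv t Z Y D Z' Y' D' q.1 q.2) (𝓝[>] 0 ×ˢ 𝓝 x₁)
      (𝓝 (Y x₁ * (1 - S.slope (x₁ - t)) - Z x₁ * deriv S.slope (x₁ - t))) := by
  have h0 : Tendsto (fun q : ℝ × ℝ => q.1) (𝓝[>] 0 ×ˢ 𝓝 x₁) (𝓝 0) :=
    (tendsto_id.mono_left nhdsWithin_le_nhds).comp tendsto_fst
  have hs : Tendsto (fun q : ℝ × ℝ => S.slope (q.2 - t)) (𝓝[>] 0 ×ˢ 𝓝 x₁)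
      (𝓝 (S.slope (x₁ - t))) :=
    ((S.smooth_slope.continuous.comp (continuous_id.sub continuous_const)).tendsto x₁).comp
      tendsto_snd
  have hds : Tendsto (fun q : ℝ × ℝ => deriv S.slope (q.2 - t)) (𝓝[>] 0 ×ˢ 𝓝 x₁)
      (𝓝 (deriv S.slope (x₁ - t))) :=
    ((((contDiff_infty_iff_deriv).mp S.smooth_slope).2.continuous.comp
      (continuous_id.sub continuous_const)).tendsto x₁).comp tendsto_snd
  have h1 := ((((hY.tendsto.comp tendsto_snd).mul (hs.const_sub 1)).sub
    ((hZ.tendsto.comp tendsto_snd).mul hds)).add (h0.mul (hD.tendsto.comp tendsto_snd))).sub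
    (((S.tendsto_inv_mul_exp h).mul (hs.mul
      ((hZ'.tendsto.comp tendsto_snd).add (h0.mul (hY'.tendsto.comp tendsto_snd))))).add
    ((S.tendsto_exp h).mul
      ((hY'.tendsto.comp tendsto_snd).add (h0.mul (hD'.tendsto.comp tendsto_snd)))))
  simpa [dipDiffDeriv] using h1

/-- Away from the two points where the staircase has slope `1`, the sign of `dipDiff` is that of
`1 - S.slope`. -/
theorem eventually_sign_dipDiff {t x₁ : ℝ} {Z Y Z' Y' : ℝ → ℝ} (hx₁ : x₁ ∈ Icc t (t + w))
    (hZ : ContinuousAt Z x₁) (hY : ContinuousAt Y x₁) (hZ' : ContinuousAt Z' x₁)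
    (hY' : ContinuousAt Y' x₁) (hpos : 0 < Z' x₁) (hlt : Z' x₁ < Z x₁)
    (h : S.slope (x₁ - t) ≠ 1) : ∀ᶠ q in 𝓝[>] (0 : ℝ) ×ˢ 𝓝 x₁, q.2 ∈ Icc t (t + w) →
      (S.slope (q.2 - t) < 1 → 0 < S.dipDiff t Z Y Z' Y' q.1 q.2) ∧
      (1 < S.slope (q.2 - t) → S.dipDiff t Z Y Z' Y' q.1 q.2 < 0) := by
  have h0 : Tendsto (fun q : ℝ × ℝ => q.1) (𝓝[>] 0 ×ˢ 𝓝 x₁) (𝓝 0) :=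
    (tendsto_id.mono_left nhdsWithin_le_nhds).comp tendsto_fst
  have hs : Tendsto (fun q : ℝ × ℝ => S.slope (q.2 - t)) (𝓝[>] 0 ×ˢ 𝓝 x₁)
      (𝓝 (S.slope (x₁ - t))) :=
    ((S.smooth_slope.continuous.comp (continuous_id.sub continuous_const)).tendsto x₁).comp
      tendsto_snd
  have hpε : ∀ᶠ ε : ℝ in 𝓝[>] 0, 0 < ε := eventually_mem_nhdsWithin
  have hw := S.width_lt_one
  rcases (S.le_one (s := x₁ - t) (by linarith [hx₁.2])).lt_or_eq with h1 | h1
  · have hlim := S.tendsto_dipDiff hZ hY hZ' hY' h1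
    rcases lt_or_gt_of_ne h with h2 | h2
    · filter_upwards [hlim.eventually_const_lt (mul_pos (hpos.trans hlt) (sub_pos.mpr h2)),
        hs.eventually_lt_const h2] with q h3 h4 _
      exact ⟨fun _ => h3, fun h5 => absurd h4 h5.not_gt⟩
    · filter_upwards [hlim.eventually_lt_const
        (mul_neg_of_pos_of_neg (hpos.trans hlt) (sub_neg.mpr h2)), hs.eventually_const_lt h2]
        with q h3 h4 _
      exact ⟨fun h5 => absurd h4 h5.not_gt, fun _ => h3⟩
  -- Where the staircase has already reached `1` the exponential need not be small. It is at most
  -- `1`, the slope is `0`, and `Z' < Z` suffices.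
  · have h2 : S.slope (x₁ - t) = 0 := by
      rcases hx₁.2.lt_or_eq with h2 | h2
      · exact S.slope_eq_zero_of_eq_one (by linarith) h1
      · exact S.slope_eq_zero' ⟨by linarith, by linarith⟩
    have hlim : Tendsto (fun q : ℝ × ℝ => Z q.2 * (1 - S.slope (q.2 - t)) + q.1 * Y q.2 -
        |Z' q.2 + q.1 * Y' q.2|) (𝓝[>] 0 ×ˢ 𝓝 x₁)
        (𝓝 (Z x₁ * (1 - S.slope (x₁ - t)) + 0 * Y x₁ - |Z' x₁ + 0 * Y' x₁|)) :=
      (((hZ.tendsto.comp tendsto_snd).mul (hs.const_sub 1)).add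
        (h0.mul (hY.tendsto.comp tendsto_snd))).sub
        ((hZ'.tendsto.comp tendsto_snd).add (h0.mul (hY'.tendsto.comp tendsto_snd))).abs
    rw [h2, sub_zero, mul_one, zero_mul, zero_mul, add_zero, add_zero, abs_of_pos hpos] at hlim
    filter_upwards [hlim.eventually_const_lt (sub_pos.mpr hlt),
      hs.eventually_lt_const (by rw [h2]; exact one_pos), tendsto_fst.eventually hpε]
      with q h3 h4 h5 hq
    refine ⟨fun _ => ?_, fun h5 => absurd h4 h5.not_gt⟩
    have h6 : Real.exp (-(q.1⁻¹ * (1 - S.toFun (q.2 - t)))) ≤ 1 := by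
      refine Real.exp_le_one_iff.mpr (neg_nonpos.mpr (mul_nonneg (inv_pos.mpr h5).le ?_))
      linarith [S.le_one (s := q.2 - t) (by linarith [hq.2])]
    have h7 : Real.exp (-(q.1⁻¹ * (1 - S.toFun (q.2 - t)))) * (Z' q.2 + q.1 * Y' q.2) ≤
        |Z' q.2 + q.1 * Y' q.2| :=
      (mul_le_mul_of_nonneg_left (le_abs_self _) (Real.exp_pos _).le).trans
        (mul_le_of_le_one_left (abs_nonneg _) h6)
    rw [dipDiff]
    linarith

/-- For small `ε`, the upper strand dips once below the lower one. -/
theorem eventually_dip {t : ℝ} {Z Y D Z' Y' D' : ℝ → ℝ} {U : Set ℝ} (hU : IsOpen U)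
    (htU : Icc t (t + w) ⊆ U) (hZ : ∀ x ∈ U, HasDerivAt Z (Y x) x)
    (hY : ∀ x ∈ U, HasDerivAt Y (D x) x) (hD : ∀ x ∈ U, ContinuousAt D x)
    (hZ' : ∀ x ∈ U, HasDerivAt Z' (Y' x) x) (hY' : ∀ x ∈ U, HasDerivAt Y' (D' x) x)
    (hD' : ∀ x ∈ U, ContinuousAt D' x) (hpos : ∀ x ∈ U, 0 < Z' x) (hlt : ∀ x ∈ U, Z' x < Z x) :
    ∀ᶠ ε in 𝓝[>] 0, ∃ a b, t < a ∧ a < b ∧ b < t + w ∧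
      S.dipDiff t Z Y Z' Y' ε a = 0 ∧ S.dipDiff t Z Y Z' Y' ε b = 0 ∧
      (∃ d < 0, HasDerivAt (S.dipDiff t Z Y Z' Y' ε) d a) ∧
      (∃ d > 0, HasDerivAt (S.dipDiff t Z Y Z' Y' ε) d b) ∧
      ∀ x ∈ Icc t (t + w), (x < a → 0 < S.dipDiff t Z Y Z' Y' ε x) ∧
        (a < x → x < b → S.dipDiff t Z Y Z' Y' ε x < 0) ∧
        (b < x → 0 < S.dipDiff t Z Y Z' Y' ε x) := by
  have hup := S.up_pos
  have hud := S.up_lt_down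
  have hdw := S.down_lt
  have hsign : ∀ x ∈ Icc t (t + w), S.slope (x - t) ≠ 1 →
      ∀ᶠ q in 𝓝[>] (0 : ℝ) ×ˢ 𝓝 x, q.2 ∈ Icc t (t + w) →
        (S.slope (q.2 - t) < 1 → 0 < S.dipDiff t Z Y Z' Y' q.1 q.2) ∧
        (1 < S.slope (q.2 - t) → S.dipDiff t Z Y Z' Y' q.1 q.2 < 0) := fun x hx h =>
    S.eventually_sign_dipDiff hx (hZ x (htU hx)).continuousAt (hY x (htU hx)).continuousAt
      (hZ' x (htU hx)).continuousAt (hY' x (htU hx)).continuousAt (hpos x (htU hx))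
      (hlt x (htU hx)) h
  have hsign' : ∀ x ∈ Icc t (t + w), S.slope (x - t) ≠ 1 → ∀ᶠ ε in 𝓝[>] (0 : ℝ),
        (S.slope (x - t) < 1 → 0 < S.dipDiff t Z Y Z' Y' ε x) ∧
        (1 < S.slope (x - t) → S.dipDiff t Z Y Z' Y' ε x < 0) := fun x hx h => by
    have ht : Tendsto (fun ε : ℝ => (ε, x)) (𝓝[>] 0) (𝓝[>] 0 ×ˢ 𝓝 x) :=
      tendsto_id.prodMk tendsto_const_nhds
    filter_upwards [ht.eventually (hsign x hx h)] with ε hε using hε hx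
  have hderiv : ∀ x ∈ U, ∀ᶠ q in 𝓝[>] (0 : ℝ) ×ˢ 𝓝 x, HasDerivAt (S.dipDiff t Z Y Z' Y' q.1)
      (S.dipDiffDeriv t Z Y D Z' Y' D' q.1 q.2) q.2 := fun x hx => by
    filter_upwards [tendsto_snd.eventually (hU.mem_nhds hx)] with q hq
    exact S.hasDerivAt_dipDiff (hZ _ hq) (hY _ hq) (hZ' _ hq) (hY' _ hq)
  have hlimit : ∀ x ∈ U, S.toFun (x - t) < 1 → _ := fun x hx h =>
    S.tendsto_dipDiffDeriv (hZ x hx).continuousAt (hY x hx).continuousAt (hD x hx)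
      (hZ' x hx).continuousAt (hY' x hx).continuousAt (hD' x hx) h
  have hA : t + S.up ∈ Icc t (t + w) := ⟨by linarith, by linarith⟩
  have hB : t + S.down ∈ Icc t (t + w) := ⟨by linarith, by linarith⟩
  -- For `ε → 0` the function tends to `Z * (1 - S.slope)`, with a simple zero at `S.up`. The zero
  -- at `S.down` has the opposite sign and is obtained from the negated function.
  obtain ⟨X, hX, η, hη, hXη⟩ := exists_simple_zero (H := S.dipDiff t Z Y Z' Y')
    (m := -(Z (t + S.up) * deriv S.slope S.up))
    (neg_neg_of_pos (mul_pos ((hpos _ (htU hA)).trans (hlt _ (htU hA))) S.deriv_up))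
    (hderiv _ (htU hA))
    (by
      have := hlimit _ (htU hA) (by
        rw [add_sub_cancel_left]
        exact S.lt_one (by linarith) (by rw [S.slope_up]; exact one_ne_zero))
      simpa only [add_sub_cancel_left, S.slope_up, sub_self, mul_zero, zero_sub] using this)
    (by
      have h1 : ∀ᶠ x in 𝓝[<] (t + S.up), t < x :=
        nhdsWithin_le_nhds (lt_mem_nhds (by linarith))
      filter_upwards [h1, self_mem_nhdsWithin] with x h1 h2
      have h2 := Set.mem_Iio.mp h2
      have h3 := S.slope_lt_left (x - t) ⟨by linarith, by linarith⟩
      filter_upwards [hsign' x ⟨h1.le, by linarith⟩ h3.ne] with ε hε using hε.1 h3)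
    (by
      have h1 : ∀ᶠ x in 𝓝[>] (t + S.up), x < t + S.down :=
        nhdsWithin_le_nhds (gt_mem_nhds (by linarith))
      filter_upwards [h1, self_mem_nhdsWithin] with x h1 h2
      have h2 := Set.mem_Ioi.mp h2
      have h3 := S.lt_slope (x - t) ⟨by linarith, by linarith⟩
      filter_upwards [hsign' x ⟨by linarith, by linarith⟩ h3.ne'] with ε hε using hε.2 h3)
  obtain ⟨X', hX', η', hη', hXη'⟩ := exists_simple_zero
    (H := fun ε x => -S.dipDiff t Z Y Z' Y' ε x)
    (H' := fun ε x => -S.dipDiffDeriv t Z Y D Z' Y' D' ε x)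
    (m := Z (t + S.down) * deriv S.slope S.down)
    (mul_neg_of_pos_of_neg ((hpos _ (htU hB)).trans (hlt _ (htU hB))) S.deriv_down)
    ((hderiv _ (htU hB)).mono fun q hq => hq.fun_neg)
    (by
      have := (hlimit _ (htU hB) (by
        rw [add_sub_cancel_left]
        exact S.lt_one (by linarith) (by rw [S.slope_down]; exact one_ne_zero))).neg
      simpa only [add_sub_cancel_left, S.slope_down, sub_self, mul_zero, zero_sub, neg_neg]
        using this)
    (by
      have h1 : ∀ᶠ x in 𝓝[<] (t + S.down), t + S.up < x :=
        nhdsWithin_le_nhds (lt_mem_nhds (by linarith))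
      filter_upwards [h1, self_mem_nhdsWithin] with x h1 h2
      have h2 := Set.mem_Iio.mp h2
      have h3 := S.lt_slope (x - t) ⟨by linarith, by linarith⟩
      filter_upwards [hsign' x ⟨by linarith, by linarith⟩ h3.ne'] with ε hε
        using neg_pos.mpr (hε.2 h3))
    (by
      have h1 : ∀ᶠ x in 𝓝[>] (t + S.down), x < t + w :=
        nhdsWithin_le_nhds (gt_mem_nhds (by linarith))
      filter_upwards [h1, self_mem_nhdsWithin] with x h1 h2
      have h2 := Set.mem_Ioi.mp h2
      have h3 := S.slope_lt_right (x - t) ⟨by linarith, by linarith⟩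
      filter_upwards [hsign' x ⟨by linarith, by linarith⟩ h3.ne] with ε hε
        using neg_neg_of_pos (hε.1 h3))
  -- The radii keep the two zeros inside the window and the two neighbourhoods disjoint.
  set r := min η (min ((S.down - S.up) / 4) S.up) with hr
  set r' := min η' (min ((S.down - S.up) / 4) (w - S.down)) with hr'
  have hr0 : 0 < r := lt_min hη (lt_min (by linarith) hup)
  have hr0' : 0 < r' := lt_min hη' (lt_min (by linarith) (by linarith))
  obtain ⟨hrη, hr4, hru⟩ : r ≤ η ∧ r ≤ (S.down - S.up) / 4 ∧ r ≤ S.up :=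
    ⟨min_le_left _ _, (min_le_right _ _).trans (min_le_left _ _),
      (min_le_right _ _).trans (min_le_right _ _)⟩
  obtain ⟨hrη', hr4', hru'⟩ : r' ≤ η' ∧ r' ≤ (S.down - S.up) / 4 ∧ r' ≤ w - S.down :=
    ⟨min_le_left _ _, (min_le_right _ _).trans (min_le_left _ _),
      (min_le_right _ _).trans (min_le_right _ _)⟩
  have hK : IsCompact (Icc t (t + w) ∩ ({x | r ≤ |x - (t + S.up)|} ∩ {x | r' ≤ |x - (t + S.down)|})) :=
    isCompact_Icc.inter_right ((isClosed_le continuous_const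
      (continuous_abs.comp (continuous_id.sub continuous_const))).inter
      (isClosed_le continuous_const (continuous_abs.comp (continuous_id.sub continuous_const))))
  have hslope : ∀ x ∈ Icc t (t + w), (x < t + S.up → S.slope (x - t) < 1) ∧
      (t + S.up < x → x < t + S.down → 1 < S.slope (x - t)) ∧
      (t + S.down < x → S.slope (x - t) < 1) := fun x hx =>
    ⟨fun h => S.slope_lt_left _ ⟨by linarith [hx.1], by linarith⟩,
      fun h h' => S.lt_slope _ ⟨by linarith, by linarith⟩,
      fun h => S.slope_lt_right _ ⟨by linarith, by linarith [hx.2]⟩⟩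
  -- Away from both zeros the slope differs from `1`, and compactness makes the sign estimate
  -- uniform.
  have hcomp := hK.eventually_forall_of_prod (l := 𝓝[>] (0 : ℝ)) (P := fun ε x =>
      x ∈ Icc t (t + w) → (S.slope (x - t) < 1 → 0 < S.dipDiff t Z Y Z' Y' ε x) ∧
        (1 < S.slope (x - t) → S.dipDiff t Z Y Z' Y' ε x < 0)) (by
    rintro x ⟨hx, hxu, hxd⟩
    refine hsign x hx ?_
    rcases lt_trichotomy x (t + S.up) with h | h | h
    · exact ((hslope x hx).1 h).ne
    · rw [mem_ofPred_eq, h, sub_self, abs_zero] at hxu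
      exact absurd hr0 hxu.not_gt
    rcases lt_trichotomy x (t + S.down) with h' | h' | h'
    · exact ((hslope x hx).2.1 h h').ne'
    · rw [mem_ofPred_eq, h', sub_self, abs_zero] at hxd
      exact absurd hr0' hxd.not_gt
    · exact ((hslope x hx).2.2 h').ne)
  filter_upwards [hXη, hXη', hcomp, hX.eventually (Metric.ball_mem_nhds _ hr0),
    hX'.eventually (Metric.ball_mem_nhds _ hr0')] with ε ha hb hc ha' hb'
  rw [Real.dist_eq, abs_lt] at ha' hb'
  obtain ⟨a0, a1, a2, a3⟩ := ha
  obtain ⟨b0, b1, b2, b3⟩ := hb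
  refine ⟨X ε, X' ε, by linarith, by linarith, by linarith, a0, neg_eq_zero.mp b0, ⟨_, a2, a1⟩,
    ⟨_, neg_neg_iff_pos.mp b2, ?_⟩, fun x hx => ?_⟩
  · have := b1.fun_neg
    simpa only [neg_neg] using this
  · by_cases h1 : |x - (t + S.up)| < r
    · have h2 := a3 x (h1.trans_le hrη)
      rw [abs_lt] at h1
      exact ⟨h2.1, fun h _ => h2.2 h, fun h => by linarith⟩
    by_cases h1' : |x - (t + S.down)| < r'
    · have h2 := b3 x (h1'.trans_le hrη')
      rw [abs_lt] at h1'
      exact ⟨fun h => by linarith, fun _ h => neg_pos.mp (h2.1 h),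
        fun h => neg_neg_iff_pos.mp (h2.2 h)⟩
    have h2 := hc x ⟨hx, not_lt.mp h1, not_lt.mp h1'⟩ hx
    have h3 := hslope x hx
    refine ⟨fun h => h2.1 (h3.1 ?_), fun h h' => h2.2 (h3.2.1 ?_ ?_), fun h => h2.1 (h3.2.2 ?_)⟩
    · by_contra h4
      exact h1 (abs_lt.mpr ⟨by linarith, by linarith⟩)
    · by_contra h4
      exact h1 (abs_lt.mpr ⟨by linarith, by linarith⟩)
    · by_contra h4
      exact h1' (abs_lt.mpr ⟨by linarith, by linarith⟩)
    · by_contra h4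
      exact h1' (abs_lt.mpr ⟨by linarith, by linarith⟩)

end Staircase

end

/-! ### The contact transformation and the strip -/

section
open Set Filter Topology Projection

namespace Staircase

variable {w : ℝ} (S : Staircase w)

/-- The fibrewise diffeomorphism of the half annulus `z > -c` that resolves a front. -/
noncomputable def fiberMap (τ : ℝ → ℝ) (hτ : ContDiff ℝ ∞ τ) (hmono : Monotone τ) (c Λ : ℝ)
    (hΛ : 0 ≤ Λ) : FiberMap (-c) where
  -- The exponential tilts the front so that the new slope records `z + c` at leading order. The
  -- staircase, of degree one, restores periodicity in `x`.
  g q := (q.2 + c) * Real.exp (Λ * (q.1 - S.toFun (q.1 - τ q.2)))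
  gx q := Λ * Real.exp (Λ * (q.1 - S.toFun (q.1 - τ q.2))) *
    ((q.2 + c) * (1 - S.slope (q.1 - τ q.2)))
  gz q := Real.exp (Λ * (q.1 - S.toFun (q.1 - τ q.2))) *
    (1 + (q.2 + c) * (Λ * S.slope (q.1 - τ q.2) * deriv τ q.2))
  smooth_g := (contDiff_snd.add contDiff_const).mul (contDiff_const.mul (contDiff_fst.sub
    (S.smooth.comp (contDiff_fst.sub (hτ.comp contDiff_snd))))).exp
  smooth_gx := (contDiff_const.mul (contDiff_const.mul (contDiff_fst.sub
    (S.smooth.comp (contDiff_fst.sub (hτ.comp contDiff_snd))))).exp).mul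
    ((contDiff_snd.add contDiff_const).mul (contDiff_const.sub
      (S.smooth_slope.comp (contDiff_fst.sub (hτ.comp contDiff_snd)))))
  smooth_gz := (contDiff_const.mul (contDiff_fst.sub
    (S.smooth.comp (contDiff_fst.sub (hτ.comp contDiff_snd))))).exp.mul
    (contDiff_const.add ((contDiff_snd.add contDiff_const).mul ((contDiff_const.mul
      (S.smooth_slope.comp (contDiff_fst.sub (hτ.comp contDiff_snd)))).mul
      (((contDiff_infty_iff_deriv).mp hτ).2.comp contDiff_snd))))
  hasFDerivAt q := by
    have h1 : HasFDerivAt (fun q : ℝ × ℝ => τ q.2) (deriv τ q.2 • ContinuousLinearMap.snd ℝ ℝ ℝ) q :=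
      ((hτ.differentiable (by simp) q.2).hasDerivAt).comp_hasFDerivAt q hasFDerivAt_snd
    have h2 : HasFDerivAt (fun q : ℝ × ℝ => S.toFun (q.1 - τ q.2))
        (S.slope (q.1 - τ q.2) • (ContinuousLinearMap.fst ℝ ℝ ℝ -
          deriv τ q.2 • ContinuousLinearMap.snd ℝ ℝ ℝ)) q :=
      (S.hasDerivAt _).comp_hasFDerivAt q (hasFDerivAt_fst.fun_sub h1)
    have h3 := ((hasFDerivAt_fst (𝕜 := ℝ) (E := ℝ) (F := ℝ) (p := q)).fun_sub h2).const_mul Λ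
    have h4 := ((hasFDerivAt_snd (𝕜 := ℝ) (E := ℝ) (F := ℝ) (p := q)).add_const c).mul h3.exp
    refine h4.congr_fderiv ?_
    ext <;> simp <;> ring
  periodic_g x z := by
    simp only [show x + 1 - τ z = x - τ z + 1 by ring, S.add_one,
      show ∀ v : ℝ, x + 1 - (v + 1) = x - v by intro v; ring]
  periodic_gx x z := by
    simp only [show x + 1 - τ z = x - τ z + 1 by ring, S.add_one, S.slope_add_one,
      show ∀ v : ℝ, x + 1 - (v + 1) = x - v by intro v; ring]
  periodic_gz x z := by
    simp only [show x + 1 - τ z = x - τ z + 1 by ring, S.add_one, S.slope_add_one,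
      show ∀ v : ℝ, x + 1 - (v + 1) = x - v by intro v; ring]
  -- This is where `τ` has to be monotone: higher points meet the staircase later, so the fibres are
  -- never folded.
  gz_pos x z hz := by
    have h1 : 0 ≤ deriv τ z := hmono.deriv_nonneg
    have h2 := S.slope_nonneg (x - τ z)
    have h3 : 0 ≤ z + c := by linarith
    positivity

end Staircase

/-- A smooth monotone function which takes the values `1`, …, `n` near `n` given points. -/
theorem exists_smooth_counting {n : ℕ} {h : Fin n → ℝ} (hh : StrictMono h) :
    ∃ r > 0, ∃ N : ℝ → ℝ, ContDiff ℝ ∞ N ∧ Monotone N ∧ (∀ z, N z ∈ Icc (0 : ℝ) n) ∧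
      (∀ k z, |z - h k| < r → N z = k + 1) ∧ ∀ j k, j < k → h j + 3 * r ≤ h k := by
  have hr : ∀ᶠ r : ℝ in 𝓝[>] 0, ∀ j k, j < k → h j + 3 * r ≤ h k := by
    refine eventually_all.mpr fun j => eventually_all.mpr fun k => ?_
    by_cases hjk : j < k
    · have hc : Tendsto (fun r : ℝ => h j + 3 * r) (𝓝[>] 0) (𝓝 (h j + 3 * 0)) :=
        ((continuous_const.add (continuous_const.mul continuous_id)).tendsto 0).mono_left
          nhdsWithin_le_nhds
      filter_upwards [hc.eventually_lt_const (by rw [mul_zero, add_zero]; exact hh hjk)]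
        with r hr _ using hr.le
    · exact Eventually.of_forall fun r h' => absurd h' hjk
  have hpos : ∀ᶠ r : ℝ in 𝓝[>] 0, 0 < r := eventually_mem_nhdsWithin
  obtain ⟨r, hr, hr0⟩ := (hr.and hpos).exists
  -- Each summand rises from `0` to `1` between `h k - 2 * r` and `h k - r`; the gap `3 * r` keeps
  -- all of them constant within distance `r` of every `h k`.
  refine ⟨r, hr0, fun z => ∑ k, Real.smoothTransition ((z - h k) / r + 2), ?_, ?_, ?_, ?_, hr⟩
  · exact ContDiff.sum fun k _ => Real.smoothTransition.contDiff.comp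
      (((contDiff_id.sub contDiff_const).div_const r).add contDiff_const)
  · intro a b hab
    refine Finset.sum_le_sum fun k _ => Real.smoothTransition.monotone ?_
    gcongr
  · intro z
    refine ⟨Finset.sum_nonneg fun k _ => Real.smoothTransition.nonneg _, ?_⟩
    refine (Finset.sum_le_sum fun k _ => Real.smoothTransition.le_one _).trans ?_
    simp
  · intro k z hz
    rw [abs_lt] at hz
    have hterm : ∀ j, Real.smoothTransition ((z - h j) / r + 2) = if j ≤ k then 1 else 0 := by
      intro j
      split_ifs with hj
      · refine Real.smoothTransition.one_of_one_le ?_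
        have h1 := hh.monotone hj
        have : -1 ≤ (z - h j) / r := by rw [le_div_iff₀ hr0]; linarith
        linarith
      · refine Real.smoothTransition.zero_of_nonpos ?_
        have h1 := hr k j (not_le.mp hj)
        have : (z - h j) / r ≤ -2 := by rw [div_le_iff₀ hr0]; linarith
        linarith
    simp only [hterm, Finset.sum_boole]
    rw [show Finset.univ.filter (fun j => j ≤ k) = Finset.Iic k by ext; simp, Fin.card_Iic]
    push_cast
    rfl

namespace LegendrianLink

variable {ι : Type*} {L : LegendrianLink ι}

/-- Fibres keep their orientation, so the original `z` decides which strand is over at a crossing of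
the deformed link. -/
theorem deform_z_lt {b : ℝ} (G : FiberMap b) (hb : ∀ i t, b < L.z i t) {p q : ι × ℝ}
    (h : Int.fract (L.x p.1 p.2) = Int.fract (L.x q.1 q.2)) (hz : L.z q.1 q.2 < L.z p.1 p.2) :
    (L.deform G hb).z q.1 q.2 < (L.deform G hb).z p.1 p.2 := by
  obtain ⟨n, hn⟩ := exists_shift_of_fract h
  change G.g (L.x q.1 q.2, L.z q.1 q.2) < G.g (L.x p.1 p.2, L.z p.1 p.2)
  rw [hn, FiberMap.apply_add_int G.periodic_g]
  exact G.strictMonoOn _ (hb _ _) (hb _ _) hz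

theorem exists_bound {u : ι → ℝ → ℝ} [Finite ι] (hu : ∀ i, Continuous (u i))
    (hp : ∀ i, Function.Periodic (u i) 1) : ∃ B, ∀ i t, |u i t| ≤ B := by
  have h : ∀ i, ∃ B, ∀ t, |u i t| ≤ B := fun i => by
    obtain ⟨B, hB⟩ := (isCompact_Icc (a := (0 : ℝ)) (b := 1)).exists_bound_of_continuousOn
      (hu i).continuousOn
    refine ⟨B, fun t => ?_⟩
    rw [← (hp i).apply_fract]
    exact hB _ ⟨Int.fract_nonneg t, (Int.fract_lt_one t).le⟩
  choose B hB using h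
  obtain ⟨M, hM⟩ := (Set.finite_range B).bddAbove
  exact ⟨M, fun i t => (hB i t).trans (hM (mem_range_self i))⟩

variable (L) in
/-- The data that determine the deformations of a Legendrian link which resolve its front: a strip
`u ≤ x < 1` without singularities, in which the strands, ordered by height, dip one after another. -/
structure Strip (n : ℕ) where
  c : ℝ
  u : ℝ
  w : ℝ
  S : Staircase w
  time : ℝ → ℝ
  strand : Fin n ≃ L.Branch 1
  σ : L.Branch 1 → ℝ → ℝ
  gap : ℝ
  one_le : ∀ i t, 1 ≤ L.z i t + c
  u_pos : 0 < u
  u_add : u + (n + 2) * w = 1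
  smooth_time : ContDiff ℝ ∞ time
  monotone_time : Monotone time
  le_time : ∀ z, u ≤ time z
  time_le : ∀ z, time z ≤ u + n * w
  isStrandsAt : ∀ ξ ∈ Ico u 1, L.IsStrandsAt σ ξ
  continuous_σ : ∀ k, Continuous (σ k)
  time_eq : ∀ k, ∀ ξ ∈ Ico u 1,
    time (L.z (strand k).comp (σ (strand k) ξ)) = u + (k + 1) * w ∧
    deriv time (L.z (strand k).comp (σ (strand k) ξ)) = 0
  gap_pos : 0 < gap
  add_gap_le : ∀ j k, j < k → ∀ ξ ∈ Ico u 1,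
    L.z (strand j).comp (σ (strand j) ξ) + gap ≤ L.z (strand k).comp (σ (strand k) ξ)
  lt_u : ∀ P, Singular L.x L.z P → P.1 < u

theorem over_one_iff {p : ι × ℝ} : L.Over 1 p ↔ Int.fract (L.x p.1 p.2) = 0 := by
  rw [over_iff, Int.fract_one]

/-- Nothing singular lies over the cut, so each point there carries a single branch, and the heights
are distinct. The cut is taken at `1` rather than `0`, so that its left side is the end of the
cut-open annulus. -/
theorem exists_orderedStrands [Finite ι] (hL : L.GenericFront) :
    ∃ e : Fin (strandsAtCut L.x) ≃ L.Branch 1,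
      StrictMono fun k => L.z (e k).pt.1 (e k).pt.2 := by
  have hfin := finite_branch hL 1
  have hfract : ∀ k : L.Branch 1, Int.fract (L.x k.pt.1 k.pt.2) = 0 := fun k =>
    over_one_iff.mp k.2.1.2
  have hreg : ∀ k : L.Branch 1, der L.x k.pt ≠ 0 := fun k h =>
    hL.turn_off_cut k.pt k.2.1.1 h (hfract k)
  have hpt : Function.Injective fun k : L.Branch 1 => k.pt := by
    rintro ⟨⟨p, b⟩, hk, hr⟩ ⟨⟨q, b'⟩, hl, hr'⟩ h
    change p = q at h
    subst h
    have h0 := hreg ⟨⟨p, b⟩, hk, hr⟩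
    have hb : ∀ b, L.Reaches p b → (b = true ↔ 0 < der L.x p) := by
      rintro (_ | _) h
      · have := h.resolve_right fun h => h0 h.1
        simpa using this.le
      · have := h.resolve_right fun h => h0 h.1
        simpa using this
    have : b = b' := by rw [Bool.eq_iff_iff, hb b hr, hb b' hr']
    subst this
    rfl
  have hz : Function.Injective fun k : L.Branch 1 => L.z k.pt.1 k.pt.2 := by
    intro k l h
    by_contra hne
    exact hL.double_off_cut k.pt k.2.1.1 l.pt l.2.1.1 (fun h => hne (hpt h))
      (Prod.ext ((hfract k).trans (hfract l).symm) h) (hfract k)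
  have hcard : Nat.card (L.Branch 1) = strandsAtCut L.x := by
    rw [strandsAtCut, ← Nat.card_coe_set_eq]
    refine Nat.card_eq_of_bijective (fun k => ⟨k.pt, k.2.1.1, hfract k⟩) ⟨fun k l h => ?_, ?_⟩
    · exact hpt (congrArg Subtype.val h)
    · rintro ⟨p, hp, hx⟩
      obtain ⟨k, hk⟩ := exists_branch_of_regular hp (over_one_iff.mpr hx)
        (fun h => hL.turn_off_cut p hp h hx)
      exact ⟨k, Subtype.ext hk⟩
  let _ : LinearOrder (L.Branch 1) := LinearOrder.lift' _ hz
  let _ := Fintype.ofFinite (L.Branch 1)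
  have e := Fintype.orderIsoFinOfCardEq (L.Branch 1) (Nat.card_eq_fintype_card.symm.trans hcard)
  exact ⟨e.toEquiv, fun j k hjk => e.strictMono hjk⟩

/-- All requirements on the strip hold for `x` close to the cut on its left. The time function is a
smooth count of the strands below a given height, scaled by the window width. -/
theorem exists_strip [Finite ι] (hL : L.GenericFront) : Nonempty (L.Strip (strandsAtCut L.x)) := by
  obtain ⟨e, he⟩ := exists_orderedStrands hL
  generalize strandsAtCut L.x = n at e he
  obtain ⟨r, hr, N, hN, hNm, hNn, hNk, hgap⟩ := exists_smooth_counting he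
  obtain ⟨σ, h1, h2, h3⟩ := exists_strands hL 1
  obtain ⟨B, hB⟩ := exists_bound (fun i => (L.smooth_z i).continuous) L.periodic_z
  have hfin := finite_branch hL 1
  have h4 : ∀ᶠ ξ in 𝓝[<] (1 : ℝ), ∀ k : L.Branch 1,
      |L.z k.comp (σ k ξ) - L.z k.pt.1 k.pt.2| < r := by
    refine eventually_all.mpr fun k => ?_
    have hc : Tendsto (fun ξ => L.z k.comp (σ k ξ)) (𝓝[<] 1) (𝓝 (L.z k.comp (σ k 1))) :=
      (((L.smooth_z _).continuous.comp (h1 k)).tendsto 1).mono_left nhdsWithin_le_nhds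
    rw [h2] at hc
    filter_upwards [hc.eventually (Metric.ball_mem_nhds _ hr)] with ξ hξ
    rwa [Real.dist_eq] at hξ
  have h5 : ∀ᶠ ξ in 𝓝[<] (1 : ℝ), ∀ P ∈ {P | Singular L.x L.z P}, P.1 < ξ := by
    refine (finite_singular hL).eventually_all.mpr fun P hP => ?_
    refine nhdsWithin_le_nhds (lt_mem_nhds ?_)
    rcases hP with ⟨p, -, h, -⟩ | ⟨p, -, -, -, -, h, -⟩ <;> exact (over_of_point h).1.2
  have h6 : ∀ᶠ ξ in 𝓝[<] (1 : ℝ), 0 < ξ := nhdsWithin_le_nhds (lt_mem_nhds one_pos)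
  obtain ⟨u, hu1, hu⟩ := exists_Icc_left_of_eventually (h3.and (h4.and (h5.and h6)))
  obtain ⟨-, -, hu5, hu0⟩ := hu u ⟨le_rfl, hu1⟩
  have hn : (0 : ℝ) ≤ n := Nat.cast_nonneg n
  -- One window for each of the `n` strands, and a free piece of width `w` at either end of the
  -- strip.
  set w := (1 - u) / (n + 2) with hw
  have hw0 : 0 < w := div_pos (by linarith) (by linarith)
  have hw2 : u + (n + 2) * w = 1 := by
    rw [hw]; field_simp; ring
  obtain ⟨S⟩ := exists_staircase hw0 (by nlinarith)
  refine ⟨⟨B + 1, u, w, S, fun z => u + N z * w, e, σ, r, ?_, hu0, hw2,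
    contDiff_const.add (hN.mul contDiff_const), ?_, ?_, ?_, fun ξ hξ => (hu ξ hξ).1, h1, ?_, hr,
    ?_, hu5⟩⟩
  · intro i t
    have := (abs_le.mp (hB i t)).1
    linarith
  · intro a b hab
    have := mul_le_mul_of_nonneg_right (hNm hab) hw0.le
    change u + N a * w ≤ u + N b * w
    linarith
  · intro z
    have := mul_nonneg (hNn z).1 hw0.le
    linarith
  · intro z
    have := mul_le_mul_of_nonneg_right (hNn z).2 hw0.le
    linarith
  · intro k ξ hξ
    have h7 := (hu ξ hξ).2.1 (e k)
    refine ⟨by rw [hNk k _ h7], ?_⟩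
    have h8 : (fun z => u + N z * w) =ᶠ[𝓝 (L.z (e k).comp (σ (e k) ξ))]
        fun _ => u + ((k : ℕ) + 1) * w := by
      filter_upwards [Metric.isOpen_ball.mem_nhds (show _ ∈ Metric.ball (L.z (e k).pt.1 (e k).pt.2) r
        from h7)] with z hz
      rw [hNk k z hz]
    rw [h8.deriv_eq, deriv_const]
  · intro j k hjk ξ hξ
    have h7 := abs_lt.mp ((hu ξ hξ).2.1 (e j))
    have h8 := abs_lt.mp ((hu ξ hξ).2.1 (e k))
    have h9 := hgap j k hjk
    linarith

end LegendrianLink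

end

/-! ### The slopes of the deformed link -/

section
open Set Filter Topology Projection

namespace LegendrianLink

variable {ι : Type*} {L : LegendrianLink ι}

namespace Strip

variable {n : ℕ} (D : L.Strip n)

theorem neg_c_lt (i : ι) (t : ℝ) : -D.c < L.z i t := by linarith [D.one_le i t]

/-- The deformation of the link which resolves its front. -/
noncomputable def link {ε : ℝ} (hε : 0 < ε) : LegendrianLink ι :=
  L.deform (D.S.fiberMap D.time D.smooth_time D.monotone_time D.c ε⁻¹ (inv_nonneg.mpr hε.le))
    D.neg_c_lt

theorem link_y {ε : ℝ} (hε : 0 < ε) {i : ι} {t ξ : ℝ} {m : ℤ} (hx : L.x i t = ξ + m) :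
    (D.link hε).y i t =
      ε⁻¹ * Real.exp (ε⁻¹ * (ξ - D.S.toFun (ξ - D.time (L.z i t)))) *
        ((L.z i t + D.c) * (1 - D.S.slope (ξ - D.time (L.z i t)))) +
      Real.exp (ε⁻¹ * (ξ - D.S.toFun (ξ - D.time (L.z i t)))) *
        (1 + (L.z i t + D.c) * (ε⁻¹ * D.S.slope (ξ - D.time (L.z i t)) *
          deriv D.time (L.z i t))) * L.y i t := by
  change FiberMap.gx _ (L.x i t, L.z i t) + FiberMap.gz _ (L.x i t, L.z i t) * L.y i t = _
  rw [hx, FiberMap.apply_add_int (FiberMap.periodic_gx _),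
    FiberMap.apply_add_int (FiberMap.periodic_gz _)]
  rfl

/-- The staircase has not started at any height, so the new slope is the height of the perturbed
front, translated and then scaled by a positive factor that depends on `ξ` only. Equality and order
on a vertical line are those of the perturbed front. -/
theorem link_y_outer {ε : ℝ} (hε : 0 < ε) {i : ι} {t ξ : ℝ} {m : ℤ} (hx : L.x i t = ξ + m)
    (hξ : ξ ∈ Icc 0 D.u) : (D.link hε).y i t =
      ε⁻¹ * Real.exp (ε⁻¹ * ξ) * (L.height ε i t + D.c) := by
  have h1 := D.le_time (L.z i t)
  have h2 := D.time_le (L.z i t)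
  have h3 := D.u_add
  have h4 := D.S.pos
  -- All times lie between `u` and `1 - 2 * w`, so `ξ - time` also stays clear of the previous
  -- period of the staircase.
  have hs : ξ - D.time (L.z i t) ∈ Icc (D.w - 1) 0 :=
    ⟨by linarith [hξ.1], by linarith [hξ.2]⟩
  rw [D.link_y hε hx, D.S.eq_zero _ hs, D.S.slope_eq_zero _ hs, height, sub_zero]
  field_simp
  ring

/-- The `z`-coordinate of a strand, made positive. -/
noncomputable def strandZ (k : Fin n) (ξ : ℝ) : ℝ :=
  L.z (D.strand k).comp (D.σ (D.strand k) ξ) + D.c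

/-- The `y`-coordinate of a strand. -/
noncomputable def strandY (k : Fin n) (ξ : ℝ) : ℝ :=
  L.y (D.strand k).comp (D.σ (D.strand k) ξ)

/-- The abscissa at which the dip of a strand starts. -/
noncomputable def start (k : ℕ) : ℝ := D.u + (k + 1) * D.w

/-- The `y`-coordinate of a strand after the deformation. -/
noncomputable def stripY (ε : ℝ) (k : Fin n) (ξ : ℝ) : ℝ :=
  ε⁻¹ * Real.exp (ε⁻¹ * (ξ - D.S.toFun (ξ - D.start k))) *
    (D.strandZ k ξ * (1 - D.S.slope (ξ - D.start k)) + ε * D.strandY k ξ)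

/-- Near the height of a strand `time` is constant, so its derivative disappears and each strand
sees a staircase that depends on `ξ` alone. -/
theorem link_y_strip {ε : ℝ} (hε : 0 < ε) {k : Fin n} {ξ : ℝ} (hξ : ξ ∈ Ico D.u 1) :
    (D.link hε).y (D.strand k).comp (D.σ (D.strand k) ξ) = D.stripY ε k ξ := by
  obtain ⟨m, hm⟩ := (D.isStrandsAt ξ hξ).mem_over (D.strand k)
  obtain ⟨h1, h2⟩ := D.time_eq k ξ hξ
  rw [D.link_y hε hm, h1, h2, stripY, start, strandZ, strandY]
  field_simp
  ring

theorem start_add_le {j k : ℕ} (h : j < k) : D.start j + D.w ≤ D.start k := by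
  have h1 : (j : ℝ) + 1 ≤ k := by exact_mod_cast h
  have := mul_le_mul_of_nonneg_right h1 D.S.pos.le
  rw [start, start]
  linarith

theorem u_add_le_start (k : ℕ) : D.u + D.w ≤ D.start k := by
  have := mul_nonneg (Nat.cast_nonneg (α := ℝ) k) D.S.pos.le
  rw [start]
  linarith

theorem start_add_le_one (k : Fin n) : D.start k + 2 * D.w ≤ 1 := by
  have h1 : ((k : ℕ) : ℝ) + 1 ≤ n := by exact_mod_cast k.2
  have := mul_le_mul_of_nonneg_right h1 D.S.pos.le
  have h2 := D.u_add
  rw [start]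
  linarith

theorem one_le_strandZ (k : Fin n) (ξ : ℝ) : 1 ≤ D.strandZ k ξ := D.one_le _ _

theorem strandZ_add_gap_le {j k : Fin n} (h : j < k) {ξ : ℝ} (hξ : ξ ∈ Ico D.u 1) :
    D.strandZ j ξ + D.gap ≤ D.strandZ k ξ := by
  have := D.add_gap_le j k h ξ hξ
  rw [strandZ, strandZ]
  linarith

theorem stripY_of_le {ε : ℝ} {k : Fin n} {ξ : ℝ} (hξ : ξ ∈ Ico D.u 1) (h : ξ ≤ D.start k) :
    D.stripY ε k ξ = ε⁻¹ * Real.exp (ε⁻¹ * ξ) * (D.strandZ k ξ + ε * D.strandY k ξ) := by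
  have hs : ξ - D.start k ∈ Icc (D.w - 1) 0 :=
    ⟨by linarith [hξ.1, D.start_add_le_one k, D.S.pos, D.u_pos], by linarith⟩
  rw [stripY, D.S.eq_zero _ hs, D.S.slope_eq_zero _ hs, sub_zero, sub_zero, mul_one]

/-- After its dip a strand carries an additional factor `exp (-1 / ε)`, which makes it negligible
against those that have not dipped. -/
theorem stripY_of_ge {ε : ℝ} {k : Fin n} {ξ : ℝ} (hξ : ξ ∈ Ico D.u 1) (h : D.start k + D.w ≤ ξ) :
    D.stripY ε k ξ = ε⁻¹ * Real.exp (ε⁻¹ * (ξ - 1)) * (D.strandZ k ξ + ε * D.strandY k ξ) := by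
  have hs : ξ - D.start k ∈ Icc D.w 1 :=
    ⟨by linarith, by linarith [hξ.2, D.u_add_le_start k, D.S.pos, D.u_pos]⟩
  rw [stripY, D.S.eq_one hs, D.S.slope_eq_zero' hs, sub_zero, mul_one]

/-- Before `k` starts, the staircase of `j`, at whatever stage, can only reduce the bound for the
lower strand. The gap between the heights then absorbs the two error terms `ε * B`. -/
theorem stripY_lt_of_le {ε B : ℝ} (hε : 0 < ε) (hB : ∀ i t, |L.y i t| ≤ B)
    (hεB : 2 * (ε * B) < D.gap) {j k : Fin n} (hjk : j < k) {ξ : ℝ} (hξ : ξ ∈ Ico D.u 1)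
    (h : ξ ≤ D.start k) : D.stripY ε j ξ < D.stripY ε k ξ := by
  have h1 := D.strandZ_add_gap_le hjk hξ
  have hYj := (abs_le.mp (hB (D.strand j).comp (D.σ (D.strand j) ξ))).2
  have hYk := (abs_le.mp (hB (D.strand k).comp (D.σ (D.strand k) ξ))).1
  have hB0 : 0 ≤ B := (abs_nonneg _).trans (hB (D.strand j).comp 0)
  have h2 := mul_le_mul_of_nonneg_left hYj hε.le
  have h3 := mul_le_mul_of_nonneg_left hYk hε.le
  have h4 := mul_nonneg hε.le hB0
  have h5 := D.one_le_strandZ j ξ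
  have h6 : D.strandZ j ξ * (1 - D.S.slope (ξ - D.start j)) ≤ D.strandZ j ξ :=
    mul_le_of_le_one_right (by linarith) (by linarith [D.S.slope_nonneg (ξ - D.start j)])
  have h7 : Real.exp (ε⁻¹ * (ξ - D.S.toFun (ξ - D.start j))) ≤ Real.exp (ε⁻¹ * ξ) := by
    refine Real.exp_le_exp.mpr (mul_le_mul_of_nonneg_left ?_ (inv_pos.mpr hε).le)
    have := D.S.nonneg (s := ξ - D.start j)
      (by linarith [hξ.1, D.start_add_le_one j, D.S.pos, D.u_pos])
    linarith
  rw [D.stripY_of_le hξ h, stripY]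
  change ε * D.strandY j ξ ≤ ε * B at h2
  change ε * -B ≤ ε * D.strandY k ξ at h3
  have hi := inv_pos.mpr hε
  calc _ ≤ ε⁻¹ * Real.exp (ε⁻¹ * (ξ - D.S.toFun (ξ - D.start j))) * (D.strandZ j ξ + ε * B) :=
        mul_le_mul_of_nonneg_left (by linarith) (by positivity)
    _ ≤ ε⁻¹ * Real.exp (ε⁻¹ * ξ) * (D.strandZ j ξ + ε * B) :=
        mul_le_mul_of_nonneg_right (mul_le_mul_of_nonneg_left h7 hi.le) (by linarith)
    _ < _ := mul_lt_mul_of_pos_left (by linarith) (by positivity)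

/-- Windows are ordered by height, so `j` finished before `k` and both strands carry the same
factor. -/
theorem stripY_lt_of_ge {ε B : ℝ} (hε : 0 < ε) (hB : ∀ i t, |L.y i t| ≤ B)
    (hεB : 2 * (ε * B) < D.gap) {j k : Fin n} (hjk : j < k) {ξ : ℝ} (hξ : ξ ∈ Ico D.u 1)
    (h : D.start k + D.w ≤ ξ) : D.stripY ε j ξ < D.stripY ε k ξ := by
  have h1 := D.strandZ_add_gap_le hjk hξ
  have h2 := mul_le_mul_of_nonneg_left
    (abs_le.mp (hB (D.strand j).comp (D.σ (D.strand j) ξ))).2 hε.le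
  have h3 := mul_le_mul_of_nonneg_left
    (abs_le.mp (hB (D.strand k).comp (D.σ (D.strand k) ξ))).1 hε.le
  have hi := inv_pos.mpr hε
  rw [D.stripY_of_ge hξ h,
    D.stripY_of_ge hξ (by linarith [D.start_add_le (show (j : ℕ) < k from hjk), D.S.pos])]
  change ε * D.strandY j ξ ≤ ε * B at h2
  change ε * -B ≤ ε * D.strandY k ξ at h3
  exact mul_lt_mul_of_pos_left (by linarith) (by positivity)

/-- From the start of the window of `k` on, `j` is already scaled down; dividing out the positive
factor of `k` leaves `dipDiff`. -/
theorem stripY_sub {ε : ℝ} {j k : Fin n} (hjk : j < k) {ξ : ℝ} (hξ : ξ ∈ Ico D.u 1)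
    (h : D.start k ≤ ξ) : D.stripY ε k ξ - D.stripY ε j ξ =
      ε⁻¹ * Real.exp (ε⁻¹ * (ξ - D.S.toFun (ξ - D.start k))) *
        D.S.dipDiff (D.start k) (D.strandZ k) (D.strandY k) (D.strandZ j) (D.strandY j) ε ξ := by
  rw [D.stripY_of_ge (k := j) hξ (by linarith [D.start_add_le (show (j : ℕ) < k from hjk)]),
    stripY, Staircase.dipDiff,
    show ε⁻¹ * (ξ - 1) = ε⁻¹ * (ξ - D.S.toFun (ξ - D.start k)) +
      -(ε⁻¹ * (1 - D.S.toFun (ξ - D.start k))) by ring, Real.exp_add]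
  ring

/-- In the deformed link, the strand `k` dips below the strand `j` between `a` and `b`. -/
structure Dips (ε : ℝ) (j k : Fin n) (a b : ℝ) : Prop where
  start_lt : D.start k < a
  lt : a < b
  lt_start : b < D.start k + D.w
  eq_left : D.stripY ε k a = D.stripY ε j a
  eq_right : D.stripY ε k b = D.stripY ε j b
  deriv_left : ∃ d < 0, HasDerivAt (fun ξ => D.stripY ε k ξ - D.stripY ε j ξ) d a
  deriv_right : ∃ d > 0, HasDerivAt (fun ξ => D.stripY ε k ξ - D.stripY ε j ξ) d b
  before : ∀ ξ ∈ Ico D.u 1, ξ < a → D.stripY ε j ξ < D.stripY ε k ξ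
  between : ∀ ξ, a < ξ → ξ < b → D.stripY ε k ξ < D.stripY ε j ξ
  after : ∀ ξ ∈ Ico D.u 1, b < ξ → D.stripY ε j ξ < D.stripY ε k ξ

/-- Inside the window of the upper strand the sign pattern is that of `dipDiff`; before and after it
the gap decides. Finitely many pairs are handled by a common small `ε`. -/
theorem eventually_dips [Finite ι] : ∀ᶠ ε in 𝓝[>] 0, ∀ j k, j < k → ∃ a b, D.Dips ε j k a b := by
  obtain ⟨B, hB⟩ := exists_bound (fun i => (L.smooth_y i).continuous) L.periodic_y
  have h0 : ∀ᶠ ε : ℝ in 𝓝[>] 0, 2 * (ε * B) < D.gap := by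
    have hc : Tendsto (fun ε : ℝ => 2 * (ε * B)) (𝓝[>] 0) (𝓝 (2 * (0 * B))) :=
      ((continuous_const.mul (continuous_id.mul continuous_const)).tendsto 0).mono_left
        nhdsWithin_le_nhds
    exact hc.eventually_lt_const (by rw [zero_mul, mul_zero]; exact D.gap_pos)
  have hpos : ∀ᶠ ε : ℝ in 𝓝[>] 0, 0 < ε := eventually_mem_nhdsWithin
  have hwin : ∀ k : Fin n, Icc (D.start k) (D.start k + D.w) ⊆ Ioo D.u 1 := fun k ξ hξ =>
    ⟨by linarith [hξ.1, D.u_add_le_start k, D.S.pos],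
      by linarith [hξ.2, D.start_add_le_one k, D.S.pos]⟩
  have hIoo : ∀ {ξ}, ξ ∈ Ioo D.u 1 → ξ ∈ Ico D.u 1 := fun h => ⟨h.1.le, h.2⟩
  have hZ : ∀ k, ∀ ξ ∈ Ioo D.u 1, HasDerivAt (D.strandZ k) (D.strandY k ξ) ξ := fun k ξ hξ =>
    have h := D.isStrandsAt ξ (hIoo hξ)
    (hasDerivAt_z_section (h.deriv_ne _) (h.hasDerivAt _)).add_const _
  have hY : ∀ k, ∀ ξ ∈ Ioo D.u 1, HasDerivAt (D.strandY k)
      (deriv (L.y (D.strand k).comp) (D.σ (D.strand k) ξ) /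
        deriv (L.x (D.strand k).comp) (D.σ (D.strand k) ξ)) ξ := fun k ξ hξ =>
    hasDerivAt_y_section ((D.isStrandsAt ξ (hIoo hξ)).hasDerivAt _)
  have hC : ∀ k, ∀ ξ ∈ Ioo D.u 1, ContinuousAt (fun ξ =>
      deriv (L.y (D.strand k).comp) (D.σ (D.strand k) ξ) /
        deriv (L.x (D.strand k).comp) (D.σ (D.strand k) ξ)) ξ := fun k ξ hξ =>
    ((L.contDiff_deriv_y _).continuous.comp (D.continuous_σ _)).continuousAt.div
      ((L.contDiff_deriv_x _).continuous.comp (D.continuous_σ _)).continuousAt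
      ((D.isStrandsAt ξ (hIoo hξ)).deriv_ne _)
  refine eventually_all.mpr fun j => eventually_all.mpr fun k => ?_
  by_cases hjk : j < k
  swap
  · exact Eventually.of_forall fun ε h => absurd h hjk
  filter_upwards [h0, hpos, D.S.eventually_dip isOpen_Ioo (hwin k) (hZ k) (hY k) (hC k) (hZ j)
    (hY j) (hC j) (fun ξ _ => by linarith [D.one_le_strandZ j ξ])
    (fun ξ hξ => by linarith [D.strandZ_add_gap_le hjk (hIoo hξ), D.gap_pos])]
    with ε hεB hε ⟨a, b, h1, h2, h3, h4, h5, ⟨d, hd, h6⟩, ⟨d', hd', h7⟩, h8⟩ _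
  have hi := inv_pos.mpr hε
  have hE : ∀ ξ, 0 < ε⁻¹ * Real.exp (ε⁻¹ * (ξ - D.S.toFun (ξ - D.start k))) := fun ξ => by positivity
  have hdE : ∀ ξ, ∃ e, HasDerivAt (fun ξ => ε⁻¹ * Real.exp (ε⁻¹ * (ξ - D.S.toFun (ξ - D.start k))))
      e ξ := fun ξ =>
    ⟨_, ((((hasDerivAt_id ξ).sub ((D.S.hasDerivAt _).comp ξ
      ((hasDerivAt_id ξ).sub_const _))).const_mul ε⁻¹).exp).const_mul ε⁻¹⟩
  have hsub : ∀ ξ ∈ Icc (D.start k) (D.start k + D.w), _ := fun ξ hξ =>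
    D.stripY_sub (ε := ε) hjk (hIoo (hwin k hξ)) hξ.1
  -- At a zero of `dipDiff` the derivative of the positive prefactor does not contribute, so
  -- transversality and its sign carry over.
  have hderiv : ∀ ξ ∈ Ioo (D.start k) (D.start k + D.w), ∀ d,
      D.S.dipDiff (D.start k) (D.strandZ k) (D.strandY k) (D.strandZ j) (D.strandY j) ε ξ = 0 →
      HasDerivAt (D.S.dipDiff (D.start k) (D.strandZ k) (D.strandY k) (D.strandZ j)
        (D.strandY j) ε) d ξ →
      HasDerivAt (fun ξ => D.stripY ε k ξ - D.stripY ε j ξ)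
        (ε⁻¹ * Real.exp (ε⁻¹ * (ξ - D.S.toFun (ξ - D.start k))) * d) ξ := by
    intro ξ hξ d h9 h10
    obtain ⟨e, he⟩ := hdE ξ
    refine ((he.mul h10).congr_deriv (by rw [h9, mul_zero, zero_add])).congr_of_eventuallyEq ?_
    filter_upwards [isOpen_Ioo.mem_nhds hξ] with x hx using hsub x ⟨hx.1.le, hx.2.le⟩
  refine ⟨a, b, h1, h2, h3, ?_, ?_, ?_, ?_, ?_, ?_, ?_⟩
  · rw [← sub_eq_zero, hsub a ⟨h1.le, by linarith⟩, h4, mul_zero]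
  · rw [← sub_eq_zero, hsub b ⟨by linarith, h3.le⟩, h5, mul_zero]
  · exact ⟨_, mul_neg_of_pos_of_neg (hE a) hd, hderiv a ⟨h1, by linarith⟩ d h4 h6⟩
  · exact ⟨_, mul_pos (hE b) hd', hderiv b ⟨by linarith, h3⟩ d' h5 h7⟩
  · intro ξ hξ hξa
    rcases le_total ξ (D.start k) with h | h
    · exact D.stripY_lt_of_le hε hB hεB hjk hξ h
    · have h9 : ξ ∈ Icc (D.start k) (D.start k + D.w) := ⟨h, by linarith⟩
      rw [← sub_pos, hsub ξ h9]
      exact mul_pos (hE ξ) ((h8 ξ h9).1 hξa)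
  · intro ξ ha hb
    have h9 : ξ ∈ Icc (D.start k) (D.start k + D.w) := ⟨by linarith, by linarith⟩
    rw [← sub_neg, hsub ξ h9]
    exact mul_neg_of_pos_of_neg (hE ξ) ((h8 ξ h9).2.1 ha hb)
  · intro ξ hξ hξb
    rcases le_total (D.start k + D.w) ξ with h | h
    · exact D.stripY_lt_of_ge hε hB hεB hjk hξ h
    · have h9 : ξ ∈ Icc (D.start k) (D.start k + D.w) := ⟨by linarith, h⟩
      rw [← sub_pos, hsub ξ h9]
      exact mul_pos (hE ξ) ((h8 ξ h9).2.2 hξb)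

end Strip

end LegendrianLink

end

section
open Set Filter Topology Projection

/-! ### Link diagrams from lists of singularities -/

namespace LegendrianLink

variable {ι : Type*}

/-- A transverse crossing of the Lagrangian projection, and its description. -/
structure IsCrossingItem (L : LegendrianLink ι) (d : (ℝ × ℝ) × DiagramEvent) : Prop where
  off_cut : d.1.1 ≠ 0
  isEvent : L.IsLagrangianEvent d.1 d.2
  exists_pair : ∃ p ∈ Par ι, ∃ q ∈ Par ι, p ≠ q ∧ point L.x L.y p = d.1 ∧ point L.x L.y q = d.1 ∧
    der L.x p ≠ 0 ∧ der L.x q ≠ 0 ∧ L.slope p ≠ L.slope q ∧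
    ∀ r ∈ Par ι, point L.x L.y r = d.1 → r = p ∨ r = q

/-- A turning point of the Lagrangian projection, and its description. -/
structure IsTurnItem (L : LegendrianLink ι) (d : (ℝ × ℝ) × DiagramEvent) : Prop where
  off_cut : d.1.1 ≠ 0
  isEvent : L.IsLagrangianEvent d.1 d.2
  exists_turn : ∃ p ∈ Par ι, point L.x L.y p = d.1 ∧ der L.x p = 0 ∧
    ∀ r ∈ Par ι, point L.x L.y r = d.1 → r = p

/-- Each item lists all points of the link over its place, so no place carries more than its
crossing or its turn. Distinct slopes give transversality. -/
theorem generic_of_items {L : LegendrianLink ι} (hnd : ∀ p ∈ Par ι, der L.x p = 0 → der2 L.x p ≠ 0)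
    {c : List ((ℝ × ℝ) × DiagramEvent)} (hc : ∀ d ∈ c, L.IsCrossingItem d ∨ L.IsTurnItem d)
    (hsing : ∀ P, Singular L.x L.y P → ∃ d ∈ c, d.1 = P) : Generic L.x L.y := by
  have hdouble : ∀ p ∈ Par ι, ∀ q ∈ Par ι, p ≠ q → point L.x L.y p = point L.x L.y q →
      (point L.x L.y p).1 ≠ 0 ∧ der L.x p ≠ 0 ∧ der L.x q ≠ 0 ∧ L.slope p ≠ L.slope q ∧
        ∀ r ∈ Par ι, point L.x L.y r = point L.x L.y p → r = p ∨ r = q := by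
    intro p hp q hq hne h
    obtain ⟨d, hd, hdP⟩ := hsing _ (Or.inr ⟨p, hp, q, hq, hne, rfl, h.symm⟩)
    rcases hc d hd with ⟨h0, -, p', hp', q', hq', hne', hpp, hqq, hxp, hxq, hs, hr⟩ |
      ⟨-, -, p', hp', hpp, hx, hr⟩
    · rw [hdP] at hr h0
      rcases hr p hp rfl with rfl | rfl <;> rcases hr q hq h.symm with rfl | rfl
      · exact absurd rfl hne
      · exact ⟨h0, hxp, hxq, hs, hr⟩
      · exact ⟨h0, hxq, hxp, hs.symm, fun r hr1 hr2 => (hr r hr1 hr2).symm⟩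
      · exact absurd rfl hne
    · rw [hdP] at hr
      exact absurd ((hr p hp rfl).trans (hr q hq h.symm).symm) hne
  refine ⟨hnd, fun p hp q hq hne h => (hdouble p hp q hq hne h).2.1, ?_, ?_, ?_,
    fun p hp q hq hne h => (hdouble p hp q hq hne h).1⟩
  · intro p hp q hq hne h heq
    obtain ⟨-, hxp, hxq, hs, -⟩ := hdouble p hp q hq hne h
    refine hs ?_
    rw [slope, slope, div_eq_div_iff hxp hxq, heq]
  · rintro p hp q hq r hr hpq hqr hpr ⟨h1, h2⟩
    rcases (hdouble p hp q hq hpq h1).2.2.2.2 r hr (h2.symm.trans h1.symm) with h | h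
    · exact hpr h.symm
    · exact hqr h.symm
  · intro p hp hx
    obtain ⟨d, hd, hdP⟩ := hsing _ (Or.inl ⟨p, hp, rfl, hx⟩)
    rw [← hdP]
    rcases hc d hd with h | h <;> exact h.off_cut

/-- The link diagram described by a list of all singularities which is in reading order up to
sliding crossings to the left. -/
theorem exists_lagrangianDiagram {L : LegendrianLink ι}
    (hnd : ∀ p ∈ Par ι, der L.x p = 0 → der2 L.x p ≠ 0)
    {c : List ((ℝ × ℝ) × DiagramEvent)} (hc : ∀ d ∈ c, L.IsCrossingItem d ∨ L.IsTurnItem d)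
    (hsing : ∀ P, Singular L.x L.y P → ∃ d ∈ c, d.1 = P)
    (hpw : c.Pairwise fun d d' => ReadsBefore d.1 d'.1 ∨ SlidesLeft d.2 d'.2) :
    ∃ Y : LinkDiagram, L.HasLagrangianDiagram Y ∧ Y.strands = strandsAtCut L.x ∧
      Relation.EqvGen PlanarMove Y.word (c.map Prod.snd) := by
  have hev : ∀ d ∈ c, L.IsLagrangianEvent d.1 d.2 := fun d hd =>
    (hc d hd).elim (fun h => h.isEvent) fun h => h.isEvent
  -- Two items at one place would have the same position, which contradicts sliding, and reading
  -- order is irreflexive.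
  have hnodup : (c.map Prod.fst).Nodup := by
    rw [List.Nodup, List.pairwise_map]
    refine hpw.imp_of_mem ?_
    rintro d d' hd hd' (h | h) heq
    · rw [heq] at h
      exact h.asymm h
    · have h1 := (hev d hd).1
      have h2 := (hev d' hd').1
      rw [heq, ← h2] at h1
      have := h.2.2
      omega
  obtain ⟨a, hp, ha⟩ := exists_perm_pairwise_readsBefore Prod.fst c hnodup
  refine ⟨⟨strandsAtCut L.x, a.map Prod.snd⟩, ⟨generic_of_items hnd hc hsing, rfl,
    a.map Prod.fst, List.pairwise_map.mpr ha, fun P => ?_, ?_⟩, rfl,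
    eqvGen_of_perm Prod.snd (fun d d' => ReadsBefore d.1 d'.1) (fun d d' h => h.asymm) a c hp ha hpw⟩
  · constructor
    · intro h
      obtain ⟨d, hd, rfl⟩ := List.mem_map.mp h
      rcases hc d (hp.subset hd) with ⟨-, -, p, hp, q, hq, hne, hpp, hqq, -⟩ |
        ⟨-, -, p, hp, hpp, hx, -⟩
      · exact Or.inr ⟨p, hp, q, hq, hne, hpp, hqq⟩
      · exact Or.inl ⟨p, hp, hpp, hx⟩
    · intro h
      obtain ⟨d, hd, rfl⟩ := hsing P h
      exact List.mem_map.mpr ⟨d, hp.symm.subset hd, rfl⟩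
  · rw [List.forall₂_map_left_iff, List.forall₂_map_right_iff, List.forall₂_same]
    exact fun d hd => hev d (hp.subset hd)

theorem strandsBelow_congr {x v v' : ι → ℝ → ℝ} {ξ c c' : ℝ}
    (h : ∀ p ∈ Par ι, Int.fract (x p.1 p.2) = ξ → (v p.1 p.2 < c ↔ v' p.1 p.2 < c')) :
    strandsBelow x v (ξ, c) = strandsBelow x v' (ξ, c') := by
  have h1 : ∀ p ∈ Par ι, ∀ Q : Prop, ((point x v p).1 = (ξ, c).1 ∧ (point x v p).2 < (ξ, c).2 ∧ Q) ↔
      ((point x v' p).1 = (ξ, c').1 ∧ (point x v' p).2 < (ξ, c').2 ∧ Q) := fun p hp Q =>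
    and_congr_right fun hx => and_congr_left fun _ => h p hp hx
  rw [strandsBelow, strandsBelow]
  congr 2
  · ext p
    exact and_congr_right fun hp => h1 p hp _
  · congr 1
    ext p
    exact and_congr_right fun hp => h1 p hp _

end LegendrianLink

/-! ### The transition tangle -/

/-- The crossings of a dip below `k` strands, placed at the points `A` on the way down and `B` on
the way up. -/
def dipItems (A B : ℕ → ℝ × ℝ) (k : ℕ) : List ((ℝ × ℝ) × DiagramEvent) :=
  (List.range k).reverse.map (fun j => (A j, ⟨.lesserOver, j⟩)) ++
  (List.range k).map (fun j => (B j, ⟨.greaterOver, j⟩))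

/-- The crossings of a transition tangle, placed at given points. -/
def tangleItems (A B : ℕ → ℕ → ℝ × ℝ) : ℕ → List ((ℝ × ℝ) × DiagramEvent)
  | 0 => []
  | k + 1 => tangleItems A B k ++ dipItems (A k) (B k) k

theorem map_snd_tangleItems (A B : ℕ → ℕ → ℝ × ℝ) (n : ℕ) :
    (tangleItems A B n).map Prod.snd = transitionTangle n := by
  induction n with
  | zero => rfl
  | succ k ih =>
    rw [tangleItems, List.map_append, ih, transitionTangle, dipItems, dip, List.map_append,
      List.map_map, List.map_map]
    rfl

theorem mem_dipItems {A B : ℕ → ℝ × ℝ} {k : ℕ} {d : (ℝ × ℝ) × DiagramEvent} :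
    d ∈ dipItems A B k ↔
      ∃ j < k, d = (A j, ⟨.lesserOver, j⟩) ∨ d = (B j, ⟨.greaterOver, j⟩) := by
  simp only [dipItems, List.mem_append, List.mem_map, List.mem_reverse, List.mem_range]
  constructor
  · rintro (⟨j, hj, rfl⟩ | ⟨j, hj, rfl⟩)
    · exact ⟨j, hj, Or.inl rfl⟩
    · exact ⟨j, hj, Or.inr rfl⟩
  · rintro ⟨j, hj, rfl | rfl⟩
    · exact Or.inl ⟨j, hj, rfl⟩
    · exact Or.inr ⟨j, hj, rfl⟩

theorem mem_tangleItems {A B : ℕ → ℕ → ℝ × ℝ} {n : ℕ} {d : (ℝ × ℝ) × DiagramEvent} :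
    d ∈ tangleItems A B n ↔ ∃ k < n, d ∈ dipItems (A k) (B k) k := by
  induction n with
  | zero => simp [tangleItems]
  | succ m ih =>
    rw [tangleItems, List.mem_append, ih]
    constructor
    · rintro (⟨k, hk, h⟩ | h)
      · exact ⟨k, by omega, h⟩
      · exact ⟨m, by omega, h⟩
    · rintro ⟨k, hk, h⟩
      rcases Nat.lt_succ_iff_lt_or_eq.mp hk with hk | rfl
      · exact Or.inl ⟨k, hk, h⟩
      · exact Or.inr h

/-- The descending strand meets the highest of the lower strands first and leaves it last, so the
crossing intervals are nested. -/
theorem pairwise_dipItems {A B : ℕ → ℝ × ℝ} {k : ℕ} (hAB : ∀ j < k, (A j).1 < (B j).1)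
    (hA : ∀ i j, i < j → j < k → (A j).1 < (A i).1)
    (hB : ∀ i j, i < j → j < k → (B i).1 < (B j).1) :
    (dipItems A B k).Pairwise fun d d' => d.1.1 < d'.1.1 := by
  rw [dipItems, List.pairwise_append]
  refine ⟨?_, ?_, ?_⟩
  · rw [List.pairwise_map, List.pairwise_reverse]
    exact List.pairwise_lt_range.imp_of_mem fun _ hj hij => hA _ _ hij (List.mem_range.mp hj)
  · rw [List.pairwise_map]
    exact List.pairwise_lt_range.imp_of_mem fun _ hj hij => hB _ _ hij (List.mem_range.mp hj)
  · intro d hd d' hd'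
    obtain ⟨i, hi, rfl⟩ := List.mem_map.mp hd
    obtain ⟨j, hj, rfl⟩ := List.mem_map.mp hd'
    rw [List.mem_reverse, List.mem_range] at hi
    rw [List.mem_range] at hj
    rcases lt_trichotomy i j with h | rfl | h
    · exact (hAB i hi).trans (hB i j h hj)
    · exact hAB i hi
    · exact (hA j i h hi).trans (hAB j hj)

theorem pairwise_tangleItems {A B : ℕ → ℕ → ℝ × ℝ} {n : ℕ} {s : ℕ → ℝ} (hs : Monotone s)
    (h : ∀ j k, j < k → k < n →
      s k < (A k j).1 ∧ (A k j).1 < (B k j).1 ∧ (B k j).1 < s (k + 1))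
    (hA : ∀ k < n, ∀ i j, i < j → j < k → (A k j).1 < (A k i).1)
    (hB : ∀ k < n, ∀ i j, i < j → j < k → (B k i).1 < (B k j).1) :
    (tangleItems A B n).Pairwise fun d d' => d.1.1 < d'.1.1 := by
  induction n with
  | zero => exact List.Pairwise.nil
  | succ m ih =>
    rw [tangleItems, List.pairwise_append]
    refine ⟨ih (fun j k hjk hk => h j k hjk (by omega)) (fun k hk => hA k (by omega))
      (fun k hk => hB k (by omega)), pairwise_dipItems (fun j hj => (h j m hj (by omega)).2.1)
      (hA m (by omega)) (hB m (by omega)), ?_⟩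
    intro d hd d' hd'
    obtain ⟨k, hk, hd⟩ := mem_tangleItems.mp hd
    obtain ⟨i, hi, hd⟩ := mem_dipItems.mp hd
    obtain ⟨j, hj, hd'⟩ := mem_dipItems.mp hd'
    obtain ⟨h1, h2, h3⟩ := h i k hi (by omega)
    obtain ⟨h4, h5, h6⟩ := h j m hj (by omega)
    have h7 : s (k + 1) ≤ s m := hs (by omega)
    rcases hd with rfl | rfl <;> rcases hd' with rfl | rfl <;> simp only <;> linarith

end

section
open Set Filter Topology Projection

namespace LegendrianLink

variable {ι : Type*} {L : LegendrianLink ι}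

namespace Strip

variable {n : ℕ} (D : L.Strip n)

/-! ### Crossings in the strip -/

/-- The point of the link on the strand `k` over `ξ`. -/
noncomputable def pt (k : Fin n) (ξ : ℝ) : ι × ℝ := parOf ((D.strand k).comp, D.σ (D.strand k) ξ)

theorem mem_Ico_zero_one {ξ : ℝ} (hξ : ξ ∈ Ico D.u 1) : ξ ∈ Ico (0 : ℝ) 1 :=
  ⟨D.u_pos.le.trans hξ.1, hξ.2⟩

theorem fract_x_pt {k : Fin n} {ξ : ℝ} (hξ : ξ ∈ Ico D.u 1) :
    Int.fract (L.x (D.pt k ξ).1 (D.pt k ξ).2) = ξ :=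
  (over_iff_of_mem (D.mem_Ico_zero_one hξ)).mp (over_parOf.mpr ((D.isStrandsAt ξ hξ).mem_over _))

theorem point_pt {ε : ℝ} (hε : 0 < ε) {k : Fin n} {ξ : ℝ} (hξ : ξ ∈ Ico D.u 1) :
    point (D.link hε).x (D.link hε).y (D.pt k ξ) = (ξ, D.stripY ε k ξ) := by
  refine Prod.ext (D.fract_x_pt hξ) ?_
  change (D.link hε).y (D.pt k ξ).1 (D.pt k ξ).2 = _
  rw [pt, y_parOf]
  exact D.link_y_strip hε hξ

theorem pt_injective {ξ : ℝ} (hξ : ξ ∈ Ico D.u 1) {j k : Fin n} (h : D.pt j ξ = D.pt k ξ) :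
    j = k :=
  D.strand.injective ((D.isStrandsAt ξ hξ).inj _ _ h)

theorem exists_eq_pt {ξ : ℝ} (hξ : ξ ∈ Ico D.u 1) {r : ι × ℝ} (hr : r ∈ Par ι)
    (hx : Int.fract (L.x r.1 r.2) = ξ) : ∃ k, r = D.pt k ξ := by
  obtain ⟨b, hb⟩ := (D.isStrandsAt ξ hξ).surj r ((over_iff_of_mem (D.mem_Ico_zero_one hξ)).mpr hx)
  refine ⟨D.strand.symm b, ?_⟩
  rw [pt, Equiv.apply_symm_apply, ← hb, parOf_of_mem hr]

theorem der_x_pt_ne {k : Fin n} {ξ : ℝ} (hξ : ξ ∈ Ico D.u 1) : der L.x (D.pt k ξ) ≠ 0 := by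
  rw [pt, der_x_parOf]
  exact (D.isStrandsAt ξ hξ).deriv_ne _

theorem z_pt_lt {j k : Fin n} (h : j < k) {ξ : ℝ} (hξ : ξ ∈ Ico D.u 1) :
    L.z (D.pt j ξ).1 (D.pt j ξ).2 < L.z (D.pt k ξ).1 (D.pt k ξ).2 := by
  rw [pt, pt, z_parOf, z_parOf]
  linarith [D.add_gap_le j k h ξ hξ, D.gap_pos]

theorem hasDerivAt_stripY {ε : ℝ} (hε : 0 < ε) (k : Fin n) {ξ : ℝ} (hξ : ξ ∈ Ioo D.u 1) :
    HasDerivAt (D.stripY ε k) ((D.link hε).slope (D.pt k ξ)) ξ := by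
  have h := hasDerivAt_y_section (L := D.link hε)
    ((D.isStrandsAt ξ ⟨hξ.1.le, hξ.2⟩).hasDerivAt (D.strand k))
  rw [slope, pt, der_y_parOf, der_x_parOf]
  refine h.congr_of_eventuallyEq ?_
  filter_upwards [isOpen_Ioo.mem_nhds hξ] with x hx
  exact (D.link_y_strip hε ⟨hx.1.le, hx.2⟩).symm

theorem strandsBelow_strip {ε : ℝ} (hε : 0 < ε) {ξ c : ℝ} (hξ : ξ ∈ Ico D.u 1) :
    strandsBelow (D.link hε).x (D.link hε).y (ξ, c) = {k | D.stripY ε k ξ < c}.ncard := by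
  change strandsBelow L.x (D.link hε).y (ξ, c) = _
  rw [strandsBelow_eq_of_isStrandsAt (D.link hε).periodic_y (D.isStrandsAt ξ hξ)
    (D.mem_Ico_zero_one hξ), ← ncard_image_of_injective _ D.strand.injective]
  congr 1
  ext b
  constructor
  · intro hb
    refine ⟨D.strand.symm b, ?_, D.strand.apply_symm_apply b⟩
    change D.stripY ε _ ξ < c
    rw [← D.link_y_strip hε hξ, D.strand.apply_symm_apply]
    exact hb
  · rintro ⟨k, hk, rfl⟩
    change (D.link hε).y (D.strand k).comp (D.σ (D.strand k) ξ) < c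
    rw [D.link_y_strip hε hξ]
    exact hk

variable {D}

theorem stripY_lt_of_dips {ε : ℝ} (hD : ∀ j k, j < k → ∃ a b, D.Dips ε j k a b) {j l : Fin n}
    (hjl : j < l) {ξ : ℝ} (hξ : ξ ∈ Ico D.u 1) (h : ξ ≤ D.start l ∨ D.start l + D.w ≤ ξ) :
    D.stripY ε j ξ < D.stripY ε l ξ := by
  obtain ⟨a, b, hab⟩ := hD j l hjl
  rcases h with h | h
  · exact hab.before ξ hξ (h.trans_lt hab.start_lt)
  · exact hab.after ξ hξ (hab.lt_start.trans_le h)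

theorem mem_window {k : Fin n} {ξ : ℝ} (h : ξ ∈ Ioo (D.start k) (D.start k + D.w)) :
    ξ ∈ Ioo D.u 1 :=
  ⟨by linarith [h.1, D.u_add_le_start k, D.S.pos],
    by linarith [h.2, D.start_add_le_one k, D.S.pos]⟩

/-- While the strand `k` dips, the other strands do not cross each other. -/
theorem stripY_lt_of_ne {ε : ℝ} (hD : ∀ j k, j < k → ∃ a b, D.Dips ε j k a b) {j l k : Fin n}
    (hjl : j < l) (hl : l ≠ k) {ξ : ℝ} (hξ : ξ ∈ Ioo (D.start k) (D.start k + D.w)) :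
    D.stripY ε j ξ < D.stripY ε l ξ := by
  have hξ' := mem_window hξ
  refine stripY_lt_of_dips hD hjl ⟨hξ'.1.le, hξ'.2⟩ ?_
  rcases lt_or_gt_of_ne hl with h | h
  · exact Or.inr ((D.start_add_le (show (l : ℕ) < k from h)).trans hξ.1.le)
  · exact Or.inl (hξ.2.le.trans (D.start_add_le (show (k : ℕ) < l from h)))

/-- While `k` dips, the other strands keep their order. Hence exactly the strands below `j` lie
below the crossing of `k` with `j`, and no third strand passes through it. -/
theorem strip_position {ε : ℝ} (hε : 0 < ε) (hD : ∀ j k, j < k → ∃ a b, D.Dips ε j k a b)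
    {j k : Fin n} (hjk : j < k) {ξ : ℝ} (hξ : ξ ∈ Ioo (D.start k) (D.start k + D.w))
    (heq : D.stripY ε k ξ = D.stripY ε j ξ) :
    strandsBelow (D.link hε).x (D.link hε).y (ξ, D.stripY ε j ξ) = j ∧
    ∀ r ∈ Par ι, point (D.link hε).x (D.link hε).y r = (ξ, D.stripY ε j ξ) →
      r = D.pt j ξ ∨ r = D.pt k ξ := by
  have hξ' := mem_window hξ
  have hξ'' : ξ ∈ Ico D.u 1 := ⟨hξ'.1.le, hξ'.2⟩
  constructor
  · rw [D.strandsBelow_strip hε hξ'']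
    have : {l | D.stripY ε l ξ < D.stripY ε j ξ} = Finset.Iio j := by
      ext l
      rw [Finset.coe_Iio, mem_ofPred_eq, Set.mem_Iio]
      constructor
      · intro h
        by_contra hlj
        rcases (not_lt.mp hlj).lt_or_eq with h' | rfl
        · by_cases hlk : l = k
          · rw [hlk, heq] at h
            exact lt_irrefl _ h
          · exact lt_asymm h (stripY_lt_of_ne hD h' hlk hξ)
        · exact lt_irrefl _ h
      · exact fun h => stripY_lt_of_ne hD h hjk.ne hξ
    rw [this, ncard_coe_finset, Fin.card_Iio]
  · intro r hr hpt
    obtain ⟨l, rfl⟩ := D.exists_eq_pt hξ'' hr (congrArg Prod.fst hpt)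
    rw [D.point_pt hε hξ''] at hpt
    have hl := congrArg Prod.snd hpt
    simp only at hl
    by_cases hlk : l = k
    · exact Or.inr (by rw [hlk])
    · rcases lt_trichotomy l j with h | rfl | h
      · exact absurd hl (stripY_lt_of_ne hD h hjk.ne hξ).ne
      · exact Or.inl rfl
      · exact absurd hl (stripY_lt_of_ne hD h hlk hξ).ne'

/-- The derivative of the difference of `y` is the difference of slopes. The dipping strand has the
larger `z`, so it is the overstrand both on the way down and on the way up. -/
theorem isCrossingItem_strip {ε : ℝ} (hε : 0 < ε) (hD : ∀ j k, j < k → ∃ a b, D.Dips ε j k a b)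
    {j k : Fin n} (hjk : j < k) {ξ : ℝ} (hξ : ξ ∈ Ioo (D.start k) (D.start k + D.w))
    (heq : D.stripY ε k ξ = D.stripY ε j ξ) {d : ℝ}
    (hd : HasDerivAt (fun ξ => D.stripY ε k ξ - D.stripY ε j ξ) d ξ) :
    (d < 0 → (D.link hε).IsCrossingItem ((ξ, D.stripY ε j ξ), ⟨.lesserOver, j⟩)) ∧
    (0 < d → (D.link hε).IsCrossingItem ((ξ, D.stripY ε j ξ), ⟨.greaterOver, j⟩)) := by
  have hξ' := mem_window hξ
  have hξ'' : ξ ∈ Ico D.u 1 := ⟨hξ'.1.le, hξ'.2⟩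
  obtain ⟨hpos, huniq⟩ := strip_position hε hD hjk hξ heq
  have hslope : d = (D.link hε).slope (D.pt k ξ) - (D.link hε).slope (D.pt j ξ) :=
    hd.unique ((D.hasDerivAt_stripY hε k hξ').sub (D.hasDerivAt_stripY hε j hξ'))
  have hpk : point (D.link hε).x (D.link hε).y (D.pt k ξ) = (ξ, D.stripY ε j ξ) := by
    rw [D.point_pt hε hξ'', heq]
  have hpj := D.point_pt hε (k := j) hξ''
  have hne : D.pt k ξ ≠ D.pt j ξ := fun h => hjk.ne' (D.pt_injective hξ'' h)
  have hover : (D.link hε).CrossesOver (ξ, D.stripY ε j ξ) (D.pt k ξ) (D.pt j ξ) :=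
    ⟨parOf_mem _, parOf_mem _, hne, hpk, hpj, deform_z_lt _ _
      ((D.fract_x_pt hξ'').trans (D.fract_x_pt hξ'').symm) (D.z_pt_lt hjk hξ'')⟩
  have hpair : d ≠ 0 → ∃ p ∈ Par ι, ∃ q ∈ Par ι, p ≠ q ∧
      point (D.link hε).x (D.link hε).y p = (ξ, D.stripY ε j ξ) ∧
      point (D.link hε).x (D.link hε).y q = (ξ, D.stripY ε j ξ) ∧
      der (D.link hε).x p ≠ 0 ∧ der (D.link hε).x q ≠ 0 ∧
      (D.link hε).slope p ≠ (D.link hε).slope q ∧ ∀ r ∈ Par ι,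
        point (D.link hε).x (D.link hε).y r = (ξ, D.stripY ε j ξ) → r = p ∨ r = q := fun h0 =>
    ⟨D.pt j ξ, parOf_mem _, D.pt k ξ, parOf_mem _, hne.symm, hpj, hpk, D.der_x_pt_ne hξ'',
      D.der_x_pt_ne hξ'', fun h => h0 (by rw [hslope, h, sub_self]), huniq⟩
  have hcut : ξ ≠ 0 := (D.u_pos.trans hξ'.1).ne'
  exact ⟨fun h => ⟨hcut, ⟨hpos.symm, _, _, hover, by linarith⟩, hpair h.ne⟩,
    fun h => ⟨hcut, ⟨hpos.symm, _, _, hover, by linarith⟩, hpair h.ne'⟩⟩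

/-- All double points of the deformed link in the strip. -/
theorem exists_dips_of_double {ε : ℝ} (hε : 0 < ε) {p q : ι × ℝ} (hp : p ∈ Par ι) (hq : q ∈ Par ι)
    (hne : p ≠ q) (h : point (D.link hε).x (D.link hε).y p = point (D.link hε).x (D.link hε).y q)
    (hu : D.u ≤ Int.fract (L.x p.1 p.2)) {a b : Fin n → Fin n → ℝ}
    (hab : ∀ j k, j < k → D.Dips ε j k (a j k) (b j k)) : ∃ j k, j < k ∧
      (point (D.link hε).x (D.link hε).y p = (a j k, D.stripY ε j (a j k)) ∨
       point (D.link hε).x (D.link hε).y p = (b j k, D.stripY ε j (b j k))) := by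
  have hξ : Int.fract (L.x p.1 p.2) ∈ Ico D.u 1 := ⟨hu, Int.fract_lt_one _⟩
  set ξ := Int.fract (L.x p.1 p.2)
  obtain ⟨j, hj⟩ := D.exists_eq_pt hξ hp rfl
  obtain ⟨k, hk⟩ := D.exists_eq_pt hξ hq (congrArg Prod.fst h).symm
  have key : ∀ j k, j < k → D.stripY ε j ξ = D.stripY ε k ξ →
      (ξ, D.stripY ε j ξ) = (a j k, D.stripY ε j (a j k)) ∨
      (ξ, D.stripY ε j ξ) = (b j k, D.stripY ε j (b j k)) := by
    intro j k hjk heq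
    have hd := hab j k hjk
    rcases lt_trichotomy ξ (a j k) with h1 | h1 | h1
    · exact absurd heq (hd.before ξ hξ h1).ne
    · exact Or.inl (by rw [h1])
    rcases lt_trichotomy ξ (b j k) with h2 | h2 | h2
    · exact absurd heq (hd.between ξ h1 h2).ne'
    · exact Or.inr (by rw [h2])
    · exact absurd heq (hd.after ξ hξ h2).ne
  have hpp := D.point_pt hε (k := j) hξ
  have hqq := D.point_pt hε (k := k) hξ
  rw [← hj] at hpp
  rw [← hk] at hqq
  have heq : D.stripY ε j ξ = D.stripY ε k ξ := congrArg Prod.snd (hpp.symm.trans (h.trans hqq))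
  rcases lt_trichotomy j k with hjk | hjk | hjk
  · exact ⟨j, k, hjk, by rw [hpp]; exact key j k hjk heq⟩
  · exact absurd (hj.trans (by rw [hjk, ← hk])) hne
  · exact ⟨k, j, hjk, by rw [h, hqq]; exact key k j hjk heq.symm⟩

/-- The dips are nested. -/
theorem Dips.nested {ε : ℝ} (hD : ∀ j k, j < k → ∃ a b, D.Dips ε j k a b) {i j k : Fin n}
    (hij : i < j) (hjk : j < k) {a b a' b' : ℝ} (h : D.Dips ε j k a b) (h' : D.Dips ε i k a' b') :
    a < a' ∧ b' < b := by
  -- Where `k` meets `i` it is below `j`, which is still above `i`; so this happens strictly within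
  -- the dip of `k` below `j`.
  have hmem : ∀ ξ ∈ Ioo (D.start k) (D.start k + D.w), D.stripY ε k ξ = D.stripY ε i ξ →
      a < ξ ∧ ξ < b := by
    intro ξ hξ heq
    have hξ' := mem_window hξ
    have hlt : D.stripY ε k ξ < D.stripY ε j ξ := by
      rw [heq]; exact stripY_lt_of_ne hD hij hjk.ne hξ
    constructor
    · by_contra hle
      rcases (not_lt.mp hle).lt_or_eq with h1 | h1
      · exact lt_asymm hlt (h.before ξ ⟨hξ'.1.le, hξ'.2⟩ h1)
      · rw [h1, h.eq_left] at hlt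
        exact lt_irrefl _ hlt
    · by_contra hle
      rcases (not_lt.mp hle).lt_or_eq with h1 | h1
      · exact lt_asymm hlt (h.after ξ ⟨hξ'.1.le, hξ'.2⟩ h1)
      · rw [← h1, h.eq_right] at hlt
        exact lt_irrefl _ hlt
  exact ⟨(hmem a' ⟨h'.start_lt, h'.lt.trans h'.lt_start⟩ h'.eq_left).1,
    (hmem b' ⟨h'.start_lt.trans h'.lt, h'.lt_start⟩ h'.eq_right).2⟩

end Strip

end LegendrianLink

end

section
open Set Filter Topology Projection

namespace LegendrianLink

variable {ι : Type*} {L : LegendrianLink ι}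

namespace Strip

variable {n : ℕ} (D : L.Strip n)

/-! ### Singularities outside the strip -/

theorem link_y_fract {ε : ℝ} (hε : 0 < ε) {r : ι × ℝ} (hu : Int.fract (L.x r.1 r.2) ≤ D.u) :
    (D.link hε).y r.1 r.2 =
      ε⁻¹ * Real.exp (ε⁻¹ * Int.fract (L.x r.1 r.2)) * (L.height ε r.1 r.2 + D.c) :=
  D.link_y_outer hε (Int.fract_add_floor _).symm ⟨Int.fract_nonneg _, hu⟩

theorem factor_pos {ε : ℝ} (hε : 0 < ε) (ξ : ℝ) : 0 < ε⁻¹ * Real.exp (ε⁻¹ * ξ) :=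
  mul_pos (inv_pos.mpr hε) (Real.exp_pos _)

theorem link_y_lt_iff {ε : ℝ} (hε : 0 < ε) {r s : ι × ℝ}
    (h : Int.fract (L.x r.1 r.2) = Int.fract (L.x s.1 s.2)) (hu : Int.fract (L.x s.1 s.2) ≤ D.u) :
    (D.link hε).y r.1 r.2 < (D.link hε).y s.1 s.2 ↔ L.height ε r.1 r.2 < L.height ε s.1 s.2 := by
  rw [D.link_y_fract hε hu, D.link_y_fract hε (h.trans_le hu), h,
    mul_lt_mul_iff_right₀ (factor_pos hε _), add_lt_add_iff_right]

theorem point_link_eq_iff {ε : ℝ} (hε : 0 < ε) {r s : ι × ℝ} (hu : Int.fract (L.x s.1 s.2) ≤ D.u) :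
    point (D.link hε).x (D.link hε).y r = point (D.link hε).x (D.link hε).y s ↔
      Int.fract (L.x r.1 r.2) = Int.fract (L.x s.1 s.2) ∧
        L.height ε r.1 r.2 = L.height ε s.1 s.2 := by
  refine Prod.ext_iff.trans (and_congr_right fun h => ?_)
  change Int.fract (L.x r.1 r.2) = Int.fract (L.x s.1 s.2) at h
  change (D.link hε).y r.1 r.2 = (D.link hε).y s.1 s.2 ↔ _
  rw [D.link_y_fract hε hu, D.link_y_fract hε (h.trans_le hu), h,
    mul_right_inj' (factor_pos hε _).ne', add_left_inj]

theorem strandsBelow_outer {ε : ℝ} (hε : 0 < ε) {s : ι × ℝ} (hu : Int.fract (L.x s.1 s.2) ≤ D.u) :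
    strandsBelow (D.link hε).x (D.link hε).y (point (D.link hε).x (D.link hε).y s) =
      strandsBelow L.x (L.height ε) (Int.fract (L.x s.1 s.2), L.height ε s.1 s.2) :=
  strandsBelow_congr fun _ _ h => D.link_y_lt_iff hε h hu

/-- At a crossing of the perturbed front the term with `height` agrees on both strands, so the
slopes of the deformed link are ordered like those of the perturbed front. -/
theorem slope_outer {ε : ℝ} (hε : 0 < ε) {r : ι × ℝ} (h0 : 0 < Int.fract (L.x r.1 r.2))
    (hu : Int.fract (L.x r.1 r.2) < D.u) (hd : der L.x r ≠ 0) :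
    (D.link hε).slope r = ε⁻¹ * Real.exp (ε⁻¹ * Int.fract (L.x r.1 r.2)) *
      (ε⁻¹ * (L.height ε r.1 r.2 + D.c) + L.heightSlope ε r) := by
  obtain ⟨i, t₀⟩ := r
  simp only at h0 hu ⊢
  change deriv (L.x i) t₀ ≠ 0 at hd
  set m := ⌊L.x i t₀⌋ with hm
  have hfr : Int.fract (L.x i t₀) = L.x i t₀ - m := rfl
  have hev : ∀ᶠ t in 𝓝 t₀, L.x i t - m ∈ Ioo 0 D.u :=
    ((L.smooth_x i).continuous.sub continuous_const).continuousAt.eventually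
      (isOpen_Ioo.mem_nhds ⟨h0, hu⟩)
  have h1 : HasDerivAt (fun t => ε⁻¹ * Real.exp (ε⁻¹ * (L.x i t - m)) * (L.height ε i t + D.c)) _ t₀ :=
    (((((hasDerivAt_x (L := L) i t₀).sub_const (m : ℝ)).const_mul ε⁻¹).exp).const_mul ε⁻¹).mul
      (((hasDerivAt_z (L := L) i t₀).add ((hasDerivAt_y (L := L) i t₀).const_mul ε)).add_const D.c)
  have h2 : (D.link hε).y i =ᶠ[𝓝 t₀]
      fun t => ε⁻¹ * Real.exp (ε⁻¹ * (L.x i t - m)) * (L.height ε i t + D.c) := by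
    filter_upwards [hev] with t ht
    exact D.link_y_outer hε (m := m) (by ring) ⟨ht.1.le, ht.2.le⟩
  rw [slope, der, h2.deriv_eq, h1.deriv, hfr]
  change _ / deriv (L.x i) t₀ = _
  simp only [heightSlope, height, der]
  field_simp

theorem isCrossingItem_outer {ε : ℝ} (hε : 0 < ε) {P : ℝ × ℝ} {p q : ι × ℝ}
    (h : L.ResolvesAt P ε p q) (h0 : 0 < Int.fract (L.x p.1 p.2))
    (hu : Int.fract (L.x p.1 p.2) < D.u) : (D.link hε).IsCrossingItem
      (point (D.link hε).x (D.link hε).y p, ⟨.lesserOver, strandsBelow L.x L.z P⟩) := by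
  have hne : p ≠ q := fun hpq => (h.z_lt.trans_eq (by rw [hpq])).false
  have hqp : point (D.link hε).x (D.link hε).y q = point (D.link hε).x (D.link hε).y p :=
    (D.point_link_eq_iff hε hu.le).mpr ⟨h.fract_eq.symm, h.height_eq.symm⟩
  have hslope : (D.link hε).slope p < (D.link hε).slope q := by
    rw [D.slope_outer hε h0 hu h.regular_left, D.slope_outer hε (h.fract_eq ▸ h0)
      (h.fract_eq ▸ hu) h.regular_right, ← h.fract_eq, ← h.height_eq]
    exact mul_lt_mul_of_pos_left (by linarith [h.slope_lt]) (factor_pos hε _)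
  refine ⟨h0.ne', ⟨?_, p, q, ⟨h.mem_left, h.mem_right, hne, rfl, hqp,
    deform_z_lt _ _ h.fract_eq h.z_lt⟩, hslope⟩, p, h.mem_left, q, h.mem_right, hne, rfl, hqp,
    h.regular_left, h.regular_right, hslope.ne, fun r hr hrp => ?_⟩
  · rw [D.strandsBelow_outer hε hu.le, h.strands]
  · obtain ⟨h1, h2⟩ := (D.point_link_eq_iff hε hu.le).mp hrp
    exact h.eq_or_eq r hr h1 h2

theorem isTurnItem_outer {ε : ℝ} (hε : 0 < ε) {p : ι × ℝ} (hp : p ∈ Par ι) (hd : der L.x p = 0)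
    (h0 : Int.fract (L.x p.1 p.2) ≠ 0) (hu : Int.fract (L.x p.1 p.2) < D.u)
    (hpos : strandsBelow L.x (L.height ε) (Int.fract (L.x p.1 p.2), L.height ε p.1 p.2) =
      strandsBelow L.x L.z (point L.x L.z p))
    (hdouble : ∀ r ∈ Par ι, ¬ L.IsDouble (ε, p, r)) :
    (LeftTurn L.x p → (D.link hε).IsTurnItem (point (D.link hε).x (D.link hε).y p,
      ⟨.leftTurn, strandsBelow L.x L.z (point L.x L.z p)⟩)) ∧
    (RightTurn L.x p → (D.link hε).IsTurnItem (point (D.link hε).x (D.link hε).y p,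
      ⟨.rightTurn, strandsBelow L.x L.z (point L.x L.z p)⟩)) := by
  have hpos' := (D.strandsBelow_outer hε hu.le).trans hpos
  have huniq : ∀ r ∈ Par ι, point (D.link hε).x (D.link hε).y r =
      point (D.link hε).x (D.link hε).y p → r = p := by
    intro r hr hrp
    by_contra hne
    obtain ⟨h1, h2⟩ := (D.point_link_eq_iff hε hu.le).mp hrp
    exact hdouble r hr ⟨Ne.symm hne, h1.symm, h2.symm⟩
  exact ⟨fun h => ⟨h0, ⟨hpos'.symm, p, hp, rfl, h⟩, p, hp, rfl, hd, huniq⟩,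
    fun h => ⟨h0, ⟨hpos'.symm, p, hp, rfl, h⟩, p, hp, rfl, hd, huniq⟩⟩

end Strip

/-! ### The list of singularities of the resolution -/

/-- The pieces of the resolution of a singularity, where the turning points of cusps are placed at
the points `T` and the crossings at the points `C`. -/
def frontItems (T C : ℝ × ℝ → ℝ × ℝ) (a : (ℝ × ℝ) × FrontEvent) : List ((ℝ × ℝ) × DiagramEvent) :=
  match a.2.kind with
  | .leftCusp => [(T a.1, ⟨.leftTurn, a.2.pos⟩)]
  | .rightCusp => [(C a.1, ⟨.lesserOver, a.2.pos⟩), (T a.1, ⟨.rightTurn, a.2.pos⟩)]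
  | .crossing => [(C a.1, ⟨.lesserOver, a.2.pos⟩)]

theorem map_snd_frontItems (T C : ℝ × ℝ → ℝ × ℝ) (a : (ℝ × ℝ) × FrontEvent) :
    (frontItems T C a).map Prod.snd = a.2.resolve := by
  obtain ⟨P, k, m⟩ := a
  cases k <;> rfl

/-- The front has a cusp at `P`. -/
def HasTurn (L : LegendrianLink ι) (P : ℝ × ℝ) : Prop :=
  ∃ p ∈ Par ι, point L.x L.z p = P ∧ der L.x p = 0

theorem IsFrontEvent.mem_frontItems {T C : ℝ × ℝ → ℝ × ℝ} {P : ℝ × ℝ} {e : FrontEvent}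
    (h : L.IsFrontEvent P e) {d : (ℝ × ℝ) × DiagramEvent} (hd : d ∈ frontItems T C (P, e)) :
    (d = (C P, ⟨.lesserOver, strandsBelow L.x L.z P⟩) ∧ L.HasCrossing P) ∨
    (d = (T P, ⟨.leftTurn, strandsBelow L.x L.z P⟩) ∧
      ∃ p ∈ Par ι, point L.x L.z p = P ∧ LeftTurn L.x p) ∨
    (d = (T P, ⟨.rightTurn, strandsBelow L.x L.z P⟩) ∧
      ∃ p ∈ Par ι, point L.x L.z p = P ∧ RightTurn L.x p) := by
  obtain ⟨k, m⟩ := e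
  obtain ⟨h1, h2⟩ := h
  simp only at h1
  subst h1
  cases k <;> simp only [frontItems, List.mem_cons, List.not_mem_nil, or_false] at hd h2
  · exact Or.inr (Or.inl ⟨hd, h2⟩)
  · rcases hd with hd | hd
    · exact Or.inl ⟨hd, Or.inl h2⟩
    · exact Or.inr (Or.inr ⟨hd, h2⟩)
  · exact Or.inl ⟨hd, Or.inr h2⟩

theorem HasTurn.not_double (hL : L.GenericFront) {P : ℝ × ℝ} (h : L.HasTurn P) {p q : ι × ℝ}
    (hp : p ∈ Par ι) (hq : q ∈ Par ι) (hpP : point L.x L.z p = P) (hqP : point L.x L.z q = P) :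
    p = q := by
  obtain ⟨r, hr, hrP, hd⟩ := h
  have key : ∀ p ∈ Par ι, point L.x L.z p = P → r = p := fun p hp hpP => by
    by_contra hne
    exact hL.double_ne_turn r hr p hp hne (hrP.trans hpP.symm) hd
  rw [← key p hp hpP, ← key q hq hqP]

theorem exists_mem_frontItems_of_turn (hL : L.GenericFront) {T C : ℝ × ℝ → ℝ × ℝ} {P : ℝ × ℝ}
    {e : FrontEvent} (h : L.IsFrontEvent P e) (ht : L.HasTurn P) :
    ∃ d ∈ frontItems T C (P, e), d.1 = T P := by
  obtain ⟨k, m⟩ := e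
  obtain ⟨-, h2⟩ := h
  cases k
  · exact ⟨_, List.mem_singleton.mpr rfl, rfl⟩
  · exact ⟨_, List.mem_cons_of_mem _ (List.mem_singleton.mpr rfl), rfl⟩
  · obtain ⟨p, hp, q, hq, hne, hpP, hqP⟩ := h2
    exact absurd (ht.not_double hL hp hq hpP hqP) hne

theorem exists_mem_frontItems_of_crossing (hL : L.GenericFront) {T C : ℝ × ℝ → ℝ × ℝ} {P : ℝ × ℝ}
    {e : FrontEvent} (h : L.IsFrontEvent P e) (hc : L.HasCrossing P) :
    ∃ d ∈ frontItems T C (P, e), d.1 = C P := by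
  obtain ⟨k, m⟩ := e
  obtain ⟨-, h2⟩ := h
  cases k
  · obtain ⟨p, hp, hpP, ht⟩ := h2
    have hT : L.HasTurn P := ⟨p, hp, hpP, ht.1⟩
    rcases hc with ⟨q, hq, hqP, hr⟩ | ⟨q, hq, r, hr, hne, hqP, hrP⟩
    · rw [hT.not_double hL hp hq hpP hqP] at ht
      exact absurd ht.2 hr.2.not_gt
    · exact absurd (hT.not_double hL hq hr hqP hrP) hne
  · exact ⟨_, List.mem_cons_self, rfl⟩
  · exact ⟨_, List.mem_cons_self, rfl⟩

/-- The singularities of the resolution, cusp by cusp and crossing by crossing, are in reading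
order up to sliding crossings to the left. -/
theorem pairwise_frontItems [Finite ι] (hL : L.GenericFront) {T C : ℝ × ℝ → ℝ × ℝ}
    (hT₁ : ∀ P, L.HasTurn P → (T P).1 = P.1)
    (hT₂ : ∀ P Q, L.HasTurn P → L.HasTurn Q → P.1 = Q.1 → Q.2 < P.2 → (T Q).2 < (T P).2)
    (hC₁ : ∀ P, L.HasCrossing P → (C P).1 < P.1)
    (hC₂ : ∀ P Q, L.HasCrossing P → Singular L.x L.z Q → Q.1 < P.1 → Q.1 < (C P).1)
    {m : List ((ℝ × ℝ) × FrontEvent)} (hm : ∀ a ∈ m, Singular L.x L.z a.1 ∧ L.IsFrontEvent a.1 a.2)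
    (hpw : m.Pairwise fun a b => ReadsBefore a.1 b.1) :
    (m.flatMap (frontItems T C)).Pairwise
      fun d d' => ReadsBefore d.1 d'.1 ∨ SlidesLeft d.2 d'.2 := by
  rw [List.pairwise_flatMap]
  constructor
  · rintro ⟨P, k, pos⟩ ha
    obtain ⟨-, -, h2⟩ := hm _ ha
    cases k
    · exact List.pairwise_singleton _ _
    · refine List.pairwise_cons.mpr ⟨fun d hd => ?_, List.pairwise_singleton _ _⟩
      rw [List.mem_singleton.mp hd]
      obtain ⟨p, hp, hpP, ht⟩ := h2
      refine Or.inl (Or.inl ?_)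
      rw [hT₁ P ⟨p, hp, hpP, ht.1⟩]
      exact hC₁ P (Or.inl ⟨p, hp, hpP, ht⟩)
    · exact List.pairwise_singleton _ _
  · refine hpw.imp_of_mem ?_
    rintro ⟨P, e⟩ ⟨Q, f⟩ ha hb hPQ d hd d' hd'
    obtain ⟨hPs, hPe⟩ := hm _ ha
    obtain ⟨hQs, hQe⟩ := hm _ hb
    simp only at hPQ hPs hPe hQs hQe
    have hdc : (d.1 = C P ∧ L.HasCrossing P) ∨ (d.1 = T P ∧ L.HasTurn P) := by
      rcases hPe.mem_frontItems hd with ⟨rfl, h⟩ | ⟨rfl, p, hp, hpP, ht⟩ | ⟨rfl, p, hp, hpP, ht⟩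
      · exact Or.inl ⟨rfl, h⟩
      · exact Or.inr ⟨rfl, p, hp, hpP, ht.1⟩
      · exact Or.inr ⟨rfl, p, hp, hpP, ht.1⟩
    have hdp : d.2.pos = strandsBelow L.x L.z P := by
      rcases hPe.mem_frontItems hd with ⟨rfl, h⟩ | ⟨rfl, h⟩ | ⟨rfl, h⟩ <;> rfl
    have hdc' : (d' = (C Q, ⟨.lesserOver, strandsBelow L.x L.z Q⟩) ∧ L.HasCrossing Q) ∨
        (d'.1 = T Q ∧ L.HasTurn Q) := by
      rcases hQe.mem_frontItems hd' with h | ⟨rfl, p, hp, hpP, ht⟩ | ⟨rfl, p, hp, hpP, ht⟩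
      · exact Or.inl h
      · exact Or.inr ⟨rfl, p, hp, hpP, ht.1⟩
      · exact Or.inr ⟨rfl, p, hp, hpP, ht.1⟩
    have hle : d.1.1 ≤ P.1 := by
      rcases hdc with ⟨h, h'⟩ | ⟨h, h'⟩ <;> rw [h]
      · exact (hC₁ P h').le
      · exact (hT₁ P h').le
    rcases hPQ with hlt | ⟨hx, hz⟩
    -- The crossing of `Q` moves to the left, but not as far as an earlier singularity.
    · refine Or.inl (Or.inl (hle.trans_lt ?_))
      rcases hdc' with ⟨rfl, h'⟩ | ⟨h, h'⟩
      · exact hC₂ Q P h' hPs hlt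
      · rw [h, hT₁ Q h']
        exact hlt
    · rcases hdc' with ⟨rfl, h'⟩ | ⟨h, h'⟩
      -- On a common vertical line the crossing of the lower singularity may overtake a piece above
      -- it; this is the one case that needs a planar move.
      · refine Or.inr ⟨rfl, rfl, ?_⟩
        rw [hdp]
        exact strandsBelow_add_two_le hL h' hx hz
      · left
        rcases hdc with ⟨h1, h1'⟩ | ⟨h1, h1'⟩
        · left
          rw [h, h1, hT₁ Q h', ← hx]
          exact hC₁ P h1'
        · right
          rw [h, h1, hT₁ Q h', hT₁ P h1']
          exact ⟨hx, hT₂ P Q h1' h' hx hz⟩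

end LegendrianLink

end

/-! ### Assembling the diagram for one small parameter -/

section
open Set Filter Topology Projection

namespace LegendrianLink

variable {ι : Type*} {L : LegendrianLink ι}

/-- Properties of the perturbed fronts that hold for all small `ε`. -/
structure IsSmall (L : LegendrianLink ι) (p q : ∀ P, L.HasCrossing P → ℝ → ι × ℝ) (ε : ℝ) :
    Prop where
  resolves : ∀ P h, L.ResolvesAt P ε (p P h ε) (q P h ε)
  fract_lt : ∀ P h, Int.fract (L.x (p P h ε).1 (p P h ε).2) < P.1
  fract_pos : ∀ P h, 0 < Int.fract (L.x (p P h ε).1 (p P h ε).2)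
  lt_fract : ∀ P h Q, Singular L.x L.z Q → Q.1 < P.1 →
    Q.1 < Int.fract (L.x (p P h ε).1 (p P h ε).2)
  isDouble_imp : ∀ r ∈ Par ι, ∀ s ∈ Par ι, L.IsDouble (ε, r, s) →
    ∃ P h, r = p P h ε ∨ r = q P h ε
  turn : ∀ r ∈ Par ι, der L.x r = 0 →
    strandsBelow L.x (L.height ε) (Int.fract (L.x r.1 r.2), L.height ε r.1 r.2) =
      strandsBelow L.x L.z (point L.x L.z r)
  turn_lt : ∀ r ∈ Par ι, der L.x r = 0 → ∀ s ∈ Par ι, der L.x s = 0 →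
    L.z r.1 r.2 < L.z s.1 s.2 → L.height ε r.1 r.2 < L.height ε s.1 s.2

theorem Singular.fst_pos (hL : L.GenericFront) {P : ℝ × ℝ} (h : Singular L.x L.z P) : 0 < P.1 := by
  rcases h with ⟨p, hp, rfl, hd⟩ | ⟨p, hp, q, hq, hne, rfl, hqP⟩
  · exact lt_of_le_of_ne (Int.fract_nonneg _) (hL.turn_off_cut p hp hd).symm
  · exact lt_of_le_of_ne (Int.fract_nonneg _) (hL.double_off_cut p hp q hq hne hqP.symm).symm

theorem eventually_isSmall [Finite ι] (hL : L.GenericFront)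
    {p q : ∀ P, L.HasCrossing P → ℝ → ι × ℝ} (hpq : ∀ P h, L.IsResolution P (p P h) (q P h)) :
    ∀ᶠ ε in 𝓝[>] 0, L.IsSmall p q ε := by
  have hfin := finite_singular hL
  have hturn := finite_turn hL
  have h1 : ∀ᶠ ε in 𝓝[>] 0, ∀ P ∈ {P | Singular L.x L.z P}, ∀ h : L.HasCrossing P,
      L.ResolvesAt P ε (p P h ε) (q P h ε) ∧ Int.fract (L.x (p P h ε).1 (p P h ε).2) < P.1 ∧
      0 < Int.fract (L.x (p P h ε).1 (p P h ε).2) ∧ ∀ Q ∈ {P | Singular L.x L.z P}, Q.1 < P.1 →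
        Q.1 < Int.fract (L.x (p P h ε).1 (p P h ε).2) := by
    refine hfin.eventually_all.mpr fun P hP => eventually_all.mpr fun h => ?_
    have ht := (hpq P h).tendsto
    have h2 : ∀ᶠ ξ in 𝓝[<] P.1, ∀ Q ∈ {P | Singular L.x L.z P}, Q.1 < P.1 → Q.1 < ξ := by
      refine hfin.eventually_all.mpr fun Q _ => ?_
      by_cases h : Q.1 < P.1
      · exact nhdsWithin_le_nhds ((lt_mem_nhds h).mono fun ξ hξ _ => hξ)
      · exact Eventually.of_forall fun ξ h' => absurd h' h
    filter_upwards [(hpq P h).resolves, ht.eventually h2,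
      ht.eventually (eventually_mem_nhdsWithin (s := Iio P.1)),
      ht.eventually (nhdsWithin_le_nhds (lt_mem_nhds (Singular.fst_pos hL hP)))]
      with ε h3 h4 h5 h6 using ⟨h3, h5, h6, h4⟩
  have h2 : ∀ᶠ ε in 𝓝[>] 0, ∀ r ∈ {p ∈ Par ι | der L.x p = 0},
      strandsBelow L.x (L.height ε) (Int.fract (L.x r.1 r.2), L.height ε r.1 r.2) =
        strandsBelow L.x L.z (point L.x L.z r) :=
    hturn.eventually_all.mpr fun r hr => eventually_strandsBelow_turn hL hr.1 hr.2
  have h3 : ∀ᶠ ε in 𝓝[>] 0, ∀ r ∈ {p ∈ Par ι | der L.x p = 0},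
      ∀ s ∈ {p ∈ Par ι | der L.x p = 0}, L.z r.1 r.2 < L.z s.1 s.2 →
        L.height ε r.1 r.2 < L.height ε s.1 s.2 := by
    refine hturn.eventually_all.mpr fun r _ => hturn.eventually_all.mpr fun s _ => ?_
    by_cases h : L.z r.1 r.2 < L.z s.1 s.2
    · exact (eventually_height_lt_height h).mono fun ε hε _ => hε
    · exact Eventually.of_forall fun ε h' => absurd h' h
  filter_upwards [h1, h2, h3, eventually_isDouble_imp hL hpq] with ε h1 h2 h3 h4
  exact ⟨fun P h => (h1 P h.singular h).1, fun P h => (h1 P h.singular h).2.1,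
    fun P h => (h1 P h.singular h).2.2.1, fun P h => (h1 P h.singular h).2.2.2, h4,
    fun r hr hd => h2 r ⟨hr, hd⟩, fun r hr hd s hs hd' => h3 r ⟨hr, hd⟩ s ⟨hs, hd'⟩⟩

/-- A turning point of the link is not a double point of the perturbed fronts. -/
theorem IsSmall.not_isDouble_turn {p q : ∀ P, L.HasCrossing P → ℝ → ι × ℝ} {ε : ℝ}
    (h : L.IsSmall p q ε) {r s : ι × ℝ} (hr : r ∈ Par ι) (hd : der L.x r = 0) (hs : s ∈ Par ι) :
    ¬ L.IsDouble (ε, r, s) := by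
  intro hrs
  obtain ⟨P, hP, rfl | rfl⟩ := h.isDouble_imp r hr s hs hrs
  · exact (h.resolves P hP).regular_left hd
  · exact (h.resolves P hP).regular_right hd

/-- A cusp belongs to a single point of the link, so its image in another projection is a function
of its place in the front. -/
theorem HasTurn.exists_image (hL : L.GenericFront) (v : ι → ℝ → ℝ) (P : ℝ × ℝ) : ∃ Q : ℝ × ℝ,
    ∀ p ∈ Par ι, point L.x L.z p = P → der L.x p = 0 → point L.x v p = Q := by
  by_cases h : L.HasTurn P
  · obtain ⟨r, hr, hrP, hd⟩ := id h
    exact ⟨point L.x v r, fun p hp hpP _ => by rw [h.not_double hL hp hr hpP hrP]⟩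
  · exact ⟨(0, 0), fun p hp hpP hd => absurd ⟨p, hp, hpP, hd⟩ h⟩

/-- The Lagrangian diagram of the deformed link. -/
theorem Strip.exists_diagram [Finite ι] {Z : FrontDiagram} (hZ : L.HasFront Z)
    (D : L.Strip (strandsAtCut L.x)) {p q : ∀ P, L.HasCrossing P → ℝ → ι × ℝ} {ε : ℝ} (hε : 0 < ε)
    (hsmall : L.IsSmall p q ε) (hdips : ∀ j k, j < k → ∃ a b, D.Dips ε j k a b) :
    ∃ Y : LinkDiagram, (D.link hε).HasLagrangianDiagram Y ∧ Y.PlanarIsotopic Z.resolution := by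
  obtain ⟨hL, hstr, l, hl, hmem, hread⟩ := hZ
  obtain ⟨hlen, hzip⟩ := List.forall₂_iff_zip.mp hread
  choose T hT using fun P => HasTurn.exists_image hL (D.link hε).y P
  have hC : ∀ P, ∃ Q : ℝ × ℝ, ∀ h : L.HasCrossing P,
      Q = point (D.link hε).x (D.link hε).y (p P h ε) := fun P => by
    by_cases h : L.HasCrossing P
    · exact ⟨point (D.link hε).x (D.link hε).y (p P h ε), fun _ => rfl⟩
    · exact ⟨(0, 0), fun h' => absurd h' h⟩
  choose C hC using hC
  have hab : ∀ j k, ∃ a b, j < k → D.Dips ε j k a b := fun j k => by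
    by_cases h : j < k
    · obtain ⟨a, b, hab⟩ := hdips j k h
      exact ⟨a, b, fun _ => hab⟩
    · exact ⟨0, 0, fun h' => absurd h' h⟩
  choose a b hab using hab
  -- The tangle is indexed by natural numbers and the strands by `Fin`; outside the range the points
  -- are defaults that never occur in the list.
  have hAB : ∀ k j : ℕ, ∃ A B : ℝ × ℝ, ∀ (hj : j < strandsAtCut L.x) (hk : k < strandsAtCut L.x),
      A = (a ⟨j, hj⟩ ⟨k, hk⟩, D.stripY ε ⟨j, hj⟩ (a ⟨j, hj⟩ ⟨k, hk⟩)) ∧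
      B = (b ⟨j, hj⟩ ⟨k, hk⟩, D.stripY ε ⟨j, hj⟩ (b ⟨j, hj⟩ ⟨k, hk⟩)) := fun k j => by
    by_cases h : j < strandsAtCut L.x ∧ k < strandsAtCut L.x
    · exact ⟨(a ⟨j, h.1⟩ ⟨k, h.2⟩, D.stripY ε ⟨j, h.1⟩ (a ⟨j, h.1⟩ ⟨k, h.2⟩)),
        (b ⟨j, h.1⟩ ⟨k, h.2⟩, D.stripY ε ⟨j, h.1⟩ (b ⟨j, h.1⟩ ⟨k, h.2⟩)), fun _ _ => ⟨rfl, rfl⟩⟩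
    · exact ⟨(0, 0), (0, 0), fun hj hk => absurd ⟨hj, hk⟩ h⟩
  choose A B hAB using hAB
  have hC₁ : ∀ P, L.HasCrossing P → (C P).1 < P.1 := fun P h => by
    rw [hC P h]; exact hsmall.fract_lt P h
  have hT₁ : ∀ P, L.HasTurn P → (T P).1 = P.1 := by
    rintro P ⟨r, hr, hrP, hd⟩
    rw [← hT P r hr hrP hd, ← hrP]
    rfl
  have hT₂ : ∀ P Q, L.HasTurn P → L.HasTurn Q → P.1 = Q.1 → Q.2 < P.2 → (T Q).2 < (T P).2 := by
    rintro P Q ⟨r, hr, hrP, hd⟩ ⟨s, hs, hsQ, hd'⟩ hx hz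
    rw [← hT P r hr hrP hd, ← hT Q s hs hsQ hd']
    have hu := (D.lt_u P (Or.inl ⟨r, hr, hrP, hd⟩)).le
    subst hrP hsQ
    exact (D.link_y_lt_iff hε hx.symm hu).mpr (hsmall.turn_lt s hs hd' r hr hd hz)
  have hC₂ : ∀ P Q, L.HasCrossing P → Singular L.x L.z Q → Q.1 < P.1 → Q.1 < (C P).1 :=
    fun P Q h hQ hlt => by rw [hC P h]; exact hsmall.lt_fract P h Q hQ hlt
  have hm : ∀ a ∈ l.zip Z.word, Singular L.x L.z a.1 ∧ L.IsFrontEvent a.1 a.2 := fun a ha =>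
    ⟨(hmem _).mp (List.of_mem_zip ha).1, hzip ha⟩
  have hexists : ∀ P, Singular L.x L.z P → ∃ e, (P, e) ∈ l.zip Z.word := fun P hP => by
    have h := (hmem P).mpr hP
    rw [← List.map_fst_zip hlen.le] at h
    obtain ⟨⟨P', e⟩, h1, rfl⟩ := List.mem_map.mp h
    exact ⟨e, h1⟩
  have hdip : ∀ j k, j < k → ∀ hk : k < strandsAtCut L.x, ∃ hj : j < strandsAtCut L.x,
      D.Dips ε ⟨j, hj⟩ ⟨k, hk⟩ (a ⟨j, hj⟩ ⟨k, hk⟩) (b ⟨j, hj⟩ ⟨k, hk⟩) ∧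
      A k j = (a ⟨j, hj⟩ ⟨k, hk⟩, D.stripY ε ⟨j, hj⟩ (a ⟨j, hj⟩ ⟨k, hk⟩)) ∧
      B k j = (b ⟨j, hj⟩ ⟨k, hk⟩, D.stripY ε ⟨j, hj⟩ (b ⟨j, hj⟩ ⟨k, hk⟩)) := fun j k hjk hk =>
    ⟨hjk.trans hk, hab _ _ hjk, hAB k j (hjk.trans hk) hk⟩
  have hitems : ∀ d ∈ (l.zip Z.word).flatMap (frontItems T C),
      ((D.link hε).IsCrossingItem d ∨ (D.link hε).IsTurnItem d) ∧ d.1.1 < D.u := by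
    intro d hd
    obtain ⟨⟨P, e⟩, ha, hd⟩ := List.mem_flatMap.mp hd
    obtain ⟨hPs, hPe⟩ := hm _ ha
    have hu := D.lt_u P hPs
    have hturn : ∀ r ∈ Par ι, point L.x L.z r = P → der L.x r = 0 →
        T P = point (D.link hε).x (D.link hε).y r ∧ (T P).1 < D.u ∧
        (LeftTurn L.x r → (D.link hε).IsTurnItem (T P, ⟨.leftTurn, strandsBelow L.x L.z P⟩)) ∧
        (RightTurn L.x r → (D.link hε).IsTurnItem (T P, ⟨.rightTurn, strandsBelow L.x L.z P⟩)) := by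
      intro r hr hrP hr₀
      refine ⟨(hT P r hr hrP hr₀).symm, by rw [hT₁ P ⟨r, hr, hrP, hr₀⟩]; exact hu, ?_⟩
      rw [← hT P r hr hrP hr₀]
      subst hrP
      exact D.isTurnItem_outer hε hr hr₀ (hL.turn_off_cut r hr hr₀) hu (hsmall.turn r hr hr₀)
        fun s hs => hsmall.not_isDouble_turn hr hr₀ hs
    rcases hPe.mem_frontItems hd with ⟨rfl, h⟩ | ⟨rfl, r, hr, hrP, ht⟩ | ⟨rfl, r, hr, hrP, ht⟩
    · have hlt := (hsmall.fract_lt P h).trans hu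
      refine ⟨Or.inl ?_, (hC₁ P h).trans hu⟩
      rw [hC P h]
      exact D.isCrossingItem_outer hε (hsmall.resolves P h) (hsmall.fract_pos P h) hlt
    · obtain ⟨-, h1, h2, -⟩ := hturn r hr hrP ht.1
      exact ⟨Or.inr (h2 ht), h1⟩
    · obtain ⟨-, h1, -, h2⟩ := hturn r hr hrP ht.1
      exact ⟨Or.inr (h2 ht), h1⟩
  have htangle : ∀ d ∈ tangleItems A B (strandsAtCut L.x),
      (D.link hε).IsCrossingItem d ∧ D.u < d.1.1 := by
    intro d hd
    obtain ⟨k, hk, hd⟩ := mem_tangleItems.mp hd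
    obtain ⟨j, hjk, hd⟩ := mem_dipItems.mp hd
    obtain ⟨hj, hdip, hA, hB⟩ := hdip j k hjk hk
    have hu := D.u_add_le_start k
    have hw := D.S.pos
    have h1 := hdip.start_lt
    have h2 := hdip.lt
    have h3 := hdip.lt_start
    simp only at h1 h3
    rcases hd with rfl | rfl
    · obtain ⟨e, he, hde⟩ := hdip.deriv_left
      rw [hA]
      exact ⟨(Strip.isCrossingItem_strip hε hdips hjk ⟨h1, h2.trans h3⟩ hdip.eq_left hde).1 he,
        by simp only; linarith⟩
    · obtain ⟨e, he, hde⟩ := hdip.deriv_right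
      rw [hB]
      exact ⟨(Strip.isCrossingItem_strip hε hdips hjk ⟨h1.trans h2, h3⟩ hdip.eq_right hde).2 he,
        by simp only; linarith⟩
  set c := (l.zip Z.word).flatMap (frontItems T C) ++ tangleItems A B (strandsAtCut L.x) with hc
  have hcitems : ∀ d ∈ c, (D.link hε).IsCrossingItem d ∨ (D.link hε).IsTurnItem d := by
    intro d hd
    rcases List.mem_append.mp hd with hd | hd
    · exact (hitems d hd).1
    · exact Or.inl (htangle d hd).1
  have hsing : ∀ Q, Singular (D.link hε).x (D.link hε).y Q → ∃ d ∈ c, d.1 = Q := by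
    rintro Q (⟨r, hr, hrQ, hd⟩ | ⟨r, hr, s, hs, hne, hrQ, hsQ⟩)
    · have ht : L.HasTurn (point L.x L.z r) := ⟨r, hr, rfl, hd⟩
      obtain ⟨e, he⟩ := hexists _ (Or.inl ht)
      obtain ⟨d, hd', hdT⟩ := exists_mem_frontItems_of_turn (T := T) (C := C) hL (hm _ he).2 ht
      refine ⟨d, List.mem_append_left _ (List.mem_flatMap.mpr ⟨_, he, hd'⟩), ?_⟩
      rw [hdT, ← hT _ r hr rfl hd]
      exact hrQ
    · have hrs := hrQ.trans hsQ.symm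
      -- Left of the strip a double point is one of the perturbed front; in the strip it belongs to
      -- a dip.
      rcases le_total (Int.fract (L.x r.1 r.2)) D.u with hu | hu
      · have hx : Int.fract (L.x r.1 r.2) = Int.fract (L.x s.1 s.2) := congrArg Prod.fst hrs
        have hdouble := (D.point_link_eq_iff hε (hx ▸ hu)).mp hrs
        obtain ⟨P, h, hP⟩ := hsmall.isDouble_imp r hr s hs ⟨hne, hdouble⟩
        obtain ⟨e, he⟩ := hexists _ h.singular
        obtain ⟨d, hd', hdC⟩ := exists_mem_frontItems_of_crossing (T := T) (C := C) hL (hm _ he).2 h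
        refine ⟨d, List.mem_append_left _ (List.mem_flatMap.mpr ⟨_, he, hd'⟩), ?_⟩
        rw [hdC, hC P h, ← hrQ]
        rcases hP with rfl | rfl
        · rfl
        · exact (D.point_link_eq_iff hε hu).mpr
            ⟨(hsmall.resolves P h).fract_eq, (hsmall.resolves P h).height_eq⟩
      · obtain ⟨j, k, hjk, h⟩ := D.exists_dips_of_double hε hr hs hne hrs hu hab
        obtain ⟨hA, hB⟩ := hAB k j j.2 k.2
        rw [← hrQ]
        rcases h with h | h <;> rw [h]
        · exact ⟨_, List.mem_append_right _ (mem_tangleItems.mpr ⟨k, k.2,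
            mem_dipItems.mpr ⟨j, hjk, Or.inl rfl⟩⟩), hA⟩
        · exact ⟨_, List.mem_append_right _ (mem_tangleItems.mpr ⟨k, k.2,
            mem_dipItems.mpr ⟨j, hjk, Or.inr rfl⟩⟩), hB⟩
  -- Resolved singularities precede the tangle because they lie left of `u`. Within the tangle, the
  -- windows order the dips and nesting orders the crossings of each dip.
  have hpw : c.Pairwise fun d d' => ReadsBefore d.1 d'.1 ∨ SlidesLeft d.2 d'.2 := by
    rw [List.pairwise_append]
    refine ⟨pairwise_frontItems hL hT₁ hT₂ hC₁ hC₂ hm ?_, ?_, fun d hd d' hd' =>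
      Or.inl (Or.inl ((hitems d hd).2.trans (htangle d' hd').2))⟩
    · rw [← List.map_fst_zip hlen.le, List.pairwise_map] at hl
      exact hl
    · refine (pairwise_tangleItems (s := D.start) (monotone_nat_of_le_succ fun k => ?_) ?_ ?_ ?_).imp
        fun h => Or.inl (Or.inl h)
      · linarith [D.start_add_le k.lt_succ_self, D.S.pos]
      · intro j k hjk hk
        obtain ⟨hj, hdip, hA, hB⟩ := hdip j k hjk hk
        rw [hA, hB]
        exact ⟨hdip.start_lt, hdip.lt, hdip.lt_start.trans_le (D.start_add_le k.lt_succ_self)⟩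
      · intro k hk i j hij hjk
        obtain ⟨hj, hdip₁, hA, -⟩ := hdip j k hjk hk
        obtain ⟨hi, hdip₂, hA', -⟩ := hdip i k (hij.trans hjk) hk
        rw [hA, hA']
        exact (Strip.Dips.nested hdips hij hjk hdip₁ hdip₂).1
      · intro k hk i j hij hjk
        obtain ⟨hj, hdip₁, -, hB⟩ := hdip j k hjk hk
        obtain ⟨hi, hdip₂, -, hB'⟩ := hdip i k (hij.trans hjk) hk
        rw [hB, hB']
        exact (Strip.Dips.nested hdips hij hjk hdip₁ hdip₂).2
  obtain ⟨Y, hY, hYs, hYw⟩ := exists_lagrangianDiagram (L := D.link hε) hL.nondegenerate hcitems hsing hpw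
  refine ⟨Y, hY, hYs.trans hstr.symm, ?_⟩
  rw [hc, List.map_append, List.map_flatMap, map_snd_tangleItems] at hYw
  simp only [map_snd_frontItems] at hYw
  rw [← List.flatMap_map, List.map_snd_zip hlen.ge] at hYw
  rw [FrontDiagram.resolution, hstr]
  exact hYw

/-- The conditions on the perturbed front and on the dips each hold for all small `ε > 0`, so a
common `ε` exists. -/
theorem exists_resolution [Finite ι] {Z : FrontDiagram} (hZ : L.HasFront Z) :
    ∃ (L' : LegendrianLink ι) (Y : LinkDiagram), LegendrianIsotopic L L' ∧
      L'.HasLagrangianDiagram Y ∧ Y.PlanarIsotopic Z.resolution := by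
  have hL := hZ.1
  obtain ⟨D⟩ := exists_strip hL
  choose p q hpq using fun P (h : L.HasCrossing P) => h.exists_isResolution hL
  have hpos : ∀ᶠ ε : ℝ in 𝓝[>] 0, 0 < ε := eventually_mem_nhdsWithin
  obtain ⟨ε, ⟨hsmall, hdips⟩, hε⟩ :=
    (((eventually_isSmall hL hpq).and D.eventually_dips).and hpos).exists
  obtain ⟨Y, hY, hYZ⟩ := D.exists_diagram hZ hε hsmall hdips
  exact ⟨D.link hε, Y, L.legendrianIsotopic_deform _ _, hY, hYZ⟩

end LegendrianLink

end

theorem mainTheorem11 {ι : Type*} [Finite ι] (L : LegendrianLink ι) (hL : L.GenericFront) :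
    (∃ Z : FrontDiagram, L.HasFront Z) ∧
    ∀ Z : FrontDiagram, L.HasFront Z →
      ∃ (L' : LegendrianLink ι) (Y : LinkDiagram),
        LegendrianIsotopic L L' ∧
        L'.HasLagrangianDiagram Y ∧
        Y.PlanarIsotopic Z.resolution := by
  exact ⟨LegendrianLink.exists_hasFront hL, fun _ hZ => LegendrianLink.exists_resolution hZ⟩
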